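/- **Setting.** Consider a linear system $x_{t+1}=Ax_t+Bu_t+w_t$, $y_t=Cx_t+e_t$ ($t\ge 1$, $y_t\in\mathbb R^{d_y}$, $u_t\in\mathbb R^{d_u}$) whose initial state $x_1$, disturbances $w_t,e_t$ and losses $\ell_t:\mathbb R^{d_y+d_u}\to\mathbb R$ are fixed in advance (oblivious adversary), and write $v_t=(y_t,u_t)$. All vector norms are Euclidean and all matrix norms $\|\cdot\|$ are the induced operator norms. Let $K\in\mathbb R^{d_u\times d_y}$ be a static feedback matrix, let $v^K_t$ be the signals obtained when $u_t=Ky_t$ is played, and let $G_K^{[0]}=\begin{bmatrix}0\\ I\end{bmatrix}$, $G_K^{[i]}=\begin{bmatrix}C\\KC\end{bmatrix}(A+BKC)^{i-1}B$ $(i\ge1)$ be the Markov operator from $u^{\rm ex}_t:=u_t-Ky_t$ to $v_t$. Assume: * each $\ell_t$ is $C^2$ with $|\ell_t(v)|\le L\max\{1,\|v\|^2\}$, $\|\nabla\ell_t(v)\|\le L\max\{1,\|v\|\}$ and $\alpha I\preceq\nabla^2\ell_t\preceq LI$, where $\alpha>0$; * $\|G_K^{[i]}\|\le c_K\rho_K^i$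 for all $i\ge 0$, where $c_K>0$, $\rho_K\in(0,1)$; * $\|v_t^K\|\le R_{\rm nat}$ for all $t$, where $R_{\rm nat}\ge1$; * $c_\star\ge c_K$, $\rho_K\le\rho_\star<1$, $T\ge2$ and $\delta\in(0,1/T)$. **Benchmark.** A linear dynamic controller $\pi$ is given by $s_{t+1}=A_\pi s_t+B_\pi y_t$, $u_t=C_\pi s_t+D_\pi y_t$, $s_1=0$, with signals $v^\pi_t$. Its closed-loop operator is $G_{\pi,\rm cl}^{[0]}=[D_\pi\ \ 0]$ and, for $i\ge1$, $$G_{\pi,\rm cl}^{[i]}=[(D_\pi-K)C\ \ C_\pi]\begin{bmatrix}A+BD_\pi C&BC_\pi\\B_\pi C&A_\pi\end{bmatrix}^{i-1}\begin{bmatrix}BD_\pi&-B\\B_\pi&0\end{bmatrix}.$$ Let $\Pi_\star$ be the set of all such $\pi$ with $\|G_{\pi,\rm cl}^{[i]}\|\le c_\star\rho_\star^i$ for all $i\ge 0$, and $\mathrm{ControlReg}_T=\sum_{t=1}^T\ell_t(v_t)-\inf_{\pi\in\Pi_\star}\sum_{t=1}^T\ell_t(v^\pi_t)$. **Algorithm**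 (DRC-ONS with estimation; parameters $h,m,N\in\mathbb N$ and $R_{\mathcal M},\lambda,\eta$). Always play $u_t=Ky_t+u_t^{\rm ex}$. 1. *Exploration and estimation.* For $t\le N$ draw $u_t^{\rm ex}\sim\mathcal N(0,I_{d_u})$ independently. Let $\hat G$ minimize $\sum_{t=h+1}^N\|v_t-\sum_{i=0}^h\hat G^{[i]}u^{\rm ex}_{t-i}\|^2$ subject to $\hat G^{[0]}=\begin{bmatrix}0\\I\end{bmatrix}$, with $\hat G^{[i]}=0$ for $i>h$. Also let $\hat G_y$ be either the $y$-block of $\hat G$ (static version of the algorithm), or a separate least-squares fit, in the same way, of the map from $u^{\rm ex}$ to $y$ with $\hat G_y^{[0]}=0$ (dynamic version with static controller $K$). 2. *Control.* Let $\hat y_t=y_t-\sum_{i=1}^{t-1}\hat G_y^{[i]}u^{\rm ex}_{t-i}$ and $\hat v_t=v_t-\sum_{i=0}^{t-1}\hat G^{[i]}u^{\rm ex}_{t-i}$. Let $\mathcal M=\{(M^{[i]})_{i=0}^{m-1}:M^{[i]}\in\mathbb R^{d_u\times d_y},\ \sum_i\|M^{[i]}\|\le R_{\mathcal M}\}$,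 identified with a set $\mathcal M_{\mathfrak e}$ of vectors $z$ by listing entries, and define matrices $Y_t$ by $Y_tz=\sum_{i=0}^{m-1}M^{[i]}\hat y_{t-i}$ (terms with $t-i\le 0$ are zero). For $t>N$ play $u^{\rm ex}_t=Y_tz_t$, where $z_{N+1}\in\mathcal M_{\mathfrak e}$ is arbitrary and, with $H_t=\sum_{i=0}^{h}\hat G^{[i]}Y_{t-i}$ ($Y_s:=0$ for $s\le 0$), $\Lambda_t=\lambda I+\sum_{s=N+1}^tH_s^\top H_s$ and $\nabla_t=H_t^\top\nabla\ell_t(\hat v_t+H_tz_t)$, $$\tilde z_{t+1}=z_t-\eta\Lambda_t^{-1}\nabla_t,\qquad z_{t+1}=\arg\min_{z\in\mathcal M_{\mathfrak e}}\|\Lambda_t^{1/2}(z-\tilde z_{t+1})\|.$$ **Theorem.** There are universal constants $c,C>0$ such that the following holds in the setting above, for all systems, dimensions and parameters. Take $h=\lceil(1-\rho_\star)^{-1}\log T\rceil$, $m=3h$, $R_{\mathcal M}=2\frac{(1+\|K\|)c_\star}{1-\rho_\star}$, $\lambda=R_{\rm nat}^2\log(1/\delta)\sqrt T+\frac{hc_K^2}{(1-\rho_K)^2}$,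 $\eta=3/\alpha$, $N=\lceil h^2\sqrt T(d_y+d_u)\rceil$, and suppose that $$\sqrt T\ \ge\ c\log^2T\left(\frac{c_\star^4(1+\|K\|)^2R_{\rm nat}^2\log^2(1/\delta)}{(1-\rho_\star)^{6}}+\frac{d_u^2}{(1-\rho_\star)^{2}}\right).$$ Then, with probability at least $1-\delta$, every run of the algorithm (whatever the choice of least-squares minimizers and of $z_{N+1}$) satisfies $$\mathrm{ControlReg}_T\ \le\ C\,(d_y+d_u)^2\,\sqrt T\cdot\frac{c_K^4c_\star^4(1+\|K\|)^5}{(1-\rho_K)^4(1-\rho_\star)^6}\cdot\frac{L^2R_{\rm nat}^5}{\alpha}\cdot\log^3(1+T)\,\log(1/\delta).$$ -/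

import Mathlib

open MeasureTheory ProbabilityTheory
open scoped Matrix

noncomputable section

/-! Time is indexed by `t = 0, 1, 2, …`; index `t` is the round `t + 1` of the protocol. -/

/-- Joint output-input signals `v = (y, u)`, with the Euclidean norm. -/
abbrev Signal (dy du : ℕ) : Type := EuclideanSpace ℝ (Fin dy ⊕ Fin du)

/-- The stacked signal `(y, u)`. -/
def mkSignal {dy du : ℕ} (y : Fin dy → ℝ) (u : Fin du → ℝ) : Signal dy du :=
  WithLp.toLp 2 (Sum.elim y u)

open scoped Matrix.Norms.L2Operator in
/-- The `ℓ₂ → ℓ₂` operator norm of a real matrix. -/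
def opNorm {m n : Type*} [Fintype m] [Fintype n] [DecidableEq n] (A : Matrix m n ℝ) : ℝ := ‖A‖

/-- A partially observed linear system `x⁺ = A x + B u + w`, `y = C x + e` together with its
initial state, disturbances, and losses (all fixed in advance by an oblivious adversary). -/
structure Environment (dx dy du : ℕ) where
  A : Matrix (Fin dx) (Fin dx) ℝ
  B : Matrix (Fin dx) (Fin du) ℝ
  C : Matrix (Fin dy) (Fin dx) ℝ
  x₁ : Fin dx → ℝ
  w : ℕ → Fin dx → ℝ
  e : ℕ → Fin dy → ℝ
  loss : ℕ → Signal dy du → ℝ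

/-- Regularity of a loss: `C²`, `L`-subquadratic with the matching gradient bound, `α`-strongly
convex (`∇² f ⪰ α I`) and `L`-smooth (`∇² f ⪯ L I`). -/
structure RegularLoss {dy du : ℕ} (α L : ℝ) (f : Signal dy du → ℝ) : Prop where
  contDiff : ContDiff ℝ 2 f
  abs_le : ∀ v, |f v| ≤ L * max 1 (‖v‖ ^ 2)
  gradient_le : ∀ v, ‖gradient f v‖ ≤ L * max 1 ‖v‖
  hessian_ge : ∀ v x, α * ‖x‖ ^ 2 ≤ fderiv ℝ (fderiv ℝ f) v x x
  hessian_le : ∀ v x, fderiv ℝ (fderiv ℝ f) v x x ≤ L * ‖x‖ ^ 2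

namespace Environment

variable {dx dy du : ℕ} (E : Environment dx dy du) (K : Matrix (Fin du) (Fin dy) ℝ)

/-! ### Static feedback with exogenous inputs: `u t = K y t + uex t` -/

/-- States under `u t = K y t + uex t`. -/
def state (uex : ℕ → Fin du → ℝ) : ℕ → Fin dx → ℝ
  | 0 => E.x₁
  | t + 1 => E.A *ᵥ state uex t
      + E.B *ᵥ (K *ᵥ (E.C *ᵥ state uex t + E.e t) + uex t) + E.w t

/-- Outputs under `u t = K y t + uex t`. -/
def output (uex : ℕ → Fin du → ℝ) (t : ℕ) : Fin dy → ℝ :=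
  E.C *ᵥ E.state K uex t + E.e t

/-- Inputs `u t = K y t + uex t`. -/
def input (uex : ℕ → Fin du → ℝ) (t : ℕ) : Fin du → ℝ :=
  K *ᵥ E.output K uex t + uex t

/-- The realized signals `v t = (y t, u t)`. -/
def signal (uex : ℕ → Fin du → ℝ) (t : ℕ) : Signal dy du :=
  mkSignal (E.output K uex t) (E.input K uex t)

/-- Nature's iterates `v^K`: the signals produced by the feedback `u = K y` alone. -/
def natureSignal (t : ℕ) : Signal dy du := E.signal K (fun _ => 0) t

/-- The Markov operator `G_K` from exogenous inputs to signals: `G_K^[0] = [0; I]` and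
`G_K^[i] = [C; K C] (A + B K C)^(i-1) B` for `i ≥ 1`. -/
def markov (i : ℕ) : Matrix (Fin dy ⊕ Fin du) (Fin du) ℝ :=
  if i = 0 then Matrix.fromRows 0 1
  else Matrix.fromRows E.C (K * E.C) * (E.A + E.B * K * E.C) ^ (i - 1) * E.B

end Environment

/-! ### Comparator policies -/

/-- Linear dynamic controllers `s⁺ = Aπ s + Bπ y`, `u = Cπ s + Dπ y`, started at `s = 0`. -/
structure LDC (dy du : ℕ) where
  n : ℕ
  Aπ : Matrix (Fin n) (Fin n) ℝ
  Bπ : Matrix (Fin n) (Fin dy) ℝ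
  Cπ : Matrix (Fin du) (Fin n) ℝ
  Dπ : Matrix (Fin du) (Fin dy) ℝ

namespace LDC

variable {dx dy du : ℕ} (π : LDC dy du) (E : Environment dx dy du)
  (K : Matrix (Fin du) (Fin dy) ℝ)

/-- The input chosen by `π` at internal state `s` and output `y`. -/
def act (s : Fin π.n → ℝ) (y : Fin dy → ℝ) : Fin du → ℝ := π.Cπ *ᵥ s + π.Dπ *ᵥ y

/-- Joint plant and controller states when `π` is executed. -/
def states : ℕ → (Fin dx → ℝ) × (Fin π.n → ℝ)
  | 0 => (E.x₁, 0)
  | t + 1 =>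
    (E.A *ᵥ (states t).1
        + E.B *ᵥ π.act (states t).2 (E.C *ᵥ (states t).1 + E.e t) + E.w t,
      π.Aπ *ᵥ (states t).2 + π.Bπ *ᵥ (E.C *ᵥ (states t).1 + E.e t))

/-- Outputs when `π` is executed. -/
def output (t : ℕ) : Fin dy → ℝ := E.C *ᵥ (π.states E t).1 + E.e t

/-- Signals `(y^π, u^π)` when `π` is executed. -/
def signal (t : ℕ) : Signal dy du :=
  mkSignal (π.output E t) (π.act (π.states E t).2 (π.output E t))

/-- The closed-loop Markov operator `G_{π,cl}` of `π` relative to the nominal feedback `K`. -/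
def closedLoop (i : ℕ) : Matrix (Fin du) (Fin dy ⊕ Fin du) ℝ :=
  if i = 0 then Matrix.fromCols π.Dπ 0
  else
    Matrix.fromCols ((π.Dπ - K) * E.C) π.Cπ
      * (Matrix.fromBlocks (E.A + E.B * π.Dπ * E.C) (E.B * π.Cπ) (π.Bπ * E.C) π.Aπ) ^ (i - 1)
      * Matrix.fromBlocks (E.B * π.Dπ) (-E.B) π.Bπ 0

end LDC

/-- The benchmark `Π_stab(c, ρ)`: linear dynamic controllers with `‖G_{π,cl}^[i]‖ ≤ c ρ^i`. -/
def stabilizing {dx dy du : ℕ} (E : Environment dx dy du) (K : Matrix (Fin du) (Fin dy) ℝ)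
    (c ρ : ℝ) : Set (LDC dy du) :=
  {π | ∀ i, opNorm (π.closedLoop E K i) ≤ c * ρ ^ i}

/-- `ControlReg_T`: cumulative loss of the executed inputs minus the infimum of the cumulative
losses of the benchmark policies. -/
def controlRegret {dx dy du : ℕ} (E : Environment dx dy du) (K : Matrix (Fin du) (Fin dy) ℝ)
    (c ρ : ℝ) (T : ℕ) (uex : ℕ → Fin du → ℝ) : EReal :=
  ((∑ t ∈ Finset.range T, E.loss t (E.signal K uex t) : ℝ) : EReal)
    - ⨅ π ∈ stabilizing E K c ρ, ((∑ t ∈ Finset.range T, E.loss t (π.signal E t) : ℝ) : EReal)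

/-! ### The algorithm -/

/-- Algorithm parameters: memory `h`, DRC length `m`, number of exploration rounds `N`,
radius `R`, regularization `lam`, step size `η`. -/
structure DrcParams where
  h : ℕ
  m : ℕ
  N : ℕ
  R : ℝ
  lam : ℝ
  η : ℝ

/-- Vectorized DRC parameters `z`, encoding `M = (M^[0], …, M^[m-1])`. -/
abbrev DrcVec (m dy du : ℕ) : Type := Fin m × Fin du × Fin dy → ℝ

/-- The matrix `M^[i]` encoded by `z`. -/
def drcBlock {m dy du : ℕ} (z : DrcVec m dy du) (i : Fin m) : Matrix (Fin du) (Fin dy) ℝ :=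
  fun a b => z (i, a, b)

/-- The (vectorized) set of `M` with `∑ i, ‖M^[i]‖ ≤ R`. -/
def drcSet (m dy du : ℕ) (R : ℝ) : Set (DrcVec m dy du) :=
  {z | ∑ i, opNorm (drcBlock z i) ≤ R}

/-- The embedding matrix `Y_t`: `Y_t z = ∑_{i < m} M^[i] η_{t-i}`, where signals at negative
times are zero. -/
def drcEmbed (m : ℕ) {dy du : ℕ} (yhat : ℕ → Fin dy → ℝ) (t : ℕ) :
    Matrix (Fin du) (Fin m × Fin du × Fin dy) ℝ :=
  fun a p => if a = p.2.1 ∧ (p.1 : ℕ) ≤ t then yhat (t - p.1) p.2.2 else 0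

/-- Least-squares fit of Markov parameters of lags `1, …, h` from the exploration rounds
`h, …, N-1`; the lag-zero parameter is known to be `G₀`, and lags above `h` are set to zero.
Any minimizer is allowed. -/
def IsLeastSquares {κ : Type} [Fintype κ] {du : ℕ} (h N : ℕ) (G₀ : Matrix κ (Fin du) ℝ)
    (obs : ℕ → κ → ℝ) (uex : ℕ → Fin du → ℝ) (G : ℕ → Matrix κ (Fin du) ℝ) : Prop :=
  let cost : (ℕ → Matrix κ (Fin du) ℝ) → ℝ := fun G' =>
    ∑ t ∈ Finset.Ico h N, ∑ k,
      (obs t k - (∑ i ∈ Finset.range (h + 1), G' i *ᵥ uex (t - i)) k) ^ 2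
  G 0 = G₀ ∧ (∀ i, h < i → G i = 0) ∧ ∀ G', G' 0 = G₀ → cost G ≤ cost G'

/-- Removing the (estimated) effect of past exogenous inputs:
`obs t - ∑_{i ≤ t} G^[i] uex (t - i)`. -/
def estResidual {κ : Type} {du : ℕ} (G : ℕ → Matrix κ (Fin du) ℝ) (obs : ℕ → κ → ℝ)
    (uex : ℕ → Fin du → ℝ) (t : ℕ) : κ → ℝ :=
  obs t - ∑ i ∈ Finset.range (t + 1), G i *ᵥ uex (t - i)

/-- `H_t = ∑_{i ≤ h} G^[i] Y_{t-i}`. -/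
def memoryMatrix {dy du : ℕ} (h m : ℕ) (G : ℕ → Matrix (Fin dy ⊕ Fin du) (Fin du) ℝ)
    (yhat : ℕ → Fin dy → ℝ) (t : ℕ) :
    Matrix (Fin dy ⊕ Fin du) (Fin m × Fin du × Fin dy) ℝ :=
  ∑ i ∈ Finset.range (h + 1), if i ≤ t then G i * drcEmbed m yhat (t - i) else 0

/-- The semi-Newton preconditioner `Λ_t = lam I + ∑_{s = N}^{t} H_sᵀ H_s`. -/
def preconditioner {dy du : ℕ} {m : ℕ} (lam : ℝ) (N : ℕ)
    (H : ℕ → Matrix (Fin dy ⊕ Fin du) (Fin m × Fin du × Fin dy) ℝ) (t : ℕ) :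
    Matrix (Fin m × Fin du × Fin dy) (Fin m × Fin du × Fin dy) ℝ :=
  lam • (1 : Matrix (Fin m × Fin du × Fin dy) (Fin m × Fin du × Fin dy) ℝ)
    + ∑ s ∈ Finset.Icc N t, (H s)ᵀ * H s

/-- One step `z ↦ z'` of Semi-ONS with constraint set `S`, loss `f`, offset `v`, matrix `H` and
preconditioner `Λ`: a preconditioned gradient step of size `η` for `z ↦ f (v + H z)`, followed
by the projection onto `S` in the norm of `Λ`. -/
def IsSemiONSStep {ι κ : Type} [Fintype ι] [DecidableEq ι] [Fintype κ] (S : Set (ι → ℝ))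
    (η : ℝ) (f : EuclideanSpace ℝ κ → ℝ) (v : κ → ℝ) (H : Matrix κ ι ℝ) (Λ : Matrix ι ι ℝ)
    (z z' : ι → ℝ) : Prop :=
  let grad : ι → ℝ := Hᵀ *ᵥ (gradient f (WithLp.toLp 2 (v + H *ᵥ z))).ofLp
  let zt : ι → ℝ := z - η • (Λ⁻¹ *ᵥ grad)
  z' ∈ S ∧ ∀ q ∈ S, (z' - zt) ⬝ᵥ (Λ *ᵥ (z' - zt)) ≤ (q - zt) ⬝ᵥ (Λ *ᵥ (q - zt))

/-- `IsDrcOnsRun E K p ξ uex Gv Gη z`: running DRC-ONS with estimation, with nominal static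
feedback `K`, parameters `p` and exploration noise `ξ`, produces the exogenous inputs `uex`, the
estimates `Gv` (of the map from exogenous inputs to `(y, u)`) and `Gη` (of the map from exogenous
inputs to the controller's measurement, which is `y` for static feedback), and the iterates `z`.
The variant of the algorithm with a single estimate is the case that `Gη` is the `y`-block of
`Gv`. -/
structure IsDrcOnsRun {dx dy du : ℕ} (E : Environment dx dy du)
    (K : Matrix (Fin du) (Fin dy) ℝ) (p : DrcParams) (ξ : Fin p.N → Fin du → ℝ)
    (uex : ℕ → Fin du → ℝ) (Gv : ℕ → Matrix (Fin dy ⊕ Fin du) (Fin du) ℝ)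
    (Gη : ℕ → Matrix (Fin dy) (Fin du) ℝ) (z : ℕ → DrcVec p.m dy du) : Prop where
  /-- exploration with the noise `ξ` -/
  explore : ∀ t : Fin p.N, uex t = ξ t
  /-- estimation of the map to `(y, u)` -/
  est_v : IsLeastSquares p.h p.N (Matrix.fromRows 0 1)
    (fun t => (E.signal K uex t).ofLp) uex Gv
  /-- estimation of the map to `y` -/
  est_η : IsLeastSquares p.h p.N 0 (E.output K uex) uex Gη
  /-- arbitrary feasible initialization -/
  init : z p.N ∈ drcSet p.m dy du p.R
  /-- after exploration, the exogenous input is the DRC input on the estimated nature's outputs -/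
  control : ∀ t, p.N ≤ t →
    uex t = drcEmbed p.m (estResidual Gη (E.output K uex) uex) t *ᵥ z t
  /-- parameter updates -/
  update : ∀ t, p.N ≤ t →
    IsSemiONSStep (drcSet p.m dy du p.R) p.η (E.loss t)
      (estResidual Gv (fun s => (E.signal K uex s).ofLp) uex t)
      (memoryMatrix p.h p.m Gv (estResidual Gη (E.output K uex) uex) t)
      (preconditioner p.lam p.N
        (memoryMatrix p.h p.m Gv (estResidual Gη (E.output K uex) uex)) t)
      (z t) (z (t + 1))

/-- The law of the exploration noise: `N` independent standard Gaussian vectors in `ℝ^du`. -/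
def explorationLaw (N du : ℕ) : Measure (Fin N → Fin du → ℝ) :=
  Measure.pi fun _ => Measure.pi fun _ => gaussianReal 0 1

end

open scoped ENNReal

set_option linter.unusedSectionVars false

noncomputable section

/-! ### Euclidean norms of coordinate vectors -/

/-! By superposition the played signals are nature's signals plus `E.markov K` convolved with the
exogenous inputs, and a benchmark policy `π` is itself an exogenous input obtained by filtering
nature's signals through a summable kernel (`LDC.exInput_eq`). Truncating that kernel at lag `h`,
with error of order `1 / T`, makes `π` a disturbance-response controller. If the Markov operator
were known, this would be online convex optimization with memory over `z`; the whole difficulty is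
that it is only estimated.

Exploration for about `√T` rounds gives an estimate with total error `ε` of order `T ^ (-1/4)`
(`estimation_error`, resting on the Chernoff bound `measure_sum_gt_le` for sequential functionals of
the noise). Paying for this error by Lipschitz continuity would cost `ε T`, of order `T ^ (3/4)`.
Strong convexity reduces the cost to `ε ^ 2 T`, of order `√T`, as follows. Let `M` be the truncated
kernel of `π` acting on outputs and `D` the error of the output Markov operator. The comparator is
`M - M D M` and not `M`. Its predicted signal then differs from the signal of `π` by a part of size
`ε ^ 2` and a part linear, with gain of order `ε`, in the difference between comparator input and
played input (`comparator_identity`). The exogenous input is `u - K y`, hence readable from the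
joint signal, so during control this difference is at most `1 + ‖K‖` times `H_t (z_t - q)`
(`euclNorm_drcEmbed_le_memoryMatrix`). Strong convexity supplies the negative term `-(α / 2) ∑ |H_t
(z_t - q)| ^ 2`. By the weighted arithmetic-geometric inequality the linear part costs `T ε ^ 2 / α`
plus a fraction of that sum, which is absorbed (`ControlPhase.sum_prediction_sub_le`).

The online part is a potential argument in the norm of the preconditioner (`sum_dotProduct_le`).
Growth of the preconditioner contributes `|H_t (z_t - q)| ^ 2`, again absorbed by strong convexity.
Since `lam` is of order `√T`, the crude bound `|g| ^ 2 / lam` for each gradient suffices, without a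
log-determinant estimate, and consecutive iterates are so close that the memory of the system costs
only `√T` in total. Exploration rounds are bounded crudely. When `T ≤ N` nothing else is needed. -/

/-- The Euclidean norm of a coordinate vector. -/
def euclNorm {ι : Type*} [Fintype ι] (x : ι → ℝ) : ℝ := ‖(WithLp.toLp 2 x : EuclideanSpace ℝ ι)‖

section EuclNorm

variable {ι κ μ : Type*} [Fintype ι] [Fintype κ] [Fintype μ]

theorem euclNorm_nonneg (x : ι → ℝ) : 0 ≤ euclNorm x := norm_nonneg _

@[simp] theorem euclNorm_zero : euclNorm (0 : ι → ℝ) = 0 := by simp [euclNorm]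

theorem euclNorm_sq (x : ι → ℝ) : euclNorm x ^ 2 = ∑ i, x i ^ 2 := by
  simp [euclNorm, EuclideanSpace.norm_sq_eq]

theorem euclNorm_sq_eq_dotProduct (x : ι → ℝ) : euclNorm x ^ 2 = x ⬝ᵥ x := by
  rw [euclNorm_sq]; simp [dotProduct, sq]

theorem euclNorm_ofLp (v : EuclideanSpace ℝ ι) : euclNorm v.ofLp = ‖v‖ := rfl

theorem euclNorm_add_le (x y : ι → ℝ) : euclNorm (x + y) ≤ euclNorm x + euclNorm y := by
  simpa [euclNorm] using norm_add_le (WithLp.toLp 2 x : EuclideanSpace ℝ ι) (WithLp.toLp 2 y)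

theorem euclNorm_sub_le (x y : ι → ℝ) : euclNorm (x - y) ≤ euclNorm x + euclNorm y := by
  simpa [euclNorm] using norm_sub_le (WithLp.toLp 2 x : EuclideanSpace ℝ ι) (WithLp.toLp 2 y)

theorem euclNorm_neg (x : ι → ℝ) : euclNorm (-x) = euclNorm x := by
  simp [euclNorm]

theorem euclNorm_sub_comm (x y : ι → ℝ) : euclNorm (x - y) = euclNorm (y - x) := by
  rw [← euclNorm_neg, neg_sub]

theorem euclNorm_sum_le {σ : Type*} {s : Finset σ} (f : σ → ι → ℝ) :
    euclNorm (∑ i ∈ s, f i) ≤ ∑ i ∈ s, euclNorm (f i) := by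
  simpa [euclNorm, WithLp.toLp_sum] using
    norm_sum_le s (fun i => (WithLp.toLp 2 (f i) : EuclideanSpace ℝ ι))

theorem dotProduct_le_euclNorm_mul (x y : ι → ℝ) : x ⬝ᵥ y ≤ euclNorm x * euclNorm y := by
  have := real_inner_le_norm (WithLp.toLp 2 x : EuclideanSpace ℝ ι) (WithLp.toLp 2 y)
  simpa [euclNorm, EuclideanSpace.inner_eq_star_dotProduct, dotProduct_comm] using this

theorem abs_dotProduct_le_euclNorm_mul (x y : ι → ℝ) :
    |x ⬝ᵥ y| ≤ euclNorm x * euclNorm y := by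
  rw [abs_le]
  constructor
  · have := dotProduct_le_euclNorm_mul (-x) y
    rw [euclNorm_neg, neg_dotProduct] at this
    linarith
  · exact dotProduct_le_euclNorm_mul x y

theorem abs_apply_le_euclNorm (x : ι → ℝ) (i : ι) : |x i| ≤ euclNorm x := by
  refine abs_le_of_sq_le_sq ?_ (euclNorm_nonneg _)
  rw [euclNorm_sq]
  exact Finset.single_le_sum (f := fun i => x i ^ 2) (fun i _ => sq_nonneg _) (Finset.mem_univ i)

variable [DecidableEq ι] [DecidableEq κ]

open scoped Matrix.Norms.L2Operator in
theorem euclNorm_mulVec_le (A : Matrix μ ι ℝ) (x : ι → ℝ) :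
    euclNorm (A *ᵥ x) ≤ opNorm A * euclNorm x :=
  Matrix.l2_opNorm_mulVec A (WithLp.toLp 2 x)

open scoped Matrix.Norms.L2Operator in
theorem opNorm_nonneg (A : Matrix μ ι ℝ) : 0 ≤ opNorm A := norm_nonneg A

open scoped Matrix.Norms.L2Operator in
theorem opNorm_add_le (A B : Matrix μ ι ℝ) : opNorm (A + B) ≤ opNorm A + opNorm B :=
  norm_add_le A B

open scoped Matrix.Norms.L2Operator in
theorem opNorm_sub_le (A B : Matrix μ ι ℝ) : opNorm (A - B) ≤ opNorm A + opNorm B :=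
  norm_sub_le A B

open scoped Matrix.Norms.L2Operator in
theorem opNorm_mul_le (A : Matrix μ ι ℝ) (B : Matrix ι κ ℝ) :
    opNorm (A * B) ≤ opNorm A * opNorm B :=
  Matrix.l2_opNorm_mul A B

open scoped Matrix.Norms.L2Operator in
theorem opNorm_zero : opNorm (0 : Matrix μ ι ℝ) = 0 := norm_zero

open scoped Matrix.Norms.L2Operator in
theorem opNorm_smul (c : ℝ) (A : Matrix μ ι ℝ) : opNorm (c • A) = |c| * opNorm A :=
  norm_smul c A

open scoped Matrix.Norms.L2Operator in
theorem opNorm_sum_le {σ : Type*} (s : Finset σ) (A : σ → Matrix μ ι ℝ) :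
    opNorm (∑ i ∈ s, A i) ≤ ∑ i ∈ s, opNorm (A i) :=
  norm_sum_le s A

open scoped Matrix.Norms.L2Operator in
theorem opNorm_le_of_forall (A : Matrix μ ι ℝ) {c : ℝ} (hc : 0 ≤ c)
    (h : ∀ x, euclNorm (A *ᵥ x) ≤ c * euclNorm x) : opNorm A ≤ c := by
  rw [opNorm, Matrix.l2_opNorm_def]
  exact ContinuousLinearMap.opNorm_le_bound _ hc fun x => h x.ofLp

theorem opNorm_sq_le_sum (A : Matrix μ ι ℝ) : opNorm A ^ 2 ≤ ∑ i, ∑ j, A i j ^ 2 := by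
  have h0 : 0 ≤ ∑ i, ∑ j, A i j ^ 2 :=
    Finset.sum_nonneg fun i _ => Finset.sum_nonneg fun j _ => sq_nonneg _
  rw [← Real.le_sqrt (opNorm_nonneg _) h0]
  refine opNorm_le_of_forall _ (Real.sqrt_nonneg _) fun x => ?_
  refine abs_le_of_sq_le_sq' ?_ (by have := euclNorm_nonneg x; positivity) |>.2
  rw [mul_pow, Real.sq_sqrt h0, euclNorm_sq, euclNorm_sq, Finset.sum_mul]
  refine Finset.sum_le_sum fun i _ => ?_
  exact Finset.sum_mul_sq_le_sq_mul_sq _ _ _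

theorem abs_entry_le_opNorm (A : Matrix μ ι ℝ) (i : μ) (j : ι) : |A i j| ≤ opNorm A := by
  have h := euclNorm_mulVec_le A (Pi.single j 1)
  have h1 : euclNorm (Pi.single j (1 : ℝ)) = 1 := by
    simp [euclNorm]
  have h2 := abs_apply_le_euclNorm (A *ᵥ Pi.single j 1) i
  rw [h1, mul_one] at h
  have e : (A *ᵥ Pi.single j 1) i = A i j := by simp
  rw [e] at h2
  exact h2.trans h

/-- The Frobenius norm is at most `√rows` times the operator norm (columns version). -/
theorem sum_sq_le_card_mul_opNorm_sq (A : Matrix μ ι ℝ) :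
    ∑ i, ∑ j, A i j ^ 2 ≤ Fintype.card ι * opNorm A ^ 2 := by
  rw [Finset.sum_comm]
  have h : ∀ j ∈ Finset.univ, ∑ i, A i j ^ 2 ≤ opNorm A ^ 2 := by
    intro j _
    have h := euclNorm_mulVec_le A (Pi.single j 1)
    have h1 : euclNorm (Pi.single j (1 : ℝ)) = 1 := by simp [euclNorm]
    rw [h1, mul_one] at h
    have h2 := pow_le_pow_left₀ (euclNorm_nonneg _) h 2
    rw [euclNorm_sq] at h2
    simpa using h2
  simpa using Finset.sum_le_card_nsmul _ _ _ h

/-- Duality, from `|Aᵀ y| ^ 2 = y ⬝ A (Aᵀ y)`. An arbitrary bound `c` replaces `opNorm`, because the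
memory matrices are controlled only through their action on vectors. -/
theorem euclNorm_transpose_mulVec_le (A : Matrix κ ι ℝ) {c : ℝ} (hc : 0 ≤ c)
    (h : ∀ x, euclNorm (A *ᵥ x) ≤ c * euclNorm x) (y : κ → ℝ) :
    euclNorm (Aᵀ *ᵥ y) ≤ c * euclNorm y := by
  have h1 : euclNorm (Aᵀ *ᵥ y) ^ 2 ≤ (c * euclNorm y) * euclNorm (Aᵀ *ᵥ y) := by
    rw [euclNorm_sq_eq_dotProduct]
    have e : (Aᵀ *ᵥ y) ⬝ᵥ (Aᵀ *ᵥ y) = y ⬝ᵥ (A *ᵥ (Aᵀ *ᵥ y)) := by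
      rw [Matrix.mulVec_transpose, ← Matrix.dotProduct_mulVec]
    rw [e]
    refine (dotProduct_le_euclNorm_mul _ _).trans ?_
    nlinarith [h (Aᵀ *ᵥ y), euclNorm_nonneg y]
  rcases (euclNorm_nonneg (Aᵀ *ᵥ y)).eq_or_lt with h0 | h0
  · rw [← h0]; have := euclNorm_nonneg y; positivity
  · nlinarith

end EuclNorm

/-! ### Causal convolution -/

section Conv

variable {ι κ μ : Type*} [Fintype ι] [Fintype κ] [Fintype μ]

/-- Causal convolution of a matrix kernel with a signal. -/
def conv (M : ℕ → Matrix κ ι ℝ) (u : ℕ → ι → ℝ) (t : ℕ) : κ → ℝ :=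
  ∑ i ∈ Finset.range (t + 1), M i *ᵥ u (t - i)

/-- Cauchy product of matrix kernels. -/
def kernelMul (M : ℕ → Matrix κ ι ℝ) (N : ℕ → Matrix ι μ ℝ) (t : ℕ) : Matrix κ μ ℝ :=
  ∑ p ∈ Finset.HasAntidiagonal.antidiagonal t, M p.1 * N p.2

theorem conv_eq_antidiagonal (M : ℕ → Matrix κ ι ℝ) (u : ℕ → ι → ℝ) (t : ℕ) :
    conv M u t = ∑ p ∈ Finset.HasAntidiagonal.antidiagonal t, M p.1 *ᵥ u p.2 :=
  (Finset.Nat.sum_antidiagonal_eq_sum_range_succ (fun i j => M i *ᵥ u j) t).symm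

theorem conv_conv (M : ℕ → Matrix κ ι ℝ) (N : ℕ → Matrix ι μ ℝ) (u : ℕ → μ → ℝ) :
    conv M (conv N u) = conv (kernelMul M N) u := by
  funext t
  simp only [conv_eq_antidiagonal, kernelMul, Matrix.mulVec_sum, Matrix.sum_mulVec,
    ← Matrix.mulVec_mulVec]
  rw [Finset.sum_sigma', Finset.sum_sigma']
  refine Finset.sum_nbij' (fun x => ⟨(x.1.1 + x.2.1, x.2.2), (x.1.1, x.2.1)⟩)
    (fun x => ⟨(x.2.1, x.2.2 + x.1.2), (x.2.2, x.1.2)⟩) ?_ ?_ ?_ ?_ ?_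
  · rintro ⟨⟨a, b⟩, ⟨c, d⟩⟩ h
    simp at h ⊢
    omega
  · rintro ⟨⟨a, b⟩, ⟨c, d⟩⟩ h
    simp at h ⊢
    omega
  · rintro ⟨⟨a, b⟩, ⟨c, d⟩⟩ h
    simp at h ⊢
    omega
  · rintro ⟨⟨a, b⟩, ⟨c, d⟩⟩ h
    simp at h ⊢
    omega
  · rintro ⟨⟨a, b⟩, ⟨c, d⟩⟩ h
    rfl

theorem conv_add (M : ℕ → Matrix κ ι ℝ) (u v : ℕ → ι → ℝ) :
    conv M (u + v) = conv M u + conv M v := by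
  funext t
  simp [conv, Matrix.mulVec_add, Finset.sum_add_distrib]

theorem conv_sub (M : ℕ → Matrix κ ι ℝ) (u v : ℕ → ι → ℝ) :
    conv M (u - v) = conv M u - conv M v := by
  funext t
  simp [conv, Matrix.mulVec_sub, Finset.sum_sub_distrib]

theorem add_conv (M N : ℕ → Matrix κ ι ℝ) (u : ℕ → ι → ℝ) :
    conv (M + N) u = conv M u + conv N u := by
  funext t
  simp [conv, Matrix.add_mulVec, Finset.sum_add_distrib]

theorem sub_conv (M N : ℕ → Matrix κ ι ℝ) (u : ℕ → ι → ℝ) :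
    conv (M - N) u = conv M u - conv N u := by
  funext t
  simp [conv, Matrix.sub_mulVec, Finset.sum_sub_distrib]

theorem mulVec_conv (Q : Matrix μ κ ℝ) (M : ℕ → Matrix κ ι ℝ) (u : ℕ → ι → ℝ) (t : ℕ) :
    Q *ᵥ conv M u t = conv (fun i => Q * M i) u t := by
  simp [conv, Matrix.mulVec_sum, Matrix.mulVec_mulVec]

theorem conv_mulVec (M : ℕ → Matrix κ ι ℝ) (Q : Matrix ι μ ℝ) (u : ℕ → μ → ℝ) (t : ℕ) :
    conv M (fun s => Q *ᵥ u s) t = conv (fun i => M i * Q) u t := by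
  simp [conv, Matrix.mulVec_mulVec]

variable [DecidableEq ι] [DecidableEq μ]

theorem euclNorm_conv_le (M : ℕ → Matrix κ ι ℝ) (u : ℕ → ι → ℝ) {T t : ℕ} (ht : t < T) {U : ℝ}
    (hU : ∀ s ≤ t, euclNorm (u s) ≤ U) :
    euclNorm (conv M u t) ≤ (∑ i ∈ Finset.range T, opNorm (M i)) * U := by
  have hU0 : 0 ≤ U := (euclNorm_nonneg _).trans (hU t le_rfl)
  refine (euclNorm_sum_le _).trans ?_
  calc _ ≤ ∑ i ∈ Finset.range (t + 1), opNorm (M i) * U := by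
        refine Finset.sum_le_sum fun i _ => (euclNorm_mulVec_le _ _).trans ?_
        exact mul_le_mul_of_nonneg_left (hU _ (Nat.sub_le _ _)) (opNorm_nonneg _)
    _ = (∑ i ∈ Finset.range (t + 1), opNorm (M i)) * U := by rw [Finset.sum_mul]
    _ ≤ _ := by
        refine mul_le_mul_of_nonneg_right ?_ hU0
        exact Finset.sum_le_sum_of_subset_of_nonneg (by simpa using Nat.succ_le_of_lt ht)
          fun i _ _ => opNorm_nonneg _

/-- Young's inequality for `ℓ¹ * ℓ²` on a finite horizon: Cauchy–Schwarz with weights `opNorm (M i)`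
at each time, then exchange of the two sums. It carries the `ε ^ 2` gain of the first-order error.
-/
theorem sum_euclNorm_conv_sq_le (M : ℕ → Matrix κ ι ℝ) (u : ℕ → ι → ℝ) (T : ℕ) :
    ∑ t ∈ Finset.range T, euclNorm (conv M u t) ^ 2
      ≤ (∑ i ∈ Finset.range T, opNorm (M i)) ^ 2 * ∑ s ∈ Finset.range T, euclNorm (u s) ^ 2 := by
  set S := ∑ i ∈ Finset.range T, opNorm (M i) with hS
  have hS0 : 0 ≤ S := Finset.sum_nonneg fun i _ => opNorm_nonneg _
  have key : ∀ t ∈ Finset.range T, euclNorm (conv M u t) ^ 2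
      ≤ S * ∑ i ∈ Finset.range T,
          if i ≤ t then opNorm (M i) * euclNorm (u (t - i)) ^ 2 else 0 := by
    intro t ht
    have hsub : Finset.range (t + 1) ⊆ Finset.range T := by
      simpa using Nat.succ_le_of_lt (Finset.mem_range.1 ht)
    have h1 : euclNorm (conv M u t) ≤
        ∑ i ∈ Finset.range (t + 1), opNorm (M i) * euclNorm (u (t - i)) :=
      (euclNorm_sum_le _).trans (Finset.sum_le_sum fun i _ => euclNorm_mulVec_le _ _)
    have h2 : (∑ i ∈ Finset.range (t + 1), opNorm (M i) * euclNorm (u (t - i))) ^ 2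
        ≤ (∑ i ∈ Finset.range (t + 1), opNorm (M i)) *
          ∑ i ∈ Finset.range (t + 1), opNorm (M i) * euclNorm (u (t - i)) ^ 2 := by
      refine Finset.sum_sq_le_sum_mul_sum_of_sq_le_mul _ (fun i _ => opNorm_nonneg _)
        (fun i _ => mul_nonneg (opNorm_nonneg _) (sq_nonneg _)) fun i _ => le_of_eq (by ring)
    refine (pow_le_pow_left₀ (euclNorm_nonneg _) h1 2).trans (h2.trans ?_)
    refine mul_le_mul (Finset.sum_le_sum_of_subset_of_nonneg hsub fun i _ _ => opNorm_nonneg _)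
      ?_ (Finset.sum_nonneg fun i _ => mul_nonneg (opNorm_nonneg _) (sq_nonneg _)) hS0
    rw [← Finset.sum_filter]
    refine le_of_eq (Finset.sum_congr ?_ fun _ _ => rfl)
    ext i
    simp only [Finset.mem_range, Finset.mem_filter] at ht ⊢
    omega
  refine (Finset.sum_le_sum key).trans ?_
  rw [← Finset.mul_sum, Finset.sum_comm, sq, mul_assoc]
  refine mul_le_mul_of_nonneg_left ?_ hS0
  rw [hS, Finset.sum_mul]
  refine Finset.sum_le_sum fun i _ => ?_
  rw [← Finset.sum_filter, ← Finset.mul_sum]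
  refine mul_le_mul_of_nonneg_left ?_ (opNorm_nonneg _)
  have hinj : Set.InjOn (fun t => t - i) (Finset.filter (fun t => i ≤ t) (Finset.range T)) := by
    intro x hx y hy hxy
    simp at hx hy hxy
    omega
  rw [← Finset.sum_image (f := fun s => euclNorm (u s) ^ 2) hinj]
  refine Finset.sum_le_sum_of_subset_of_nonneg ?_ fun _ _ _ => sq_nonneg _
  intro s hs
  simp only [Finset.mem_image, Finset.mem_filter, Finset.mem_range] at hs ⊢
  omega

theorem sum_opNorm_kernelMul_le (M : ℕ → Matrix κ ι ℝ) (N : ℕ → Matrix ι μ ℝ) (T : ℕ) :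
    ∑ t ∈ Finset.range T, opNorm (kernelMul M N t)
      ≤ (∑ i ∈ Finset.range T, opNorm (M i)) * ∑ i ∈ Finset.range T, opNorm (N i) := by
  rw [Finset.sum_mul_sum, ← Finset.sum_product']
  calc _ ≤ ∑ t ∈ Finset.range T, ∑ p ∈ Finset.HasAntidiagonal.antidiagonal t, opNorm (M p.1) * opNorm (N p.2) :=
        Finset.sum_le_sum fun t _ => (opNorm_sum_le _ _).trans
          (Finset.sum_le_sum fun p _ => opNorm_mul_le _ _)
    _ = ∑ x ∈ (Finset.range T).sigma (fun t => Finset.HasAntidiagonal.antidiagonal t),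
          opNorm (M x.2.1) * opNorm (N x.2.2) := by rw [Finset.sum_sigma]
    _ = ∑ p ∈ ((Finset.range T).sigma (fun t => Finset.HasAntidiagonal.antidiagonal t)).image (fun x => x.2),
          opNorm (M p.1) * opNorm (N p.2) := by
        rw [Finset.sum_image]
        rintro ⟨t, p⟩ h ⟨t', p'⟩ h' e
        simp at h h' e
        subst e
        obtain rfl : t = t' := by omega
        rfl
    _ ≤ _ := by
        refine Finset.sum_le_sum_of_subset_of_nonneg ?_ fun _ _ _ =>
          mul_nonneg (opNorm_nonneg _) (opNorm_nonneg _)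
        intro p hp
        simp only [Finset.mem_image, Finset.mem_sigma, Finset.mem_range,
          Finset.HasAntidiagonal.mem_antidiagonal, Finset.mem_product] at hp ⊢
        obtain ⟨⟨t, q⟩, ⟨h1, h2⟩, rfl⟩ := hp
        simp only at h1 h2 ⊢
        omega

end Conv

/-! ### Closed-form responses of the plant and of the benchmark policies -/

/-- The map `y ↦ (y, K y)`. -/
def feedbackLift {dy du : ℕ} (K : Matrix (Fin du) (Fin dy) ℝ) :
    Matrix (Fin dy ⊕ Fin du) (Fin dy) ℝ := Matrix.fromRows 1 K

/-- The map `u ↦ (0, u)`. -/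
def inputLift (dy du : ℕ) : Matrix (Fin dy ⊕ Fin du) (Fin du) ℝ := Matrix.fromRows 0 1

theorem feedbackLift_mulVec {dy du : ℕ} (K : Matrix (Fin du) (Fin dy) ℝ) (y : Fin dy → ℝ) :
    feedbackLift K *ᵥ y = Sum.elim y (K *ᵥ y) := by
  simp [feedbackLift, Matrix.fromRows_mulVec]

theorem inputLift_mulVec {dy du : ℕ} (u : Fin du → ℝ) :
    inputLift dy du *ᵥ u = Sum.elim (0 : Fin dy → ℝ) u := by
  simp [inputLift, Matrix.fromRows_mulVec]

namespace Environment

variable {dx dy du : ℕ} (E : Environment dx dy du) (K : Matrix (Fin du) (Fin dy) ℝ)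

/-- The Markov operator from exogenous inputs to outputs. -/
def outputMarkov (i : ℕ) : Matrix (Fin dy) (Fin du) ℝ :=
  if i = 0 then 0 else E.C * (E.A + E.B * K * E.C) ^ (i - 1) * E.B

theorem markov_eq (i : ℕ) :
    E.markov K i = feedbackLift K * E.outputMarkov K i + if i = 0 then inputLift dy du else 0 := by
  by_cases hi : i = 0
  · simp [markov, outputMarkov, hi, inputLift]
  · simp only [markov, outputMarkov, hi, if_false, feedbackLift, add_zero, ← Matrix.mul_assoc,
      Matrix.fromRows_mul, Matrix.one_mul]

theorem state_eq (uex : ℕ → Fin du → ℝ) (t : ℕ) :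
    E.state K uex t = E.state K (fun _ => 0) t +
      ∑ i ∈ Finset.range t, ((E.A + E.B * K * E.C) ^ i * E.B) *ᵥ uex (t - 1 - i) := by
  induction t with
  | zero => simp [state]
  | succ t ih =>
    rw [Finset.sum_range_succ']
    have h : ∀ i ∈ Finset.range t,
        ((E.A + E.B * K * E.C) ^ (i + 1) * E.B) *ᵥ uex (t + 1 - 1 - (i + 1))
          = (E.A + E.B * K * E.C) *ᵥ
            ((E.A + E.B * K * E.C) ^ i * E.B) *ᵥ uex (t - 1 - i) := by
      intro i hi
      rw [Matrix.mulVec_mulVec, ← Matrix.mul_assoc, ← pow_succ']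
      congr 2
      omega
    rw [Finset.sum_congr rfl h, ← Matrix.mulVec_sum]
    simp only [state]
    rw [ih]
    set S := ∑ i ∈ Finset.range t, ((E.A + E.B * K * E.C) ^ i * E.B) *ᵥ uex (t - 1 - i)
    simp only [Matrix.mulVec_add, Matrix.add_mulVec, ← Matrix.mulVec_mulVec, add_zero, pow_zero,
      Matrix.one_mul, add_tsub_cancel_right, Nat.sub_zero]
    abel

theorem output_eq (uex : ℕ → Fin du → ℝ) (t : ℕ) :
    E.output K uex t = E.output K (fun _ => 0) t + conv (E.outputMarkov K) uex t := by
  have h : conv (E.outputMarkov K) uex t =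
      ∑ i ∈ Finset.range t,
        E.C *ᵥ (((E.A + E.B * K * E.C) ^ i * E.B) *ᵥ uex (t - 1 - i)) := by
    rw [conv, Finset.sum_range_succ']
    simp only [outputMarkov, Nat.add_one_ne_zero, if_false, if_true, Matrix.zero_mulVec, add_zero,
      add_tsub_cancel_right, Matrix.mulVec_mulVec, Matrix.mul_assoc]
    refine Finset.sum_congr rfl fun i _ => ?_
    congr 2
    omega
  rw [output, output, state_eq, h, Matrix.mulVec_add, Matrix.mulVec_sum]
  abel

theorem signal_ofLp (uex : ℕ → Fin du → ℝ) (t : ℕ) :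
    (E.signal K uex t).ofLp
      = feedbackLift K *ᵥ E.output K uex t + inputLift dy du *ᵥ uex t := by
  rw [feedbackLift_mulVec, inputLift_mulVec]
  funext i
  rcases i with i | i <;> simp [signal, mkSignal, input]

theorem natureSignal_ofLp (t : ℕ) :
    (E.natureSignal K t).ofLp = feedbackLift K *ᵥ E.output K (fun _ => 0) t := by
  rw [natureSignal, signal_ofLp, Matrix.mulVec_zero, add_zero]

theorem signal_eq_nature_add_conv (uex : ℕ → Fin du → ℝ) (t : ℕ) :
    (E.signal K uex t).ofLp = (E.natureSignal K t).ofLp + conv (E.markov K) uex t := by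
  have h : conv (E.markov K) uex t =
      feedbackLift K *ᵥ conv (E.outputMarkov K) uex t + inputLift dy du *ᵥ uex t := by
    rw [mulVec_conv]
    have e : E.markov K = (fun i => feedbackLift K * E.outputMarkov K i)
        + fun i => if i = 0 then inputLift dy du else 0 := funext fun i => E.markov_eq K i
    rw [e, add_conv, Pi.add_apply]
    congr 1
    rw [conv, Finset.sum_range_succ', Finset.sum_eq_zero]
    · simp
    · intro i _; simp
  rw [signal_ofLp, natureSignal_ofLp, output_eq, h, Matrix.mulVec_add, add_assoc]

end Environment

namespace LDC

variable {dx dy du : ℕ} (π : LDC dy du) (E : Environment dx dy du)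
  (K : Matrix (Fin du) (Fin dy) ℝ)

/-- The exogenous input (relative to the nominal feedback `K`) produced by `π`. -/
def exInput (t : ℕ) : Fin du → ℝ :=
  π.act (π.states E t).2 (π.output E t) - K *ᵥ π.output E t

theorem states_fst_eq (t : ℕ) : (π.states E t).1 = E.state K (π.exInput E K) t := by
  induction t with
  | zero => rfl
  | succ t ih =>
    simp only [states, Environment.state, exInput, output]
    rw [← ih]
    simp

theorem output_eq (t : ℕ) : π.output E t = E.output K (π.exInput E K) t := by
  rw [output, Environment.output, states_fst_eq π E K]

theorem signal_eq (t : ℕ) : π.signal E t = E.signal K (π.exInput E K) t := by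
  rw [signal, Environment.signal, ← output_eq π E K, Environment.input, ← output_eq π E K, exInput]
  simp

/-- The kernel from nature's signals to the exogenous inputs of `π`. -/
def exKernel (i : ℕ) : Matrix (Fin du) (Fin dy ⊕ Fin du) ℝ :=
  if i = 0 then Matrix.fromCols π.Dπ (-1) else π.closedLoop E K i

/-- Joint deviation of the plant state from nature's state, and the controller state. -/
def deviation (t : ℕ) : Fin dx ⊕ Fin π.n → ℝ :=
  Sum.elim ((π.states E t).1 - E.state K (fun _ => 0) t) (π.states E t).2

/-- Subtracting nature's trajectory cancels `w`, and `e` enters only through nature's output. The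
block `-B` acts on nature's input `K y`, which the subtracted trajectory has already received. -/
theorem deviation_succ (t : ℕ) :
    π.deviation E K (t + 1) =
      Matrix.fromBlocks (E.A + E.B * π.Dπ * E.C) (E.B * π.Cπ) (π.Bπ * E.C) π.Aπ
          *ᵥ π.deviation E K t
        + Matrix.fromBlocks (E.B * π.Dπ) (-E.B) π.Bπ 0 *ᵥ (E.natureSignal K t).ofLp := by
  rw [E.natureSignal_ofLp, feedbackLift_mulVec, deviation, deviation,
    Matrix.fromBlocks_mulVec, Matrix.fromBlocks_mulVec]
  simp only [Sum.elim_comp_inl, Sum.elim_comp_inr]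
  funext i
  rcases i with i | i
  · simp only [states, Environment.state, act, Environment.output, Sum.elim_inl,
      Pi.add_apply, Pi.sub_apply, Matrix.add_mulVec, Matrix.mulVec_add,
      Matrix.mulVec_sub, ← Matrix.mulVec_mulVec, Matrix.neg_mulVec, Pi.neg_apply,
      add_zero]
    ring
  · simp only [states, Environment.state, act, Environment.output, Sum.elim_inr,
      Pi.add_apply, Pi.sub_apply, Matrix.add_mulVec, Matrix.mulVec_add,
      Matrix.mulVec_sub, ← Matrix.mulVec_mulVec, Matrix.neg_mulVec,
      Matrix.zero_mulVec, Pi.zero_apply]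
    ring

theorem deviation_eq (t : ℕ) :
    π.deviation E K t = ∑ i ∈ Finset.range t,
      (Matrix.fromBlocks (E.A + E.B * π.Dπ * E.C) (E.B * π.Cπ) (π.Bπ * E.C) π.Aπ ^ i
        * Matrix.fromBlocks (E.B * π.Dπ) (-E.B) π.Bπ 0)
          *ᵥ (E.natureSignal K (t - 1 - i)).ofLp := by
  induction t with
  | zero =>
    funext i
    rcases i with i | i <;> simp [deviation, states, Environment.state]
  | succ t ih =>
    rw [deviation_succ, ih, Finset.sum_range_succ', Matrix.mulVec_sum]
    congr 1
    · refine Finset.sum_congr rfl fun i _ => ?_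
      rw [Matrix.mulVec_mulVec, ← Matrix.mul_assoc, ← pow_succ']
      have e : t + 1 - 1 - (i + 1) = t - 1 - i := by omega
      rw [e]
    · simp

/-- The term `-K y` of nature's trajectory is minus nature's input. This explains the block `-1` at
lag zero of `exKernel`, where `closedLoop` has `0`. -/
theorem exInput_eq (t : ℕ) :
    π.exInput E K t = conv (π.exKernel E K) (fun s => (E.natureSignal K s).ofLp) t := by
  have h1 : π.exInput E K t = Matrix.fromCols ((π.Dπ - K) * E.C) π.Cπ *ᵥ π.deviation E K t
      + Matrix.fromCols π.Dπ (-1) *ᵥ (E.natureSignal K t).ofLp := by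
    rw [E.natureSignal_ofLp, feedbackLift_mulVec, deviation, Matrix.fromCols_mulVec,
      Matrix.fromCols_mulVec]
    funext i
    simp only [exInput, act, output, Environment.output, Sum.elim_comp_inl, Sum.elim_comp_inr,
      Pi.add_apply, Pi.sub_apply, Matrix.sub_mulVec, Matrix.mulVec_add, Matrix.sub_mul,
      Matrix.mulVec_sub, ← Matrix.mulVec_mulVec, Matrix.neg_mulVec, Pi.neg_apply,
      Matrix.one_mulVec]
    ring
  rw [h1, deviation_eq, conv, Finset.sum_range_succ', Matrix.mulVec_sum]
  congr 1
  · refine Finset.sum_congr rfl fun i _ => ?_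
    rw [Matrix.mulVec_mulVec, exKernel, closedLoop, if_neg (Nat.succ_ne_zero i),
      if_neg (Nat.succ_ne_zero i)]
    have e : t - (i + 1) = t - 1 - i := by omega
    rw [e, add_tsub_cancel_right, ← Matrix.mul_assoc]

end LDC

/-! ### Exponential inequalities for sequential functionals of Gaussian noise -/

/-- A product of sequential weights, each of conditional mass at most one, has mass at most one. -/
theorem lintegral_prod_weights_le_one {X : Type*} [MeasurableSpace X] (μ : Measure X)
    [IsProbabilityMeasure μ] (w : ∀ t : ℕ, (Fin t → X) → X → ℝ≥0∞)
    (hw : ∀ t, Measurable fun q : (Fin t → X) × X => w t q.1 q.2)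
    (h1 : ∀ t p, ∫⁻ x, w t p x ∂μ ≤ 1) (n : ℕ) :
    ∫⁻ ξ : Fin n → X, ∏ t : Fin n, w t (fun i => ξ (Fin.castLE t.2.le i)) (ξ t)
      ∂(Measure.pi fun _ => μ) ≤ 1 := by
  induction n with
  | zero => simp
  | succ n ih =>
    have hmp := (measurePreserving_piFinSuccAbove (fun _ : Fin (n + 1) => μ) (Fin.last n)).symm
    have hprod : ∀ (n : ℕ), Measurable fun ξ : Fin n → X =>
        ∏ t : Fin n, w t (fun i => ξ (Fin.castLE t.2.le i)) (ξ t) := fun n =>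
      Finset.measurable_fun_prod _ fun t _ =>
        (hw t).comp (g := fun q : (Fin t → X) × X => w t q.1 q.2)
          (f := fun ξ : Fin n → X => (fun i => ξ (Fin.castLE t.2.le i), ξ t))
          ((measurable_pi_lambda _ fun i => measurable_pi_apply _).prodMk
            (measurable_pi_apply _))
    -- Tonelli with the newest coordinate integrated innermost: the earlier weights do not involve
    -- it, and the last weight integrates to at most one for every past.
    rw [← hmp.lintegral_comp (hprod (n + 1)), lintegral_prod_symm]
    · have hrw : ∀ (x : X) (ξ : Fin n → X),
          (∏ t : Fin (n + 1), w t (fun i => (MeasurableEquiv.piFinSuccAbove (fun _ => X)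
              (Fin.last n)).symm (x, ξ) (Fin.castLE t.2.le i))
            ((MeasurableEquiv.piFinSuccAbove (fun _ => X) (Fin.last n)).symm (x, ξ) t))
          = (∏ t : Fin n, w t (fun i => ξ (Fin.castLE t.2.le i)) (ξ t)) * w n ξ x := by
        intro x ξ
        rw [Fin.prod_univ_castSucc]
        simp only [MeasurableEquiv.piFinSuccAbove_symm_apply, Fin.insertNthEquiv_last]
        have e : ∀ i : Fin n, (Fin.snocEquiv (fun _ => X)) (x, ξ) (Fin.castSucc i) = ξ i := by
          intro i; simp [Fin.snocEquiv]
        have e2 : (Fin.snocEquiv (fun _ => X)) (x, ξ) (Fin.last n) = x := by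
          simp [Fin.snocEquiv]
        congr 1
        · refine Finset.prod_congr rfl fun t _ => ?_
          rw [e]
          congr 1
          funext i
          exact e (Fin.castLE t.2.le i)
        · simp only [Fin.val_last, e2]
          congr 1
          funext i
          exact e i
      simp only [hrw]
      calc ∫⁻ ξ, ∫⁻ x, (∏ t : Fin n, w t (fun i => ξ (Fin.castLE t.2.le i)) (ξ t)) * w n ξ x ∂μ
            ∂(Measure.pi fun _ => μ)
          ≤ ∫⁻ ξ, (∏ t : Fin n, w t (fun i => ξ (Fin.castLE t.2.le i)) (ξ t)) * 1
            ∂(Measure.pi fun _ => μ) := by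
            refine lintegral_mono fun ξ => ?_
            rw [lintegral_const_mul]
            · exact mul_le_mul_right (h1 n ξ) _
            · exact (hw n).comp (measurable_const.prodMk measurable_id)
        _ ≤ 1 := by simpa using ih
    · exact ((hprod (n + 1)).comp (MeasurableEquiv.measurable _)).aemeasurable

/-- Extension of a finite sequence by zero. -/
def extendZero {X : Type*} [Zero X] {n : ℕ} (ξ : Fin n → X) (s : ℕ) : X :=
  if h : s < n then ξ ⟨s, h⟩ else 0

theorem measurable_extendZero {X : Type*} [Zero X] [MeasurableSpace X] {n : ℕ} (s : ℕ) :
    Measurable fun ξ : Fin n → X => extendZero ξ s := by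
  unfold extendZero
  split_ifs with h
  · exact measurable_pi_apply _
  · exact measurable_const

/-- Chernoff bound for sums of sequential functionals `f t (past) (present)`. -/
theorem measure_sum_gt_le {X : Type*} [Zero X] [MeasurableSpace X] (μ : Measure X)
    [IsProbabilityMeasure μ] (f : ℕ → (ℕ → X) → X → ℝ)
    (hf : ∀ t, Measurable fun q : (ℕ → X) × X => f t q.1 q.2)
    (h1 : ∀ t p, ∫⁻ x, ENNReal.ofReal (Real.exp (f t p x)) ∂μ ≤ 1)
    (hloc : ∀ t p p' x, (∀ s < t, p s = p' s) → f t p x = f t p' x) (n : ℕ) (c : ℝ) :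
    (Measure.pi fun _ : Fin n => μ)
      {ξ | c < ∑ t ∈ Finset.range n, f t (extendZero ξ) (extendZero ξ t)}
        ≤ ENNReal.ofReal (Real.exp (-c)) := by
  set w : ∀ t : ℕ, (Fin t → X) → X → ℝ≥0∞ := fun t p x =>
    ENNReal.ofReal (Real.exp (f t (extendZero p) x)) with hwdef
  have hw : ∀ t, Measurable fun q : (Fin t → X) × X => w t q.1 q.2 := by
    intro t
    refine ENNReal.measurable_ofReal.comp (Real.measurable_exp.comp ((hf t).comp
      (f := fun q : (Fin t → X) × X => (extendZero q.1, q.2)) ?_))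
    exact (measurable_pi_lambda _ fun s => (measurable_extendZero s).comp measurable_fst).prodMk
      measurable_snd
  have key := lintegral_prod_weights_le_one μ w hw (fun t p => h1 t _) n
  have hprod : ∀ ξ : Fin n → X, ∏ t : Fin n, w t (fun i => ξ (Fin.castLE t.2.le i)) (ξ t)
      = ENNReal.ofReal
        (Real.exp (∑ t ∈ Finset.range n, f t (extendZero ξ) (extendZero ξ t))) := by
    intro ξ
    rw [Real.exp_sum, ENNReal.ofReal_prod_of_nonneg fun i _ => (Real.exp_pos _).le,
      Finset.prod_range]
    refine Finset.prod_congr rfl fun t _ => ?_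
    simp only [hwdef]
    have e : extendZero ξ (t : ℕ) = ξ t := by simp [extendZero]
    rw [e]
    congr 2
    -- Each functional sees only its past, so the zero extension of the prefix and that of the full
    -- sequence give the same value.
    refine hloc _ _ _ _ fun s hs => ?_
    simp [extendZero, hs, hs.trans t.2]
  simp only [hprod] at key
  have hmeas : Measurable fun ξ : Fin n → X =>
      ENNReal.ofReal
        (Real.exp (∑ t ∈ Finset.range n, f t (extendZero ξ) (extendZero ξ t))) := by
    refine ENNReal.measurable_ofReal.comp (Real.measurable_exp.comp ?_)
    refine Finset.measurable_fun_sum _ fun t _ => (hf t).comp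
      (f := fun ξ : Fin n → X => (extendZero ξ, extendZero ξ t)) ?_
    exact (measurable_pi_lambda _ fun s => measurable_extendZero s).prodMk
      (measurable_extendZero t)
  have hmk := mul_meas_ge_le_lintegral (μ := Measure.pi fun _ : Fin n => μ) hmeas
    (ENNReal.ofReal (Real.exp c))
  have h2 := hmk.trans key
  have h3 : (Measure.pi fun _ : Fin n => μ)
      {ξ | c < ∑ t ∈ Finset.range n, f t (extendZero ξ) (extendZero ξ t)}
      ≤ (Measure.pi fun _ : Fin n => μ) {ξ | ENNReal.ofReal (Real.exp c) ≤ ENNReal.ofReal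
        (Real.exp (∑ t ∈ Finset.range n, f t (extendZero ξ) (extendZero ξ t)))} := by
    refine measure_mono fun ξ hξ => ?_
    exact ENNReal.ofReal_le_ofReal (Real.exp_le_exp.2 (le_of_lt hξ))
  refine h3.trans ?_
  rw [Real.exp_neg, ENNReal.ofReal_inv_of_pos (Real.exp_pos _), ← one_div]
  rw [ENNReal.le_div_iff_mul_le (Or.inl (by simpa using Real.exp_pos c)) (Or.inl (by simp)),
    mul_comm]
  exact h2

theorem lintegral_exp_mul_gaussian (s : ℝ) :
    ∫⁻ x, ENNReal.ofReal (Real.exp (s * x)) ∂(gaussianReal 0 1)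
      = ENNReal.ofReal (Real.exp (s ^ 2 / 2)) := by
  rw [← ofReal_integral_eq_lintegral_ofReal (integrable_exp_mul_gaussianReal s)
    (Filter.Eventually.of_forall fun x => (Real.exp_pos _).le)]
  have := congrFun (mgf_id_gaussianReal (μ := 0) (v := 1)) s
  simp only [mgf, id] at this
  rw [this]
  simp

theorem lintegral_exp_linear_gaussian_le (s : ℝ) :
    ∫⁻ x, ENNReal.ofReal (Real.exp (s * x - s ^ 2 / 2)) ∂(gaussianReal 0 1) ≤ 1 := by
  have : ∀ x : ℝ, ENNReal.ofReal (Real.exp (s * x - s ^ 2 / 2))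
      = ENNReal.ofReal (Real.exp (-(s ^ 2 / 2))) * ENNReal.ofReal (Real.exp (s * x)) := by
    intro x
    rw [← ENNReal.ofReal_mul (Real.exp_pos _).le, ← Real.exp_add]
    ring_nf
  simp only [this]
  rw [lintegral_const_mul _ (by fun_prop), lintegral_exp_mul_gaussian,
    ← ENNReal.ofReal_mul (Real.exp_pos _).le, ← Real.exp_add]
  simp

/-- The second-order bound `-log (1 - y) ≤ y + y ^ 2`. With `y = 2 s` it controls the chi-square
moment generating function `(1 - 2 s) ^ (-1/2)`. -/
theorem one_le_mul_exp_of_le_half {y : ℝ} (hy : y ≤ 1 / 2) :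
    1 ≤ (1 - y) * Real.exp (y + y ^ 2) := by
  rcases le_total y 0 with h | h
  · have h1 := Real.add_one_le_exp (y + y ^ 2)
    nlinarith [mul_le_mul_of_nonneg_left h1 (by linarith : 0 ≤ 1 - y), sq_nonneg y,
      mul_nonneg (neg_nonneg.2 h) (sq_nonneg y)]
  · have h1 := Real.quadratic_le_exp_of_nonneg (x := y + y ^ 2) (by positivity)
    have h2 := mul_le_mul_of_nonneg_left h1 (by linarith : 0 ≤ 1 - y)
    have h3 : 0 ≤ (1 - y) * (1 + y) ^ 2 - 2 * y := by
      nlinarith [mul_nonneg h (by linarith : 0 ≤ 1 / 2 - y), mul_nonneg h (mul_nonneg h h)]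
    nlinarith [mul_nonneg (mul_nonneg h h) h3]

theorem lintegral_exp_sq_gaussian {s : ℝ} (hs : s < 1 / 2) :
    ∫⁻ x, ENNReal.ofReal (Real.exp (s * x ^ 2)) ∂(gaussianReal 0 1)
      = ENNReal.ofReal (√((1 - 2 * s)⁻¹)) := by
  rw [gaussianReal_of_var_ne_zero _ one_ne_zero,
    lintegral_withDensity_eq_lintegral_mul _ (measurable_gaussianPDF 0 1) (by fun_prop)]
  have hb : 0 < 1 / 2 - s := by linarith
  have : ∀ x : ℝ, (gaussianPDF 0 1 * fun x => ENNReal.ofReal (Real.exp (s * x ^ 2))) x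
      = ENNReal.ofReal ((√(2 * Real.pi))⁻¹ * Real.exp (-(1 / 2 - s) * x ^ 2)) := by
    intro x
    rw [Pi.mul_apply, gaussianPDF, ← ENNReal.ofReal_mul (gaussianPDFReal_nonneg _ _ _),
      gaussianPDFReal, mul_assoc, ← Real.exp_add]
    simp only [NNReal.coe_one, mul_one, sub_zero]
    congr 3
    ring
  simp only [this]
  rw [← ofReal_integral_eq_lintegral_ofReal ((integrable_exp_neg_mul_sq hb).const_mul _)
    (Filter.Eventually.of_forall fun x => by positivity), integral_const_mul, integral_gaussian]
  congr 1
  rw [← Real.sqrt_inv, ← Real.sqrt_mul (by positivity)]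
  congr 1
  have := Real.pi_pos
  have h2 : 1 - 2 * s ≠ 0 := by linarith
  field_simp

/-- All negative `s` are allowed, so both tails of a sum of squares follow from this one inequality.
-/
theorem lintegral_exp_chiSq_gaussian_le {s : ℝ} (hs : s ≤ 1 / 4) :
    ∫⁻ x, ENNReal.ofReal (Real.exp (s * x ^ 2 - s - 2 * s ^ 2)) ∂(gaussianReal 0 1) ≤ 1 := by
  have : ∀ x : ℝ, ENNReal.ofReal (Real.exp (s * x ^ 2 - s - 2 * s ^ 2))
      = ENNReal.ofReal (Real.exp (-(s + 2 * s ^ 2)))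
        * ENNReal.ofReal (Real.exp (s * x ^ 2)) := by
    intro x
    rw [← ENNReal.ofReal_mul (Real.exp_pos _).le, ← Real.exp_add]
    ring_nf
  simp only [this]
  rw [lintegral_const_mul _ (by fun_prop), lintegral_exp_sq_gaussian (by linarith),
    ← ENNReal.ofReal_mul (Real.exp_pos _).le, ENNReal.ofReal_le_one]
  have h1 := one_le_mul_exp_of_le_half (y := 2 * s) (by linarith)
  have h2 : 0 < 1 - 2 * s := by linarith
  rw [Real.exp_neg, inv_mul_le_one₀ (Real.exp_pos _)]
  refine Real.sqrt_le_iff.2 ⟨(Real.exp_pos _).le, ?_⟩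
  rw [← Real.exp_nat_mul, inv_le_iff_one_le_mul₀ h2, mul_comm]
  have e : ((2 : ℕ) : ℝ) * (s + 2 * s ^ 2) = 2 * s + (2 * s) ^ 2 := by push_cast; ring
  rw [e]
  exact h1

/-! ### Exponential moments of standard Gaussian vectors. -/

section Vector

variable {du : ℕ}

/-- The standard Gaussian law on `ℝ^du`. -/
def gaussianVec (du : ℕ) : Measure (Fin du → ℝ) := Measure.pi fun _ => gaussianReal 0 1

instance : IsProbabilityMeasure (gaussianVec du) := by
  unfold gaussianVec; infer_instance

theorem lintegral_gaussianVec_eval (a : Fin du) {f : ℝ → ℝ≥0∞} (hf : Measurable f) :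
    ∫⁻ x, f (x a) ∂(gaussianVec du) = ∫⁻ y, f y ∂(gaussianReal 0 1) :=
  (measurePreserving_eval (fun _ : Fin du => gaussianReal 0 1) a).lintegral_comp hf

theorem lintegral_gaussianVec_linear_le (a : Fin du) (s : ℝ) :
    ∫⁻ x, ENNReal.ofReal (Real.exp (s * x a - s ^ 2 / 2)) ∂(gaussianVec du) ≤ 1 := by
  rw [lintegral_gaussianVec_eval a
    (f := fun y => ENNReal.ofReal (Real.exp (s * y - s ^ 2 / 2))) (by fun_prop)]
  exact lintegral_exp_linear_gaussian_le s

theorem lintegral_gaussianVec_chiSq_le (a : Fin du) {s : ℝ} (hs : s ≤ 1 / 4) :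
    ∫⁻ x, ENNReal.ofReal (Real.exp (s * x a ^ 2 - s - 2 * s ^ 2)) ∂(gaussianVec du) ≤ 1 := by
  rw [lintegral_gaussianVec_eval a
    (f := fun y => ENNReal.ofReal (Real.exp (s * y ^ 2 - s - 2 * s ^ 2))) (by fun_prop)]
  exact lintegral_exp_chiSq_gaussian_le hs

/-- Conditionally on one coordinate the product is a linear Gaussian functional; integrating out the
other leaves `exp (s ^ 2 x ^ 2 / 2)`, to which the chi-square bound with parameter `s ^ 2 / 2 ≤ 1 /
4` applies. -/
theorem lintegral_gaussianVec_cross_le {a b : Fin du} (hab : a ≠ b) {s : ℝ} (hs : s ^ 2 ≤ 1 / 2) :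
    ∫⁻ x, ENNReal.ofReal (Real.exp (s * (x a * x b) - s ^ 2)) ∂(gaussianVec du) ≤ 1 := by
  have hind : IndepFun (fun x : Fin du → ℝ => x a) (fun x : Fin du → ℝ => x b)
      (gaussianVec du) :=
    (iIndepFun_pi (μ := fun _ : Fin du => gaussianReal 0 1) (X := fun _ x => x)
      (fun _ => aemeasurable_id)).indepFun hab
  have hmap := (indepFun_iff_map_prod_eq_prod_map_map
    (measurable_pi_apply a).aemeasurable (measurable_pi_apply b).aemeasurable).1 hind
  have ha : (gaussianVec du).map (fun x => x a) = gaussianReal 0 1 :=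
    (measurePreserving_eval (fun _ : Fin du => gaussianReal 0 1) a).map_eq
  have hb : (gaussianVec du).map (fun x => x b) = gaussianReal 0 1 :=
    (measurePreserving_eval (fun _ : Fin du => gaussianReal 0 1) b).map_eq
  rw [ha, hb] at hmap
  have hm : Measurable fun q : ℝ × ℝ =>
      ENNReal.ofReal (Real.exp (s * (q.1 * q.2) - s ^ 2)) := by fun_prop
  rw [← lintegral_map (f := fun q : ℝ × ℝ => ENNReal.ofReal (Real.exp (s * (q.1 * q.2) - s ^ 2)))
    (g := fun x : Fin du → ℝ => (x a, x b)) hm (by fun_prop), hmap, lintegral_prod _ hm.aemeasurable]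
  have h1 : ∀ x y : ℝ, ENNReal.ofReal (Real.exp (s * (x * y) - s ^ 2))
      = ENNReal.ofReal (Real.exp (-s ^ 2)) * ENNReal.ofReal (Real.exp ((s * x) * y)) := by
    intro x y
    rw [← ENNReal.ofReal_mul (Real.exp_pos _).le, ← Real.exp_add]
    ring_nf
  simp only [h1]
  have h2 : ∀ x : ℝ, ∫⁻ y, ENNReal.ofReal (Real.exp (-s ^ 2)) *
      ENNReal.ofReal (Real.exp ((s * x) * y)) ∂(gaussianReal 0 1)
      ≤ ENNReal.ofReal (Real.exp ((s ^ 2 / 2) * x ^ 2 - s ^ 2 / 2 - 2 * (s ^ 2 / 2) ^ 2)) := by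
    intro x
    rw [lintegral_const_mul _ (by fun_prop), lintegral_exp_mul_gaussian,
      ← ENNReal.ofReal_mul (Real.exp_pos _).le, ← Real.exp_add]
    refine ENNReal.ofReal_le_ofReal (Real.exp_le_exp.2 ?_)
    nlinarith [sq_nonneg s]
  exact (lintegral_mono h2).trans (lintegral_exp_chiSq_gaussian_le (by linarith))

/-- The coordinates of one vector play the role of the independent sequence, with chi-square
parameter `1 / 4`. -/
theorem gaussianVec_norm_sq_gt_le (c : ℝ) :
    gaussianVec du {x | 2 * (du : ℝ) + 4 * c < euclNorm x ^ 2}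
      ≤ ENNReal.ofReal (Real.exp (-c)) := by
  have h := measure_sum_gt_le (gaussianReal 0 1) (fun _ _ x => 1 / 4 * x ^ 2 - 1 / 4 - 2 * (1 / 4) ^ 2)
    (fun t => by fun_prop) (fun t p => lintegral_exp_chiSq_gaussian_le le_rfl)
    (fun _ _ _ _ _ => rfl) du c
  refine (measure_mono fun x hx => ?_).trans h
  simp only [Set.mem_ofPred_eq] at hx ⊢
  rw [euclNorm_sq] at hx
  rw [Finset.sum_range]
  have e : ∀ t : Fin du, extendZero x (t : ℕ) = x t := fun t => by simp [extendZero]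
  simp only [e]
  rw [Finset.sum_sub_distrib, Finset.sum_sub_distrib, ← Finset.mul_sum]
  simp only [Finset.sum_const, Finset.card_univ, Fintype.card_fin, nsmul_eq_mul]
  linarith

end Vector

/-! ### Concentration of the exploration noise -/

/-- Chernoff bound for a windowed sum whose summand at time `t` is a functional of the noise at
time `t - i` and of the noise before it. -/
theorem measure_sum_Ico_gt_le {X : Type*} [Zero X] [MeasurableSpace X] (μ : Measure X)
    [IsProbabilityMeasure μ] {h N i : ℕ} (hi : i ≤ h) (F : ℕ → (ℕ → X) → X → ℝ)
    (hF : ∀ t, Measurable fun q : (ℕ → X) × X => F t q.1 q.2)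
    (h1 : ∀ t p, ∫⁻ x, ENNReal.ofReal (Real.exp (F t p x)) ∂μ ≤ 1)
    (hloc : ∀ t p p' x, h ≤ t → (∀ s < t - i, p s = p' s) → F t p x = F t p' x) (c : ℝ) :
    (Measure.pi fun _ : Fin N => μ)
      {ξ | c < ∑ t ∈ Finset.Ico h N, F t (extendZero ξ) (extendZero ξ (t - i))}
        ≤ ENNReal.ofReal (Real.exp (-c)) := by
  -- Time is shifted by `i`, so that the noise at `τ = t - i` is the newest variable of the summand;
  -- the indicator restores the window.
  have key := measure_sum_gt_le μ
    (fun τ p x => if h ≤ τ + i ∧ τ + i < N then F (τ + i) p x else 0)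
    (fun τ => by
      by_cases hc : h ≤ τ + i ∧ τ + i < N
      · simpa only [hc, and_self, if_true] using hF (τ + i)
      · simp only [hc, if_false]; exact measurable_const)
    (fun τ p => by
      by_cases hc : h ≤ τ + i ∧ τ + i < N
      · simpa only [hc, and_self, if_true] using h1 (τ + i) p
      · simp [hc])
    (fun τ p p' x hp => by
      by_cases hc : h ≤ τ + i ∧ τ + i < N
      · simp only [hc, and_self, if_true]
        exact hloc _ _ _ _ hc.1 (by simpa using hp)
      · simp only [hc, if_false]) N c
  refine (measure_mono fun ξ hξ => ?_).trans key
  simp only [Set.mem_ofPred_eq] at hξ ⊢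
  refine hξ.trans_eq ?_
  rw [← Finset.sum_filter]
  refine Finset.sum_nbij' (fun t => t - i) (fun τ => τ + i) ?_ ?_ ?_ ?_ ?_
  · intro t ht; simp at ht ⊢; omega
  · intro t ht; simp at ht ⊢; omega
  · intro t ht; simp at ht ⊢; omega
  · intro t ht; simp at ht ⊢
  · intro t ht
    simp only [Finset.mem_Ico] at ht
    rw [Nat.sub_add_cancel (hi.trans ht.1)]

/-! ### Deviation of empirical lag correlations. -/

section Gram

variable {du : ℕ}

/-- Empirical correlation of lags `i` and `j` over the window `[h, N)`. -/
def lagCorr (h N : ℕ) (x : ℕ → Fin du → ℝ) (i j : ℕ) (a b : Fin du) : ℝ :=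
  ∑ t ∈ Finset.Ico h N, x (t - i) a * x (t - j) b

theorem lagCorr_comm (h N : ℕ) (x : ℕ → Fin du → ℝ) (i j : ℕ) (a b : Fin du) :
    lagCorr h N x i j a b = lagCorr h N x j i b a := by
  simp only [lagCorr, mul_comm]

variable {h N : ℕ}

theorem measure_chiSq_window_le {i : ℕ} (hi : i ≤ h) (a : Fin du) {s : ℝ} (hs : s ≤ 1 / 4)
    (c : ℝ) :
    explorationLaw N du {ξ | c < s * lagCorr h N (extendZero ξ) i i a a
        - (s + 2 * s ^ 2) * (N - h : ℕ)} ≤ ENNReal.ofReal (Real.exp (-c)) := by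
  have := measure_sum_Ico_gt_le (gaussianVec du) (N := N) hi
    (fun _ _ x => s * x a ^ 2 - s - 2 * s ^ 2) (fun t => by fun_prop)
    (fun t p => lintegral_gaussianVec_chiSq_le a hs) (fun _ _ _ _ _ _ => rfl) c
  refine le_trans (le_of_eq ?_) this
  rw [explorationLaw]
  congr 2
  funext ξ
  simp only [Finset.sum_sub_distrib, ← Finset.mul_sum, Finset.sum_const, Nat.card_Ico,
    nsmul_eq_mul, lagCorr, ← sq]
  congr 1
  ring

theorem measure_cross_window_le {i : ℕ} (hi : i ≤ h) {a b : Fin du} (hab : a ≠ b) {s : ℝ}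
    (hs : s ^ 2 ≤ 1 / 2) (c : ℝ) :
    explorationLaw N du {ξ | c < s * lagCorr h N (extendZero ξ) i i a b
        - s ^ 2 * (N - h : ℕ)} ≤ ENNReal.ofReal (Real.exp (-c)) := by
  have := measure_sum_Ico_gt_le (gaussianVec du) (N := N) hi
    (fun _ _ x => s * (x a * x b) - s ^ 2) (fun t => by fun_prop)
    (fun t p => lintegral_gaussianVec_cross_le hab hs) (fun _ _ _ _ _ _ => rfl) c
  refine le_trans (le_of_eq ?_) this
  rw [explorationLaw]
  congr 2
  funext ξ
  simp only [Finset.sum_sub_distrib, ← Finset.mul_sum, Finset.sum_const, Nat.card_Ico,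
    nsmul_eq_mul, lagCorr]
  congr 1
  ring

/-- For `i < j` the factor at lag `i` is fresh and the factor at lag `j` belongs to the past, so the
sum is conditionally Gaussian at each step. Its variance proxy is random, namely the empirical
energy at lag `j`, and has to be bounded separately. -/
theorem measure_lag_window_le {i j : ℕ} (hij : i < j) (hj : j ≤ h) (a b : Fin du) (s c : ℝ) :
    explorationLaw N du {ξ | c < s * lagCorr h N (extendZero ξ) i j a b
        - s ^ 2 / 2 * lagCorr h N (extendZero ξ) j j b b} ≤ ENNReal.ofReal (Real.exp (-c)) := by
  have := measure_sum_Ico_gt_le (gaussianVec du) (N := N) (hij.le.trans hj)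
    (fun t p x => (s * p (t - j) b) * x a - (s * p (t - j) b) ^ 2 / 2) (fun t => by fun_prop)
    (fun t p => lintegral_gaussianVec_linear_le a _)
    (fun t p p' x ht hp => by rw [hp (t - j) (by omega)]) c
  refine le_trans (le_of_eq ?_) this
  rw [explorationLaw]
  congr 2
  funext ξ
  simp only [lagCorr, Finset.mul_sum, ← Finset.sum_sub_distrib]
  congr 1
  exact Finset.sum_congr rfl fun t _ => by ring

theorem measure_linear_window_le {i : ℕ} (hi : i ≤ h) (a : Fin du) (o : ℕ → ℝ) (s c : ℝ) :
    explorationLaw N du {ξ | c < s * ∑ t ∈ Finset.Ico h N, extendZero ξ (t - i) a * o t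
        - s ^ 2 / 2 * ∑ t ∈ Finset.Ico h N, o t ^ 2} ≤ ENNReal.ofReal (Real.exp (-c)) := by
  have := measure_sum_Ico_gt_le (gaussianVec du) (N := N) hi
    (fun t _ x => (s * o t) * x a - (s * o t) ^ 2 / 2) (fun t => by fun_prop)
    (fun t p => lintegral_gaussianVec_linear_le a _)
    (fun t p p' x ht hp => rfl) c
  refine le_trans (le_of_eq ?_) this
  rw [explorationLaw]
  congr 2
  funext ξ
  simp only [Finset.mul_sum, ← Finset.sum_sub_distrib]
  congr 1
  exact Finset.sum_congr rfl fun t _ => by ring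

/-- Each entry of the empirical lag covariance concentrates. -/
theorem measure_lagCorr_le {i j : ℕ} (hi : i ≤ h) (hj : j ≤ h) (a b : Fin du) {s c : ℝ}
    (hs0 : 0 < s) (hs : s ≤ 1 / 4) (hc : 0 ≤ c) :
    explorationLaw N du {ξ | 2 * c / s + 2 * s * (N - h : ℕ)
        < |lagCorr h N (extendZero ξ) i j a b - if i = j ∧ a = b then ((N - h : ℕ) : ℝ) else 0|}
      ≤ 4 * ENNReal.ofReal (Real.exp (-c)) := by
  set n : ℝ := ((N - h : ℕ) : ℝ) with hn
  have hn0 : 0 ≤ n := Nat.cast_nonneg _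
  set p := ENNReal.ofReal (Real.exp (-c)) with hp
  have hcs : c / s * s = c := div_mul_cancel₀ _ hs0.ne'
  have hcs0 : 0 ≤ c / s := by positivity
  have h2cs : 2 * c / s = 2 * (c / s) := by ring
  have hp4 : p + p + p ≤ 4 * p := by
    have : p + p + p = 3 * p := by ring
    rw [this]
    exact mul_le_mul_left (by norm_num) _
  have hp2 : p + p ≤ 4 * p := le_trans (by simp) hp4
  -- Three events suffice: two tails of the self-normalized sum, and the upper tail of its variance
  -- proxy.
  have lagcase : ∀ {i j : ℕ}, i ≤ h → j ≤ h → ∀ a b : Fin du, i < j →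
      explorationLaw N du {ξ | 2 * c / s + 2 * s * n
        < |lagCorr h N (extendZero ξ) i j a b|} ≤ 4 * p := by
    intro i j hi hj a b hij
    have e1 := measure_lag_window_le (N := N) hij hj a b s c
    have e2 := measure_lag_window_le (N := N) hij hj a b (-s) c
    have e3 := measure_chiSq_window_le (N := N) hj b hs c
    refine le_trans ?_ ((measure_union_le _ _).trans
      (add_le_add ((measure_union_le _ _).trans (add_le_add e1 e2)) e3) |>.trans hp4)
    refine measure_mono fun ξ hξ => ?_
    by_contra hcon
    simp only [Set.mem_union, Set.mem_ofPred_eq, not_or, not_lt] at hcon hξ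
    obtain ⟨⟨q1, q2⟩, q3⟩ := hcon
    rw [← hn] at q3
    set G := lagCorr h N (extendZero ξ) i j a b
    set Q := lagCorr h N (extendZero ξ) j j b b
    have q4 : Q ≤ c / s + (1 + 2 * s) * n := by
      have : s * Q ≤ s * (c / s + (1 + 2 * s) * n) := by nlinarith
      exact le_of_mul_le_mul_left this hs0
    have q5 : s * |G| ≤ c + s ^ 2 / 2 * Q := by
      rw [← abs_of_pos hs0, ← abs_mul, abs_of_pos hs0, abs_le]
      constructor <;> nlinarith
    have q6 : s * |G| ≤ s * (2 * c / s + 2 * s * n) := by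
      have : s ^ 2 / 2 * Q ≤ s ^ 2 / 2 * (c / s + (1 + 2 * s) * n) :=
        mul_le_mul_of_nonneg_left q4 (by positivity)
      have e1 : s ^ 2 / 2 * (c / s) = s / 2 * c := by field_simp
      have e2 : s * (2 * c / s + 2 * s * n) = 2 * c + 2 * s ^ 2 * n := by
        rw [h2cs, mul_add, mul_left_comm, mul_comm s (c / s), hcs]; ring
      rw [e2]
      nlinarith [mul_nonneg (sq_nonneg s) hn0, mul_nonneg (mul_nonneg (sq_nonneg s) hn0) hs0.le]
    exact absurd (le_of_mul_le_mul_left q6 hs0) (not_le.2 hξ)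
  have fin2 : ∀ G m : ℝ, 0 ≤ m → m ≤ 2 * s * n → s * G - s * m ≤ c → -(s * G) - s * m ≤ c →
      |G| ≤ 2 * c / s + 2 * s * n := by
    intro G m hm0 hm h1 h2
    have : s * |G| ≤ s * (c / s + m) := by
      rw [← abs_of_pos hs0, ← abs_mul, abs_of_pos hs0, abs_le]
      constructor <;> nlinarith
    have := le_of_mul_le_mul_left this hs0
    rw [h2cs]
    linarith
  rcases lt_trichotomy i j with hij | hij | hij
  · simpa [hij.ne] using lagcase hi hj a b hij
  · subst hij
    by_cases hab : a = b
    · subst hab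
      have e1 := measure_chiSq_window_le (N := N) hi a hs c
      have e2 := measure_chiSq_window_le (N := N) hi a (s := -s) (by linarith) c
      refine le_trans ?_ ((measure_union_le _ _).trans (add_le_add e1 e2) |>.trans hp2)
      refine measure_mono fun ξ hξ => ?_
      by_contra hcon
      simp only [Set.mem_union, Set.mem_ofPred_eq, not_or, not_lt, and_self, if_true] at hcon hξ
      rw [← hn] at hcon
      obtain ⟨q1, q2⟩ := hcon
      refine absurd (fin2 _ (2 * s * n) (by positivity) le_rfl ?_ ?_) (not_le.2 hξ) <;> nlinarith
    · have e1 := measure_cross_window_le (N := N) hi hab (s := s) (by nlinarith) c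
      have e2 := measure_cross_window_le (N := N) hi hab (s := -s) (by nlinarith) c
      refine le_trans ?_ ((measure_union_le _ _).trans (add_le_add e1 e2) |>.trans hp2)
      refine measure_mono fun ξ hξ => ?_
      by_contra hcon
      simp only [Set.mem_union, Set.mem_ofPred_eq, not_or, not_lt, hab, and_false, if_false,
        sub_zero] at hcon hξ
      rw [← hn] at hcon
      obtain ⟨q1, q2⟩ := hcon
      refine absurd (fin2 _ (s * n) (by positivity) (by nlinarith) ?_ ?_) (not_le.2 hξ) <;>
        nlinarith
  · have := lagcase hj hi b a hij
    simp only [lagCorr_comm h N _ j i b a] at this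
    simpa [hij.ne'] using this

/-- The offsets are deterministic, so the correlation is Gaussian with variance equal to their
energy; this is its two-sided tail. -/
theorem measure_noiseCorr_le {i : ℕ} (hi : i ≤ h) (a : Fin du) (o : ℕ → ℝ) {c : ℝ} (hc : 0 < c) :
    explorationLaw N du {ξ | 2 * c * ∑ t ∈ Finset.Ico h N, o t ^ 2
        < (∑ t ∈ Finset.Ico h N, extendZero ξ (t - i) a * o t) ^ 2}
      ≤ 2 * ENNReal.ofReal (Real.exp (-c)) := by
  set Q := ∑ t ∈ Finset.Ico h N, o t ^ 2 with hQ
  have hQ0 : 0 ≤ Q := Finset.sum_nonneg fun _ _ => sq_nonneg _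
  rcases hQ0.eq_or_lt with h0 | h0
  · have ho : ∀ t ∈ Finset.Ico h N, o t = 0 := by
      intro t ht
      have := (Finset.sum_eq_zero_iff_of_nonneg (fun t _ => sq_nonneg (o t))).1 h0.symm t ht
      exact pow_eq_zero_iff (two_ne_zero) |>.1 this
    have : {ξ : Fin N → Fin du → ℝ | 2 * c * Q
        < (∑ t ∈ Finset.Ico h N, extendZero ξ (t - i) a * o t) ^ 2} = ∅ := by
      ext ξ
      have hz : ∑ t ∈ Finset.Ico h N, extendZero ξ (t - i) a * o t = 0 :=
        Finset.sum_eq_zero fun t ht => by rw [ho t ht, mul_zero]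
      simp [← h0, hz]
    rw [this]
    simp
  -- The optimal Chernoff parameter, balancing `c / s` against `s Q / 2`.
  · set s := √(2 * c / Q) with hs
    have hs0 : 0 < s := Real.sqrt_pos.2 (by positivity)
    have hsQ : s ^ 2 * Q = 2 * c := by
      rw [hs, Real.sq_sqrt (by positivity)]; field_simp
    have e1 := measure_linear_window_le (N := N) hi a o s c
    have e2 := measure_linear_window_le (N := N) hi a o (-s) c
    rw [two_mul (ENNReal.ofReal (Real.exp (-c)))]
    refine le_trans ?_ ((measure_union_le _ _).trans (add_le_add e1 e2))
    refine measure_mono fun ξ hξ => ?_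
    by_contra hcon
    simp only [Set.mem_union, Set.mem_ofPred_eq, not_or, not_lt] at hcon hξ
    rw [← hQ] at hcon
    obtain ⟨q1, q2⟩ := hcon
    set G := ∑ t ∈ Finset.Ico h N, extendZero ξ (t - i) a * o t
    have q3 : |s * G| ≤ 2 * c := by
      rw [abs_le]; constructor <;> nlinarith
    have q4 : (s * G) ^ 2 ≤ (2 * c) ^ 2 := by
      rw [← sq_abs]; exact pow_le_pow_left₀ (abs_nonneg _) q3 2
    have q5 : s ^ 2 * G ^ 2 ≤ s ^ 2 * (2 * c * Q) := by nlinarith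
    exact absurd (le_of_mul_le_mul_left q5 (by positivity)) (not_le.2 hξ)

end Gram

/-! ### The favourable exploration events. -/

section GoodNoise

variable {du : ℕ} {κ : Type} [Fintype κ]

/-- Noise sequences that are bounded, have a well-conditioned empirical covariance, and are
almost uncorrelated with the offsets `o`. -/
structure GoodNoise (h N : ℕ) (s c : ℝ) (o : ℕ → κ → ℝ) (x : ℕ → Fin du → ℝ) : Prop where
  lag : ∀ i ≤ h, ∀ j ≤ h, ∀ a b,
    |lagCorr h N x i j a b - if i = j ∧ a = b then ((N - h : ℕ) : ℝ) else 0|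
      ≤ 2 * c / s + 2 * s * (N - h : ℕ)
  offset : ∀ i ≤ h, ∀ a k, (∑ t ∈ Finset.Ico h N, x (t - i) a * o t k) ^ 2
    ≤ 2 * c * ∑ t ∈ Finset.Ico h N, o t k ^ 2

theorem measurable_extendZero_apply {N : ℕ} (t : ℕ) (a : Fin du) :
    Measurable fun ξ : Fin N → Fin du → ℝ => extendZero ξ t a :=
  (measurable_pi_apply a).comp (measurable_extendZero t)

instance (N : ℕ) : IsProbabilityMeasure (explorationLaw N du) := by
  unfold explorationLaw; infer_instance

theorem real_ge_of_compl_le {Ω : Type*} [MeasurableSpace Ω] (P : Measure Ω)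
    [IsProbabilityMeasure P] {S : Set Ω} (hS : MeasurableSet S) {δ : ℝ} (hδ : 0 ≤ δ)
    (h : P Sᶜ ≤ ENNReal.ofReal δ) : 1 - δ ≤ P.real S := by
  have h1 : P.real Sᶜ ≤ δ := ENNReal.toReal_le_of_le_ofReal hδ h
  rw [probReal_compl_eq_one_sub hS] at h1
  linarith

/-- The union bound runs over times below `T` and not below `N`, since exploration may be longer
than the horizon and only the rounds before `T` count. -/
theorem exists_bounded_noise_event (N T : ℕ) (c : ℝ) :
    ∃ S : Set (Fin N → Fin du → ℝ), MeasurableSet S ∧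
      explorationLaw N du Sᶜ ≤ T * ENNReal.ofReal (Real.exp (-c)) ∧
      ∀ ξ ∈ S, ∀ t < N, t < T → euclNorm (extendZero ξ t) ^ 2 ≤ 2 * du + 4 * c := by
  refine ⟨⋂ t : Fin T, {ξ | euclNorm (extendZero ξ t) ^ 2 ≤ 2 * du + 4 * c}, ?_, ?_, ?_⟩
  · refine MeasurableSet.iInter fun t => measurableSet_le ?_ measurable_const
    simp only [euclNorm_sq]
    exact Finset.measurable_fun_sum _ fun a _ => (measurable_extendZero_apply _ a).pow_const 2
  · rw [Set.compl_iInter]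
    refine (measure_iUnion_le _).trans ?_
    rw [tsum_fintype]
    have hb : ∀ t ∈ (Finset.univ : Finset (Fin T)), explorationLaw N du
        {ξ | euclNorm (extendZero ξ t) ^ 2 ≤ 2 * du + 4 * c}ᶜ
          ≤ ENNReal.ofReal (Real.exp (-c)) := by
      intro t _
      by_cases ht : (t : ℕ) < N
      · have hmp := measurePreserving_eval (fun _ : Fin N => gaussianVec du) ⟨t, ht⟩
        have hms : MeasurableSet {x : Fin du → ℝ | 2 * (du : ℝ) + 4 * c < euclNorm x ^ 2} := by
          refine measurableSet_lt measurable_const ?_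
          simp only [euclNorm_sq]
          exact Finset.measurable_fun_sum _ fun a _ => (measurable_pi_apply a).pow_const 2
        have := hmp.measure_preimage hms.nullMeasurableSet
        refine le_trans (le_of_eq ?_) (this.trans_le (gaussianVec_norm_sq_gt_le c))
        rw [explorationLaw]
        congr 1
        ext ξ
        simp [extendZero, ht]
      -- Beyond `N` the extended noise is zero, so for `c ≥ 0` the bad event is empty; for `c < 0`
      -- the bound exceeds one.
      · by_cases hc : 0 ≤ c
        · have : {ξ : Fin N → Fin du → ℝ | euclNorm (extendZero ξ t) ^ 2
              ≤ 2 * du + 4 * c}ᶜ = ∅ := by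
            rw [Set.compl_empty_iff, Set.eq_univ_iff_forall]
            intro ξ
            simp only [Set.mem_ofPred_eq, extendZero, ht, dif_neg, not_false_iff, euclNorm_zero]
            have := Nat.cast_nonneg (α := ℝ) du
            linarith [zero_pow (M₀ := ℝ) two_ne_zero]
          rw [this]; simp
        · refine prob_le_one.trans ?_
          rw [← ENNReal.ofReal_one]
          exact ENNReal.ofReal_le_ofReal (Real.one_le_exp (by linarith))
    refine (Finset.sum_le_card_nsmul _ _ _ hb).trans ?_
    simp
  · intro ξ hξ t _ ht
    exact Set.mem_iInter.1 hξ ⟨t, ht⟩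

/-- A union bound over all pairs of lags and coordinates for the covariance, and over all lags,
input coordinates and offset coordinates for the correlations with `o`. -/
theorem exists_goodNoise_event (h N : ℕ) {s c : ℝ} (hs0 : 0 < s) (hs : s ≤ 1 / 4) (hc : 0 < c)
    (o : ℕ → κ → ℝ) :
    ∃ S : Set (Fin N → Fin du → ℝ), MeasurableSet S ∧
      explorationLaw N du Sᶜ ≤ ((4 * ((h + 1) * du) ^ 2 + 2 * ((h + 1) * du * Fintype.card κ) : ℕ) :
        ℝ≥0∞) * ENNReal.ofReal (Real.exp (-c)) ∧
      ∀ ξ ∈ S, GoodNoise h N s c o (extendZero ξ) := by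
  set p := ENNReal.ofReal (Real.exp (-c)) with hp
  set S1 : Fin (h + 1) × Fin (h + 1) × Fin du × Fin du → Set (Fin N → Fin du → ℝ) := fun q =>
    {ξ | 2 * c / s + 2 * s * (N - h : ℕ) < |lagCorr h N (extendZero ξ) q.1 q.2.1 q.2.2.1 q.2.2.2
      - if (q.1 : ℕ) = q.2.1 ∧ q.2.2.1 = q.2.2.2 then ((N - h : ℕ) : ℝ) else 0|} with hS1
  set S2 : Fin (h + 1) × Fin du × κ → Set (Fin N → Fin du → ℝ) := fun q =>
    {ξ | 2 * c * ∑ t ∈ Finset.Ico h N, o t q.2.2 ^ 2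
        < (∑ t ∈ Finset.Ico h N, extendZero ξ (t - q.1) q.2.1 * o t q.2.2) ^ 2} with hS2
  have hm1 : ∀ q, MeasurableSet (S1 q) := by
    intro q
    refine measurableSet_lt measurable_const ?_
    refine Measurable.abs ?_
    refine Measurable.sub_const ?_ _
    exact Finset.measurable_fun_sum _ fun t _ =>
      (measurable_extendZero_apply _ _).mul (measurable_extendZero_apply _ _)
  have hm2 : ∀ q, MeasurableSet (S2 q) := by
    intro q
    refine measurableSet_lt measurable_const (Measurable.pow_const ?_ 2)
    exact Finset.measurable_fun_sum _ fun t _ => (measurable_extendZero_apply _ _).mul_const _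
  refine ⟨(⋃ q, S1 q)ᶜ ∩ (⋃ q, S2 q)ᶜ, ((MeasurableSet.iUnion hm1).compl).inter
    (MeasurableSet.iUnion hm2).compl, ?_, ?_⟩
  · rw [Set.compl_inter, compl_compl, compl_compl]
    refine (measure_union_le _ _).trans ?_
    have b1 : explorationLaw N du (⋃ q, S1 q) ≤ (4 * ((h + 1) * du) ^ 2 : ℕ) * p := by
      refine (measure_iUnion_le _).trans ?_
      rw [tsum_fintype]
      refine (Finset.sum_le_card_nsmul _ _ (4 * p) fun q _ => measure_lagCorr_le
        (Nat.lt_succ_iff.1 q.1.2) (Nat.lt_succ_iff.1 q.2.1.2) _ _ hs0 hs hc.le).trans (le_of_eq ?_)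
      simp only [Finset.card_univ, Fintype.card_prod, Fintype.card_fin, nsmul_eq_mul]
      push_cast
      ring
    have b2 : explorationLaw N du (⋃ q, S2 q)
        ≤ (2 * ((h + 1) * du * Fintype.card κ) : ℕ) * p := by
      refine (measure_iUnion_le _).trans ?_
      rw [tsum_fintype]
      refine (Finset.sum_le_card_nsmul _ _ (2 * p) fun q _ => measure_noiseCorr_le
        (Nat.lt_succ_iff.1 q.1.2) _ (fun t => o t q.2.2) hc).trans (le_of_eq ?_)
      simp only [Finset.card_univ, Fintype.card_prod, Fintype.card_fin, nsmul_eq_mul]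
      push_cast
      ring
    refine (add_le_add b1 b2).trans (le_of_eq ?_)
    push_cast
    ring
  · rintro ξ ⟨h1, h2⟩
    simp only [hS1, hS2, Set.mem_compl_iff, Set.mem_iUnion, Set.mem_ofPred_eq, not_exists,
      not_lt] at h1 h2
    refine ⟨fun i hi j hj a b => ?_, fun i hi a k => ?_⟩
    · exact h1 (⟨i, Nat.lt_succ_of_le hi⟩, ⟨j, Nat.lt_succ_of_le hj⟩, a, b)
    · exact h2 (⟨i, Nat.lt_succ_of_le hi⟩, a, k)

end GoodNoise

/-! ### Least squares -/

section LeastSquares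

variable {du : ℕ} {κ : Type} [Fintype κ]

/-- The prediction of a kernel supported on the lags `1, …, h`. -/
def lagFit (h : ℕ) (D : ℕ → Matrix κ (Fin du) ℝ) (x : ℕ → Fin du → ℝ) (t : ℕ) : κ → ℝ :=
  ∑ i ∈ Finset.Icc 1 h, D i *ᵥ x (t - i)

theorem sum_range_succ_eq_lagFit (h : ℕ) (D : ℕ → Matrix κ (Fin du) ℝ) (x : ℕ → Fin du → ℝ)
    (t : ℕ) : ∑ i ∈ Finset.range (h + 1), D i *ᵥ x (t - i) = D 0 *ᵥ x t + lagFit h D x t := by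
  rw [Finset.sum_range_succ', add_comm, Nat.sub_zero]
  congr 1
  rw [lagFit, ← Finset.sum_image (s := Finset.range h) (g := fun i => i + 1)
    (f := fun i => D i *ᵥ x (t - i)) (by intro a _ b _ hab; simpa using hab)]
  refine Finset.sum_congr ?_ fun _ _ => rfl
  ext i
  simp only [Finset.mem_image, Finset.mem_range, Finset.mem_Icc]
  constructor
  · rintro ⟨a, ha, rfl⟩; omega
  · intro hi; exact ⟨i - 1, by omega, by omega⟩

theorem lagFit_apply (h : ℕ) (D : ℕ → Matrix κ (Fin du) ℝ) (x : ℕ → Fin du → ℝ) (t : ℕ) (k : κ) :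
    lagFit h D x t k = ∑ q ∈ Finset.Icc 1 h ×ˢ (Finset.univ : Finset (Fin du)),
      D q.1 k q.2 * x (t - q.1) q.2 := by
  rw [lagFit, Finset.sum_apply, Finset.sum_product]
  rfl

/-- The normal equations. -/
theorem IsLeastSquares.normal_eq {h N : ℕ} {G₀ : Matrix κ (Fin du) ℝ} {obs : ℕ → κ → ℝ}
    {uex : ℕ → Fin du → ℝ} {G : ℕ → Matrix κ (Fin du) ℝ}
    (hG : IsLeastSquares h N G₀ obs uex G) {i : ℕ} (hi : i ∈ Finset.Icc 1 h) (k : κ) (a : Fin du) :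
    ∑ t ∈ Finset.Ico h N, (obs t - G₀ *ᵥ uex t - lagFit h G uex t) k * uex (t - i) a = 0 := by
  classical
  obtain ⟨h0, -, hmin⟩ := hG
  simp only [Finset.mem_Icc] at hi
  set r : ℕ → κ → ℝ := fun t => obs t - G₀ *ᵥ uex t - lagFit h G uex t with hr
  set c1 := ∑ t ∈ Finset.Ico h N, r t k * uex (t - i) a with hc1
  set c2 := ∑ t ∈ Finset.Ico h N, uex (t - i) a ^ 2 with hc2
  have hc20 : 0 ≤ c2 := Finset.sum_nonneg fun _ _ => sq_nonneg _
  have key : ∀ ε : ℝ, 0 ≤ -2 * ε * c1 + ε ^ 2 * c2 := by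
    intro ε
    have hq := hmin (fun j => if j = i then G i + Matrix.single k a ε else G j) (by
      rw [if_neg (by omega)]; exact h0)
    have e1 : ∀ t, ∑ j ∈ Finset.range (h + 1),
        (if j = i then G i + Matrix.single k a ε else G j) *ᵥ uex (t - j)
        = ∑ j ∈ Finset.range (h + 1), G j *ᵥ uex (t - j) + (Pi.single k (ε * uex (t - i) a) : κ → ℝ) := by
      intro t
      have : ∀ j, (if j = i then G i + Matrix.single k a ε else G j) *ᵥ uex (t - j)
          = G j *ᵥ uex (t - j) + if j = i then Pi.single k (ε * uex (t - i) a) else 0 := by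
        intro j
        split_ifs with hj
        · subst hj
          rw [Matrix.add_mulVec]
          congr 1
          funext l
          simp only [Matrix.mulVec, dotProduct, Matrix.single_apply, Pi.single_apply]
          by_cases hl : l = k
          · subst hl; simp
          · simp [hl, Ne.symm hl]
        · simp
      simp only [this]
      rw [Finset.sum_add_distrib, Finset.sum_ite_eq', if_pos (by simp; omega)]
    simp only [e1] at hq
    have e2 : ∀ t k', obs t k' - (∑ j ∈ Finset.range (h + 1), G j *ᵥ uex (t - j)) k' = r t k' := by
      intro t k'
      rw [sum_range_succ_eq_lagFit, h0]
      simp only [hr, Pi.sub_apply, Pi.add_apply]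
      ring
    have e3 : ∀ t, ∑ k', (obs t k' - (∑ j ∈ Finset.range (h + 1), G j *ᵥ uex (t - j)
          + (Pi.single k (ε * uex (t - i) a) : κ → ℝ)) k') ^ 2
        = ∑ k', r t k' ^ 2 + (-2 * ε * (r t k * uex (t - i) a) + ε ^ 2 * uex (t - i) a ^ 2) := by
      intro t
      have : ∀ k', (obs t k' - (∑ j ∈ Finset.range (h + 1), G j *ᵥ uex (t - j)
          + (Pi.single k (ε * uex (t - i) a) : κ → ℝ)) k') ^ 2 = r t k' ^ 2 +
          if k' = k then (-2 * ε * (r t k * uex (t - i) a) + ε ^ 2 * uex (t - i) a ^ 2) else 0 := by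
        intro k'
        rw [Pi.add_apply, ← sub_sub, e2]
        by_cases hk : k' = k
        · subst hk; simp; ring
        · simp [hk]
      simp only [this]
      rw [Finset.sum_add_distrib, Finset.sum_ite_eq', if_pos (Finset.mem_univ _)]
    simp only [e2, e3] at hq
    rw [Finset.sum_add_distrib, Finset.sum_add_distrib, ← Finset.mul_sum, ← Finset.mul_sum,
      ← hc1, ← hc2] at hq
    linarith
  -- Nearly the minimizer of the quadratic in `ε`; the added `1` avoids division by zero when the
  -- regressor vanishes on the window, and the value is still negative unless `c1 = 0`.
  have h1 := key (c1 / (c2 + 1))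
  have hpos : 0 < c2 + 1 := by linarith
  have h2 : -2 * (c1 / (c2 + 1)) * c1 + (c1 / (c2 + 1)) ^ 2 * c2
      = -(c1 ^ 2 * (c2 + 2) / (c2 + 1) ^ 2) := by field_simp; ring
  rw [h2] at h1
  have h3 : c1 ^ 2 * (c2 + 2) / (c2 + 1) ^ 2 ≤ 0 := by linarith
  have h4 : c1 ^ 2 * (c2 + 2) ≤ 0 := by
    by_contra hcon
    exact absurd h3 (not_le.2 (div_pos (not_le.1 hcon) (by positivity)))
  have h5 : c1 ^ 2 ≤ 0 := by nlinarith [sq_nonneg c1]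
  exact pow_eq_zero_iff two_ne_zero |>.1 (le_antisymm h5 (sq_nonneg _))

/-- Squared Frobenius norm of the lags `1, …, h`. -/
def lagFrobSq (h : ℕ) (D : ℕ → Matrix κ (Fin du) ℝ) : ℝ :=
  ∑ k, ∑ q ∈ Finset.Icc 1 h ×ˢ (Finset.univ : Finset (Fin du)), D q.1 k q.2 ^ 2

theorem lagFrobSq_nonneg (h : ℕ) (D : ℕ → Matrix κ (Fin du) ℝ) : 0 ≤ lagFrobSq h D :=
  Finset.sum_nonneg fun _ _ => Finset.sum_nonneg fun _ _ => sq_nonneg _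

theorem sum_opNorm_le_sqrt_lagFrobSq (h : ℕ) (D : ℕ → Matrix κ (Fin du) ℝ) :
    ∑ i ∈ Finset.Icc 1 h, opNorm (D i) ≤ √h * √(lagFrobSq h D) := by
  rw [← Real.sqrt_mul (Nat.cast_nonneg _)]
  refine Real.le_sqrt_of_sq_le ?_
  refine (sq_sum_le_card_mul_sum_sq).trans ?_
  simp only [Nat.card_Icc, add_tsub_cancel_right]
  refine mul_le_mul_of_nonneg_left ?_ (Nat.cast_nonneg _)
  rw [lagFrobSq]
  simp only [Finset.sum_product]
  rw [Finset.sum_comm]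
  exact Finset.sum_le_sum fun i _ => opNorm_sq_le_sum _

/-- The energy is a quadratic form in the entries of `D` whose Gram matrix is entrywise within `β`
of `(N - h) • 1`. The discrepancy is at most `β (∑ |y|) ^ 2`, and Cauchy–Schwarz over `h * du`
entries turns this into a fraction of the Frobenius norm. -/
theorem lagFit_energy_ge {h N : ℕ} {β : ℝ} {x : ℕ → Fin du → ℝ}
    (hlag : ∀ i ≤ h, ∀ j ≤ h, ∀ a b,
      |lagCorr h N x i j a b - if i = j ∧ a = b then ((N - h : ℕ) : ℝ) else 0| ≤ β)
    (D : ℕ → Matrix κ (Fin du) ℝ) :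
    ((N - h : ℕ) - β * (h * du)) * lagFrobSq h D
      ≤ ∑ t ∈ Finset.Ico h N, euclNorm (lagFit h D x t) ^ 2 := by
  classical
  simp only [euclNorm_sq]
  rw [Finset.sum_comm, lagFrobSq, Finset.mul_sum]
  refine Finset.sum_le_sum fun k _ => ?_
  simp only [lagFit_apply]
  set P := Finset.Icc 1 h ×ˢ (Finset.univ : Finset (Fin du)) with hP
  set y : ℕ × Fin du → ℝ := fun q => D q.1 k q.2 with hy
  have e1 : ∑ t ∈ Finset.Ico h N, (∑ q ∈ P, y q * x (t - q.1) q.2) ^ 2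
      = ∑ q ∈ P, ∑ q' ∈ P, y q * y q' * lagCorr h N x q.1 q'.1 q.2 q'.2 := by
    simp only [sq, Finset.sum_mul_sum]
    simp only [lagCorr, Finset.mul_sum]
    rw [Finset.sum_comm]
    refine Finset.sum_congr rfl fun q _ => ?_
    rw [Finset.sum_comm]
    exact Finset.sum_congr rfl fun q' _ => Finset.sum_congr rfl fun t _ => by ring
  have e2 : ∑ q ∈ P, ∑ q' ∈ P, y q * y q' *
      (if q.1 = q'.1 ∧ q.2 = q'.2 then ((N - h : ℕ) : ℝ) else 0)
      = (N - h : ℕ) * ∑ q ∈ P, y q ^ 2 := by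
    rw [Finset.mul_sum]
    refine Finset.sum_congr rfl fun q hq => ?_
    have : ∀ q' : ℕ × Fin du, y q * y q' *
        (if q.1 = q'.1 ∧ q.2 = q'.2 then ((N - h : ℕ) : ℝ) else 0)
        = if q = q' then ((N - h : ℕ) : ℝ) * y q ^ 2 else 0 := by
      intro q'
      by_cases hh : q = q'
      · rw [if_pos (Prod.ext_iff.1 hh), if_pos hh, ← hh]; ring
      · rw [if_neg fun hc => hh (Prod.ext_iff.2 hc), if_neg hh, mul_zero]
    simp only [this]
    rw [Finset.sum_ite_eq, if_pos hq]
  have e3 : ∑ q ∈ P, ∑ q' ∈ P, y q * y q' *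
      ((if q.1 = q'.1 ∧ q.2 = q'.2 then ((N - h : ℕ) : ℝ) else 0)
        - lagCorr h N x q.1 q'.1 q.2 q'.2) ≤ β * (∑ q ∈ P, |y q|) ^ 2 := by
    rw [sq, Finset.sum_mul_sum, Finset.mul_sum]
    refine Finset.sum_le_sum fun q hq => ?_
    rw [Finset.mul_sum]
    refine Finset.sum_le_sum fun q' hq' => ?_
    simp only [hP, Finset.mem_product, Finset.mem_Icc, Finset.mem_univ, and_true] at hq hq'
    refine (le_abs_self _).trans ?_
    rw [abs_mul, abs_mul, mul_comm β, abs_sub_comm]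
    exact mul_le_mul_of_nonneg_left (hlag _ hq.2 _ hq'.2 _ _) (by positivity)
  -- The sign of `β` is forced by the covariance bound as soon as there is an index at all.
  have hβ : 0 ≤ β ∨ P = ∅ := by
    rcases P.eq_empty_or_nonempty with h0 | ⟨q, hq⟩
    · exact Or.inr h0
    · simp only [hP, Finset.mem_product, Finset.mem_Icc, Finset.mem_univ, and_true] at hq
      exact Or.inl ((abs_nonneg _).trans (hlag _ hq.2 _ hq.2 q.2 q.2))
  have e4 : β * (∑ q ∈ P, |y q|) ^ 2 ≤ β * (h * du) * ∑ q ∈ P, y q ^ 2 := by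
    rcases hβ with hβ | hβ
    · rw [mul_assoc]
      refine mul_le_mul_of_nonneg_left ((sq_sum_le_card_mul_sum_sq).trans (le_of_eq ?_)) hβ
      simp [hP]
    · simp [hβ]
  rw [e1]
  simp only [mul_sub, Finset.sum_sub_distrib] at e3
  rw [e2] at e3
  nlinarith

theorem sum_mulVec_dotProduct_lagFit {h N : ℕ} (r : ℕ → κ → ℝ) (D : ℕ → Matrix κ (Fin du) ℝ)
    (x : ℕ → Fin du → ℝ) :
    ∑ t ∈ Finset.Ico h N, r t ⬝ᵥ lagFit h D x t
      = ∑ k, ∑ q ∈ Finset.Icc 1 h ×ˢ (Finset.univ : Finset (Fin du)),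
          D q.1 k q.2 * ∑ t ∈ Finset.Ico h N, r t k * x (t - q.1) q.2 := by
  simp only [dotProduct, lagFit_apply, Finset.mul_sum]
  rw [Finset.sum_comm]
  refine Finset.sum_congr rfl fun k _ => ?_
  rw [Finset.sum_comm]
  exact Finset.sum_congr rfl fun q _ => Finset.sum_congr rfl fun t _ => by ring

/-- Error of a solution of the normal equations, for responses that are the sum of the prediction
of `D`, of an offset `o` and of a small remainder `τ`. -/
theorem sqrt_lagFrobSq_le_of_normal_eq {h N : ℕ} {s c Rn b : ℝ} {o τ : ℕ → κ → ℝ}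
    {x : ℕ → Fin du → ℝ} (hx : GoodNoise h N s c o x) (hN : h < N) (hc : 0 ≤ c) (hRn : 0 ≤ Rn)
    (hb : 0 ≤ b)
    (hβ : (2 * c / s + 2 * s * (N - h : ℕ)) * (h * du) ≤ (N - h : ℕ) / 2)
    (ho : ∀ t, euclNorm (o t) ≤ Rn) (hτ : ∀ t ∈ Finset.Ico h N, euclNorm (τ t) ≤ b)
    (D : ℕ → Matrix κ (Fin du) ℝ)
    (hD : ∀ i ∈ Finset.Icc 1 h, ∀ k a,
      ∑ t ∈ Finset.Ico h N, (o t + τ t + lagFit h D x t) k * x (t - i) a = 0) :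
    √(lagFrobSq h D) ≤ 4 * (Rn * √(2 * c * (h * du) / (N - h : ℕ))) + 2 * b := by
  set n : ℝ := ((N - h : ℕ) : ℝ) with hn
  have hn0 : 0 < n := by rw [hn]; exact_mod_cast Nat.sub_pos_of_lt hN
  set F := lagFrobSq h D with hF
  have hF0 : 0 ≤ F := lagFrobSq_nonneg _ _
  set X := ∑ t ∈ Finset.Ico h N, euclNorm (lagFit h D x t) ^ 2 with hX
  have hX0 : 0 ≤ X := Finset.sum_nonneg fun _ _ => sq_nonneg _
  have hXF : n / 2 * F ≤ X := by
    refine le_trans ?_ (lagFit_energy_ge hx.lag D)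
    exact mul_le_mul_of_nonneg_right (by rw [← hn]; linarith) hF0
  -- The normal equations are tested against the error `D` itself, which makes its energy equal to
  -- minus its correlations with `o` and `τ`.
  have horth : ∑ t ∈ Finset.Ico h N, (o t + τ t + lagFit h D x t) ⬝ᵥ lagFit h D x t = 0 := by
    rw [sum_mulVec_dotProduct_lagFit]
    refine Finset.sum_eq_zero fun k _ => Finset.sum_eq_zero fun q hq => ?_
    rw [hD q.1 (Finset.mem_product.1 hq).1 k q.2, mul_zero]
  have hsplit : X = -(∑ t ∈ Finset.Ico h N, o t ⬝ᵥ lagFit h D x t)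
      + -(∑ t ∈ Finset.Ico h N, τ t ⬝ᵥ lagFit h D x t) := by
    simp only [add_dotProduct, Finset.sum_add_distrib, ← euclNorm_sq_eq_dotProduct] at horth
    linarith
  -- The offset need not be small, so it is not bounded in time; Cauchy–Schwarz is applied over the
  -- entries of `D`, where the good-noise event makes the correlations of order `√n`.
  have hoff : -(∑ t ∈ Finset.Ico h N, o t ⬝ᵥ lagFit h D x t)
      ≤ √F * (Rn * √(2 * c * (h * du) * n)) := by
    rw [sum_mulVec_dotProduct_lagFit, ← Finset.sum_product']
    set W := fun p : κ × (ℕ × Fin du) => ∑ t ∈ Finset.Ico h N, o t p.1 * x (t - p.2.1) p.2.2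
    set PP := (Finset.univ : Finset κ) ×ˢ (Finset.Icc 1 h ×ˢ (Finset.univ : Finset (Fin du)))
    have hW : ∑ p ∈ PP, W p ^ 2 ≤ Rn ^ 2 * (2 * c * (h * du) * n) := by
      have h1 : ∀ p ∈ PP, W p ^ 2 ≤ 2 * c * ∑ t ∈ Finset.Ico h N, o t p.1 ^ 2 := by
        intro p hp
        simp only [PP, Finset.mem_product, Finset.mem_Icc, Finset.mem_univ, and_true,
          true_and] at hp
        have := hx.offset p.2.1 hp.2 p.2.2 p.1
        simpa only [W, mul_comm] using this
      refine (Finset.sum_le_sum h1).trans ?_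
      rw [Finset.sum_product]
      simp only [Finset.sum_const, Finset.card_product, Nat.card_Icc, Finset.card_univ,
        Fintype.card_fin, nsmul_eq_mul, add_tsub_cancel_right]
      rw [← Finset.mul_sum, ← Finset.mul_sum, Finset.sum_comm]
      have h2 : ∑ t ∈ Finset.Ico h N, ∑ k, o t k ^ 2 ≤ n * Rn ^ 2 := by
        have := Finset.sum_le_card_nsmul (Finset.Ico h N) (fun t => ∑ k, o t k ^ 2) (Rn ^ 2)
          fun t _ => by
            rw [← euclNorm_sq]
            exact pow_le_pow_left₀ (euclNorm_nonneg _) (ho t) 2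
        simpa [hn] using this
      have h3 : (0 : ℝ) ≤ ((h * du : ℕ) : ℝ) * (2 * c) := by positivity
      push_cast at h3 ⊢
      nlinarith [mul_le_mul_of_nonneg_left h2 h3]
    have hcs := Finset.sum_mul_sq_le_sq_mul_sq PP (fun p => D p.2.1 p.1 p.2.2) W
    have hFe : ∑ p ∈ PP, D p.2.1 p.1 p.2.2 ^ 2 = F := by
      rw [hF, lagFrobSq, ← Finset.sum_product']
    rw [hFe] at hcs
    have h5 : (∑ p ∈ PP, D p.2.1 p.1 p.2.2 * W p) ^ 2
        ≤ (√F * (Rn * √(2 * c * (h * du) * n))) ^ 2 := by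
      rw [mul_pow, mul_pow, Real.sq_sqrt hF0, Real.sq_sqrt (by positivity)]
      exact hcs.trans (mul_le_mul_of_nonneg_left hW hF0)
    have h6 := (abs_le_of_sq_le_sq' h5 (by positivity)).1
    linarith
  -- The remainder is small but depends on the noise, so here only Cauchy–Schwarz in time is
  -- available.
  have hrem : -(∑ t ∈ Finset.Ico h N, τ t ⬝ᵥ lagFit h D x t) ≤ √X * (√n * b) := by
    have h1 : -(∑ t ∈ Finset.Ico h N, τ t ⬝ᵥ lagFit h D x t)
        ≤ ∑ t ∈ Finset.Ico h N, b * euclNorm (lagFit h D x t) := by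
      rw [← Finset.sum_neg_distrib]
      refine Finset.sum_le_sum fun t ht => ?_
      refine (neg_le_abs _).trans ((abs_dotProduct_le_euclNorm_mul _ _).trans ?_)
      exact mul_le_mul_of_nonneg_right (hτ t ht) (euclNorm_nonneg _)
    refine h1.trans ?_
    have hcs := Finset.sum_mul_sq_le_sq_mul_sq (Finset.Ico h N) (fun _ => b)
      (fun t => euclNorm (lagFit h D x t))
    simp only [Finset.sum_const, Nat.card_Ico, nsmul_eq_mul] at hcs
    rw [← hn, ← hX] at hcs
    refine (abs_le_of_sq_le_sq' ?_ (by positivity)).2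
    rw [mul_pow, mul_pow, Real.sq_sqrt hX0, Real.sq_sqrt hn0.le]
    linarith
  set A := Rn * √(2 * c * (h * du) / n) with hA
  have hA0 : 0 ≤ A := by positivity
  have hAn : Rn * √(2 * c * (h * du) * n) = A * n := by
    have : 2 * c * (h * du) * n = (2 * c * (h * du) / n) * n ^ 2 := by field_simp
    rw [this, Real.sqrt_mul (by positivity), Real.sqrt_sq hn0.le, hA]
    ring
  rw [hAn] at hoff
  set f := √F with hf
  have hf0 : 0 ≤ f := Real.sqrt_nonneg _
  have hff : f ^ 2 = F := Real.sq_sqrt hF0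
  set y := √X with hy
  have hy0 : 0 ≤ y := Real.sqrt_nonneg _
  have hyy : y ^ 2 = X := Real.sq_sqrt hX0
  set w := √n with hw
  have hw0 : 0 < w := Real.sqrt_pos.2 hn0
  have hww : w ^ 2 = n := Real.sq_sqrt hn0.le
  -- What remains is `f ^ 2 / 4 ≤ f A + b ^ 2 / 2`, which is incompatible with `f > 4 A + 2 b`.
  by_contra hcon
  push Not at hcon
  have hfpos : 0 < f := by linarith
  have i1 : y ^ 2 ≤ f * (A * w ^ 2) + y * (w * b) := by rw [hyy, hww]; linarith
  have i2 : w ^ 2 / 2 * f ^ 2 ≤ y ^ 2 := by rw [hyy, hww, hff]; exact hXF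
  have i3 : y * (w * b) ≤ y ^ 2 / 2 + w ^ 2 * b ^ 2 / 2 := by nlinarith [sq_nonneg (y - w * b)]
  have i4 : w ^ 2 * (f ^ 2 / 4) ≤ w ^ 2 * (f * A + b ^ 2 / 2) := by nlinarith
  have i5 : f ^ 2 / 4 ≤ f * A + b ^ 2 / 2 := le_of_mul_le_mul_left i4 (by positivity)
  nlinarith [mul_nonneg hf0 hb, mul_nonneg hA0 hb, mul_nonneg hb hb]

end LeastSquares

/-! ### Uniqueness of the least-squares fit. -/

section LagFit

variable {du : ℕ} {κ μ : Type} [Fintype κ] [Fintype μ]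

theorem lagFit_sub (h : ℕ) (D D' : ℕ → Matrix κ (Fin du) ℝ) (x : ℕ → Fin du → ℝ) (t : ℕ) :
    lagFit h (fun i => D i - D' i) x t = lagFit h D x t - lagFit h D' x t := by
  simp [lagFit, Matrix.sub_mulVec, Finset.sum_sub_distrib]

theorem mulVec_lagFit (h : ℕ) (Q : Matrix μ κ ℝ) (D : ℕ → Matrix κ (Fin du) ℝ)
    (x : ℕ → Fin du → ℝ) (t : ℕ) :
    Q *ᵥ lagFit h D x t = lagFit h (fun i => Q * D i) x t := by
  simp [lagFit, Matrix.mulVec_sum, Matrix.mulVec_mulVec]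

theorem GoodNoise.congr {h N : ℕ} {s c : ℝ} {o : ℕ → κ → ℝ} {x x' : ℕ → Fin du → ℝ}
    (hx : GoodNoise h N s c o x) (hxx : ∀ t < N, x' t = x t) : GoodNoise h N s c o x' := by
  refine ⟨fun i hi j hj a b => ?_, fun i hi a k => ?_⟩
  · have e : lagCorr h N x' i j a b = lagCorr h N x i j a b := by
      refine Finset.sum_congr rfl fun t ht => ?_
      simp only [Finset.mem_Ico] at ht
      rw [hxx _ (by omega), hxx _ (by omega)]
    rw [e]
    exact hx.lag i hi j hj a b
  · have e : ∑ t ∈ Finset.Ico h N, x' (t - i) a * o t k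
        = ∑ t ∈ Finset.Ico h N, x (t - i) a * o t k := by
      refine Finset.sum_congr rfl fun t ht => ?_
      simp only [Finset.mem_Ico] at ht
      rw [hxx _ (by omega)]
    rw [e]
    exact hx.offset i hi a k

/-- Uniqueness of solutions of the normal equations under a well-conditioned covariance. -/
theorem eq_zero_of_normal_eq {h N : ℕ} {β : ℝ} {x : ℕ → Fin du → ℝ}
    (hlag : ∀ i ≤ h, ∀ j ≤ h, ∀ a b,
      |lagCorr h N x i j a b - if i = j ∧ a = b then ((N - h : ℕ) : ℝ) else 0| ≤ β)
    (hN : h < N) (hβ : β * (h * du) ≤ (N - h : ℕ) / 2) (D : ℕ → Matrix κ (Fin du) ℝ)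
    (hD : ∀ i ∈ Finset.Icc 1 h, ∀ k a,
      ∑ t ∈ Finset.Ico h N, lagFit h D x t k * x (t - i) a = 0) :
    ∀ i ∈ Finset.Icc 1 h, D i = 0 := by
  have hn0 : (0 : ℝ) < ((N - h : ℕ) : ℝ) := by exact_mod_cast Nat.sub_pos_of_lt hN
  have h1 := lagFit_energy_ge hlag D
  have h2 : ∑ t ∈ Finset.Ico h N, euclNorm (lagFit h D x t) ^ 2 = 0 := by
    simp only [euclNorm_sq_eq_dotProduct]
    rw [sum_mulVec_dotProduct_lagFit]
    refine Finset.sum_eq_zero fun k _ => Finset.sum_eq_zero fun q hq => ?_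
    rw [hD q.1 (Finset.mem_product.1 hq).1 k q.2, mul_zero]
  rw [h2] at h1
  have h3 : lagFrobSq h D = 0 := by
    refine le_antisymm ?_ (lagFrobSq_nonneg _ _)
    by_contra hcon
    have := mul_pos (show (0 : ℝ) < ((N - h : ℕ) : ℝ) - β * (h * du) by linarith) (not_le.1 hcon)
    linarith
  intro i hi
  ext k a
  have h4 := (Finset.sum_eq_zero_iff_of_nonneg
    (fun k _ => Finset.sum_nonneg fun q _ => sq_nonneg _)).1 h3 k (Finset.mem_univ k)
  have h5 := (Finset.sum_eq_zero_iff_of_nonneg (fun q _ => sq_nonneg _)).1 h4 (i, a)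
    (Finset.mem_product.2 ⟨hi, Finset.mem_univ a⟩)
  simpa using h5

end LagFit

theorem conv_eq_lagFit_add_tail {du : ℕ} {κ : Type} [Fintype κ] {h t : ℕ} (ht : h ≤ t)
    (G : ℕ → Matrix κ (Fin du) ℝ) (u : ℕ → Fin du → ℝ) :
    conv G u t = G 0 *ᵥ u t + lagFit h G u t
      + ∑ i ∈ Finset.Ico (h + 1) (t + 1), G i *ᵥ u (t - i) := by
  rw [← sum_range_succ_eq_lagFit, conv,
    Finset.sum_range_add_sum_Ico _ (Nat.succ_le_succ ht)]

theorem sum_Ico_geom_le {ρ : ℝ} (h0 : 0 < ρ) (h1 : ρ < 1) (m n : ℕ) :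
    ∑ i ∈ Finset.Ico m n, ρ ^ i ≤ ρ ^ m / (1 - ρ) := by
  rcases le_total m n with hmn | hmn
  · rw [geom_sum_Ico' h1.ne hmn]
    have : 0 ≤ ρ ^ n := by positivity
    gcongr
    linarith
  · rw [Finset.Ico_eq_empty_of_le hmn]
    simp only [Finset.sum_empty]
    have : 0 < 1 - ρ := by linarith
    positivity

/-! ### Accuracy of the estimated Markov parameters. -/

section Estimation

variable {dx dy du : ℕ} {E : Environment dx dy du} {K : Matrix (Fin du) (Fin dy) ℝ} {h N : ℕ}
  {uex : ℕ → Fin du → ℝ} {Gv : ℕ → Matrix (Fin dy ⊕ Fin du) (Fin du) ℝ}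
  {Gη : ℕ → Matrix (Fin dy) (Fin du) ℝ} {s c : ℝ}

/-- The estimate of the map to `(y, u)` is the lift of the estimate of the map to `y`. -/
theorem estimate_eq_lift
    (hv : IsLeastSquares h N (Matrix.fromRows 0 1) (fun t => (E.signal K uex t).ofLp) uex Gv)
    (hη : IsLeastSquares h N 0 (E.output K uex) uex Gη)
    (hx : GoodNoise h N s c (fun t => (E.natureSignal K t).ofLp) uex) (hN : h < N)
    (hβ : (2 * c / s + 2 * s * (N - h : ℕ)) * (h * du) ≤ (N - h : ℕ) / 2) :
    ∀ i ∈ Finset.Icc 1 h, Gv i = feedbackLift K * Gη i := by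
  have key := eq_zero_of_normal_eq hx.lag hN hβ (fun i => Gv i - feedbackLift K * Gη i) ?_
  · intro i hi
    exact sub_eq_zero.1 (key i hi)
  · intro i hi k a
    have e1 := hv.normal_eq hi k a
    have e2 := fun k' => hη.normal_eq hi k' a
    -- The response `(y, u)` minus the known lag-zero term is the lift of `y`, so the lift of the
    -- fit for `y` solves the normal equations of the joint fit. Uniqueness then makes the two
    -- versions of the algorithm coincide.
    have e3 : ∑ t ∈ Finset.Ico h N,
        (feedbackLift K *ᵥ (E.output K uex t - lagFit h Gη uex t)) k * uex (t - i) a = 0 := by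
      simp only [Matrix.mulVec, dotProduct, Finset.sum_mul]
      rw [Finset.sum_comm]
      refine Finset.sum_eq_zero fun k' _ => ?_
      have := e2 k'
      simp only [Matrix.zero_mulVec, sub_zero] at this
      simp only [mul_assoc, ← Finset.mul_sum]
      rw [this, mul_zero]
    rw [← sub_zero (0 : ℝ)]
    nth_rw 2 [← e1]
    rw [← e3, ← Finset.sum_sub_distrib]
    refine Finset.sum_congr rfl fun t _ => ?_
    rw [← sub_mul, lagFit_sub, ← mulVec_lagFit, Matrix.mulVec_sub]
    have e4 : (E.signal K uex t).ofLp - Matrix.fromRows 0 1 *ᵥ uex t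
        = feedbackLift K *ᵥ E.output K uex t := by
      rw [E.signal_ofLp, inputLift]; abel
    rw [e4]
    simp only [Pi.sub_apply]
    ring

/-- Error of the estimated Markov parameters of lags `1, …, h`. -/
theorem estimation_error {cK ρ Rn b : ℝ}
    (hv : IsLeastSquares h N (Matrix.fromRows 0 1) (fun t => (E.signal K uex t).ofLp) uex Gv)
    (hη : IsLeastSquares h N 0 (E.output K uex) uex Gη)
    (hx : GoodNoise h N s c (fun t => (E.natureSignal K t).ofLp) uex) (hN : h < N)
    (hβ : (2 * c / s + 2 * s * (N - h : ℕ)) * (h * du) ≤ (N - h : ℕ) / 2)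
    (hc : 0 ≤ c) (hRn : 0 ≤ Rn) (hb : 0 ≤ b) (hcK : 0 ≤ cK) (hρ0 : 0 < ρ) (hρ1 : ρ < 1)
    (hG : ∀ i, opNorm (E.markov K i) ≤ cK * ρ ^ i) (hnat : ∀ t, ‖E.natureSignal K t‖ ≤ Rn)
    (hu : ∀ t < N, euclNorm (uex t) ≤ b) :
    ∑ i ∈ Finset.Icc 1 h, opNorm (feedbackLift K * (E.outputMarkov K i - Gη i))
      ≤ √h * (4 * (Rn * √(2 * c * (h * du) / (N - h : ℕ)))
          + 2 * (cK * (ρ ^ (h + 1) / (1 - ρ)) * b)) := by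
  have hlift := estimate_eq_lift hv hη hx hN hβ
  set D : ℕ → Matrix (Fin dy ⊕ Fin du) (Fin du) ℝ := fun i => E.markov K i - Gv i with hDdef
  have hD : ∀ i ∈ Finset.Icc 1 h, D i = feedbackLift K * (E.outputMarkov K i - Gη i) := by
    intro i hi
    rw [hDdef]
    simp only
    rw [hlift i hi, E.markov_eq, Matrix.mul_sub, if_neg, add_zero]
    simp only [Finset.mem_Icc] at hi
    omega
  rw [← Finset.sum_congr rfl fun i hi => congrArg opNorm (hD i hi)]
  refine (sum_opNorm_le_sqrt_lagFrobSq h D).trans ?_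
  refine mul_le_mul_of_nonneg_left ?_ (Real.sqrt_nonneg _)
  have h1ρ : 0 < 1 - ρ := by linarith
  -- The residual of the fit is nature's signal, plus the response to lags beyond `h`, plus the
  -- prediction of the estimation error.
  refine sqrt_lagFrobSq_le_of_normal_eq
    (τ := fun t => ∑ i ∈ Finset.Ico (h + 1) (t + 1), E.markov K i *ᵥ uex (t - i)) hx hN hc hRn
    (by positivity) hβ (fun t => hnat t) ?_ D ?_
  · intro t ht
    simp only [Finset.mem_Ico] at ht
    refine (euclNorm_sum_le _).trans ?_
    calc _ ≤ ∑ i ∈ Finset.Ico (h + 1) (t + 1), cK * ρ ^ i * b := by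
          refine Finset.sum_le_sum fun i _ => (euclNorm_mulVec_le _ _).trans ?_
          exact mul_le_mul (hG i) (hu _ (by omega)) (euclNorm_nonneg _) (by positivity)
      _ = cK * (∑ i ∈ Finset.Ico (h + 1) (t + 1), ρ ^ i) * b := by
          rw [Finset.mul_sum, Finset.sum_mul]
      _ ≤ _ := by
          have := sum_Ico_geom_le hρ0 hρ1 (h + 1) (t + 1)
          gcongr
  · intro i hi k a
    rw [← hv.normal_eq hi k a]
    refine Finset.sum_congr rfl fun t ht => ?_
    simp only [Finset.mem_Ico] at ht
    congr 2
    rw [E.signal_eq_nature_add_conv, conv_eq_lagFit_add_tail ht.1, hDdef, lagFit_sub]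
    have : E.markov K 0 = Matrix.fromRows 0 1 := by simp [Environment.markov]
    rw [this]
    simp only [Pi.add_apply, Pi.sub_apply]
    ring

end Estimation

/-! ### Regular losses -/

section Loss

variable {dy du : ℕ} {α L : ℝ} {f : Signal dy du → ℝ}

/-- Along the segment from `v` to `w`, subtracting `α t ^ 2 ‖x‖ ^ 2 / 2` leaves a function with
monotone derivative; the mean value theorem compares its increment with the derivative at `0`. -/
theorem RegularLoss.le_add_inner (hf : RegularLoss α L f) (v w : Signal dy du) :
    f v + fderiv ℝ f v (w - v) + α / 2 * ‖w - v‖ ^ 2 ≤ f w := by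
  set x := w - v with hx
  have hd : Differentiable ℝ f := hf.contDiff.differentiable (by norm_num)
  have hd' : Differentiable ℝ (fderiv ℝ f) :=
    (hf.contDiff.fderiv_right (m := 1) (by norm_num)).differentiable (by norm_num)
  have hline : ∀ t : ℝ, HasDerivAt (fun t : ℝ => v + t • x) x t := by
    intro t
    simpa using ((hasDerivAt_id t).smul_const x).const_add v
  set ψ' : ℝ → ℝ := fun t => fderiv ℝ f (v + t • x) x - α * t * ‖x‖ ^ 2 with hψ'
  have h1 : ∀ t : ℝ, HasDerivAt (fun t : ℝ => f (v + t • x) - α / 2 * t ^ 2 * ‖x‖ ^ 2)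
      (ψ' t) t := by
    intro t
    have e1 := (hd (v + t • x)).hasFDerivAt.comp_hasDerivAt t (hline t)
    have e2 : HasDerivAt (fun t : ℝ => α / 2 * t ^ 2 * ‖x‖ ^ 2) (α * t * ‖x‖ ^ 2) t := by
      have := (((hasDerivAt_pow 2 t).const_mul (α / 2)).mul_const (‖x‖ ^ 2))
      refine this.congr_deriv ?_
      push_cast
      ring
    exact e1.sub e2
  have h2 : ∀ t : ℝ, HasDerivAt ψ'
      (fderiv ℝ (fderiv ℝ f) (v + t • x) x x - α * ‖x‖ ^ 2) t := by
    intro t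
    have e1 := (hd' (v + t • x)).hasFDerivAt.comp_hasDerivAt t (hline t)
    have e2 := e1.clm_apply (hasDerivAt_const t x)
    simp only [map_zero, add_zero] at e2
    have e3 : HasDerivAt (fun t : ℝ => α * t * ‖x‖ ^ 2) (α * ‖x‖ ^ 2) t := by
      simpa using (((hasDerivAt_id t).const_mul α).mul_const (‖x‖ ^ 2))
    exact e2.sub e3
  have hmono : Monotone ψ' := by
    refine monotone_of_deriv_nonneg (fun t => (h2 t).differentiableAt) fun t => ?_
    rw [(h2 t).deriv]
    have := hf.hessian_ge (v + t • x) x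
    linarith
  obtain ⟨c, hc, hceq⟩ := exists_hasDerivAt_eq_slope
    (fun t : ℝ => f (v + t • x) - α / 2 * t ^ 2 * ‖x‖ ^ 2) ψ' zero_lt_one
    (fun t _ => (h1 t).continuousAt.continuousWithinAt) (fun t _ => h1 t)
  have h3 := hmono hc.1.le
  rw [hceq] at h3
  simp only [hψ', zero_smul, add_zero, one_smul, hx] at h3
  have hw : v + (w - v) = w := by abel
  rw [hw] at h3
  rw [hx]
  norm_num at h3
  rw [map_sub]
  linarith

theorem RegularLoss.le_add_dotProduct (hf : RegularLoss α L f) (v w : Fin dy ⊕ Fin du → ℝ) :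
    f (WithLp.toLp 2 v) + (gradient f (WithLp.toLp 2 v)).ofLp ⬝ᵥ (w - v)
      + α / 2 * euclNorm (w - v) ^ 2 ≤ f (WithLp.toLp 2 w) := by
  have h := hf.le_add_inner (WithLp.toLp 2 v) (WithLp.toLp 2 w)
  have e : fderiv ℝ f (WithLp.toLp 2 v) (WithLp.toLp 2 w - WithLp.toLp 2 v)
      = (gradient f (WithLp.toLp 2 v)).ofLp ⬝ᵥ (w - v) := by
    rw [gradient, ← InnerProductSpace.toDual_symm_apply (𝕜 := ℝ),
      EuclideanSpace.inner_eq_star_dotProduct, dotProduct_comm]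
    simp
  rw [e] at h
  exact h

/-- Convexity needs the gradient only at `v`, so only `v` has to lie in the ball of radius `V`. This
matters for comparator signals that are less tightly bounded. -/
theorem RegularLoss.sub_le (hf : RegularLoss α L f) (hα : 0 ≤ α) (v w : Fin dy ⊕ Fin du → ℝ)
    {V : ℝ} (hL : 0 ≤ L) (hV1 : 1 ≤ V) (hV : euclNorm v ≤ V) :
    f (WithLp.toLp 2 v) - f (WithLp.toLp 2 w) ≤ L * V * euclNorm (v - w) := by
  have h1 := hf.le_add_dotProduct v w
  have h2 := dotProduct_le_euclNorm_mul (-(gradient f (WithLp.toLp 2 v)).ofLp) (w - v)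
  rw [neg_dotProduct, euclNorm_neg, euclNorm_ofLp, euclNorm_sub_comm w v] at h2
  have h3 : ‖gradient f (WithLp.toLp 2 v)‖ ≤ L * V :=
    (hf.gradient_le _).trans (mul_le_mul_of_nonneg_left (max_le hV1 hV) hL)
  have h4 := mul_le_mul_of_nonneg_right h3 (euclNorm_nonneg (v - w))
  have h5 : 0 ≤ α / 2 * euclNorm (w - v) ^ 2 := by positivity
  linarith

theorem RegularLoss.nonneg (hf : RegularLoss α L f) : 0 ≤ L := by
  have := (abs_nonneg _).trans (hf.abs_le 0)
  simpa using this

theorem RegularLoss.le (hf : RegularLoss α L f) (hdim : 0 < dy + du) : α ≤ L := by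
  obtain ⟨i⟩ : Nonempty (Fin dy ⊕ Fin du) := by
    rcases Nat.eq_zero_or_pos dy with h | h
    · exact ⟨Sum.inr ⟨0, by omega⟩⟩
    · exact ⟨Sum.inl ⟨0, h⟩⟩
  have h1 := hf.hessian_ge 0 (EuclideanSpace.single i 1)
  have h2 := hf.hessian_le 0 (EuclideanSpace.single i 1)
  simp only [PiLp.norm_single, norm_one, one_pow, mul_one] at h1 h2
  linarith

end Loss

/-! ### Preconditioned projected gradient steps -/

section Online

variable {ι κ : Type} [Fintype ι] [DecidableEq ι] [Fintype κ]

/-- First-order optimality of the projection, obtained by moving from `z'` a small way towards `q`.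
-/
theorem dotProduct_projection_nonneg {S : Set (ι → ℝ)} (hS : Convex ℝ S) {Λ : Matrix ι ι ℝ}
    (hsym : Λᵀ = Λ) {z' zt q : ι → ℝ} (hz' : z' ∈ S) (hq : q ∈ S)
    (hmin : ∀ q ∈ S, (z' - zt) ⬝ᵥ (Λ *ᵥ (z' - zt)) ≤ (q - zt) ⬝ᵥ (Λ *ᵥ (q - zt))) :
    0 ≤ (q - z') ⬝ᵥ (Λ *ᵥ (z' - zt)) := by
  set B := (q - z') ⬝ᵥ (Λ *ᵥ (z' - zt)) with hB
  set Q := (q - z') ⬝ᵥ (Λ *ᵥ (q - z')) with hQ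
  have hswap : (z' - zt) ⬝ᵥ (Λ *ᵥ (q - z')) = B := by
    rw [Matrix.dotProduct_mulVec, ← Matrix.mulVec_transpose, hsym, dotProduct_comm]
  have key : ∀ θ : ℝ, 0 ≤ θ → θ ≤ 1 → 0 ≤ 2 * θ * B + θ ^ 2 * Q := by
    intro θ h0 h1
    have hmem : z' + θ • (q - z') ∈ S := hS.add_smul_sub_mem hz' hq ⟨h0, h1⟩
    have h := hmin _ hmem
    have e : z' + θ • (q - z') - zt = (z' - zt) + θ • (q - z') := by abel
    rw [e] at h
    simp only [Matrix.mulVec_add, Matrix.mulVec_smul, dotProduct_add, add_dotProduct,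
      dotProduct_smul, smul_dotProduct, smul_eq_mul] at h
    rw [hswap, ← hB, ← hQ] at h
    nlinarith
  by_contra hneg
  push Not at hneg
  have hQpos : 0 < Q := by
    have := key 1 zero_le_one le_rfl
    linarith
  -- The competing point is the minimizer of the quadratic on the segment, or its endpoint when that
  -- minimizer lies outside.
  rcases le_total 1 (-B / Q) with h1 | h1
  · have := key 1 zero_le_one le_rfl
    rw [le_div_iff₀ hQpos] at h1
    linarith
  · have := key (-B / Q) (by apply div_nonneg <;> linarith) h1
    have e : 2 * (-B / Q) * B + (-B / Q) ^ 2 * Q = -(B ^ 2 / Q) := by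
      field_simp; ring
    rw [e] at this
    have : 0 < B ^ 2 / Q := div_pos (by nlinarith) hQpos
    linarith

theorem exists_solution_of_coercive {Λ : Matrix ι ι ℝ} {lam : ℝ} (hlam : 0 < lam)
    (hΛ : ∀ x, lam * euclNorm x ^ 2 ≤ x ⬝ᵥ (Λ *ᵥ x)) (g : ι → ℝ) :
    Λ *ᵥ (Λ⁻¹ *ᵥ g) = g ∧ euclNorm (Λ⁻¹ *ᵥ g) ≤ euclNorm g / lam := by
  have hinj : Function.Injective Λ.mulVec := by
    intro x y hxy
    have h1 := hΛ (x - y)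
    rw [Matrix.mulVec_sub, show Λ *ᵥ x = Λ *ᵥ y from hxy, sub_self, dotProduct_zero] at h1
    have h2 : euclNorm (x - y) ^ 2 ≤ 0 := by
      by_contra hc
      have := mul_pos hlam (not_le.1 hc)
      linarith
    have h3 : ∀ i, (x - y) i = 0 := fun i => by
      have h4 := abs_apply_le_euclNorm (x - y) i
      have h5 : euclNorm (x - y) = 0 :=
        pow_eq_zero_iff two_ne_zero |>.1 (le_antisymm h2 (sq_nonneg _))
      rw [h5] at h4
      exact abs_eq_zero.1 (le_antisymm h4 (abs_nonneg _))
    funext i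
    exact sub_eq_zero.1 (h3 i)
  have hu : IsUnit Λ := Matrix.mulVec_injective_iff_isUnit.1 hinj
  have hsol : Λ *ᵥ (Λ⁻¹ *ᵥ g) = g := by
    rw [Matrix.mulVec_mulVec, Matrix.mul_nonsing_inv _ ((Matrix.isUnit_iff_isUnit_det _).1 hu),
      Matrix.one_mulVec]
  refine ⟨hsol, ?_⟩
  have h1 := hΛ (Λ⁻¹ *ᵥ g)
  rw [hsol] at h1
  have h2 := h1.trans (dotProduct_le_euclNorm_mul _ _)
  rw [le_div_iff₀ hlam]
  rcases (euclNorm_nonneg (Λ⁻¹ *ᵥ g)).eq_or_lt with h0 | h0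
  · rw [← h0]; simpa using euclNorm_nonneg g
  · nlinarith

/-- One Semi-ONS step: approach to every feasible point, and length of the step. -/
theorem IsSemiONSStep.bounds {S : Set (ι → ℝ)} (hS : Convex ℝ S) {η : ℝ} (hη : 0 ≤ η)
    {f : EuclideanSpace ℝ κ → ℝ} {v : κ → ℝ} {H : Matrix κ ι ℝ} {Λ : Matrix ι ι ℝ} {lam : ℝ}
    (hlam : 0 < lam) (hsym : Λᵀ = Λ) (hΛ : ∀ x, lam * euclNorm x ^ 2 ≤ x ⬝ᵥ (Λ *ᵥ x))
    {z z' : ι → ℝ} (hz : z ∈ S) (hstep : IsSemiONSStep S η f v H Λ z z') {g : ι → ℝ}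
    (hg : g = Hᵀ *ᵥ (gradient f (WithLp.toLp 2 (v + H *ᵥ z))).ofLp) :
    (∀ q ∈ S, (z' - q) ⬝ᵥ (Λ *ᵥ (z' - q)) ≤ (z - q) ⬝ᵥ (Λ *ᵥ (z - q)) - 2 * η * (g ⬝ᵥ (z - q))
        + η ^ 2 * (euclNorm g ^ 2 / lam))
      ∧ euclNorm (z' - z) ≤ η * (euclNorm g / lam) := by
  obtain ⟨hz', hmin⟩ := hstep
  rw [← hg] at hmin
  set y := Λ⁻¹ *ᵥ g with hy
  obtain ⟨hsol, hynorm⟩ := exists_solution_of_coercive hlam hΛ g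
  rw [← hy] at hsol hynorm
  have hswap : ∀ a b : ι → ℝ, a ⬝ᵥ (Λ *ᵥ b) = b ⬝ᵥ (Λ *ᵥ a) := by
    intro a b
    rw [Matrix.dotProduct_mulVec, ← Matrix.mulVec_transpose, hsym, dotProduct_comm]
  have hyg : y ⬝ᵥ g ≤ euclNorm g ^ 2 / lam := by
    refine (dotProduct_le_euclNorm_mul _ _).trans ?_
    rw [sq, mul_div_right_comm]
    exact mul_le_mul_of_nonneg_right hynorm (euclNorm_nonneg _)
  have hmain : ∀ q ∈ S, (z' - q) ⬝ᵥ (Λ *ᵥ (z' - q)) ≤ (z - q) ⬝ᵥ (Λ *ᵥ (z - q))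
      - 2 * η * (g ⬝ᵥ (z - q)) + η ^ 2 * (euclNorm g ^ 2 / lam) := by
    intro q hq
    have hB := dotProduct_projection_nonneg hS hsym hz' hq hmin
    have hpsd := hΛ (z' - (z - η • y))
    have hpsd0 : 0 ≤ lam * euclNorm (z' - (z - η • y)) ^ 2 := by positivity
    have e1 : (z - η • y) - q = (z' - q) - (z' - (z - η • y)) := by abel
    have e2 : ((z - η • y) - q) ⬝ᵥ (Λ *ᵥ ((z - η • y) - q)) = (z' - q) ⬝ᵥ (Λ *ᵥ (z' - q))
        - 2 * ((z' - q) ⬝ᵥ (Λ *ᵥ (z' - (z - η • y))))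
        + (z' - (z - η • y)) ⬝ᵥ (Λ *ᵥ (z' - (z - η • y))) := by
      rw [e1]
      simp only [Matrix.mulVec_sub (A := Λ) (x := z' - q), dotProduct_sub, sub_dotProduct (z' - q)]
      rw [hswap (z' - (z - η • y)) (z' - q)]
      ring
    have e3 : (q - z') ⬝ᵥ (Λ *ᵥ (z' - (z - η • y)))
        = -((z' - q) ⬝ᵥ (Λ *ᵥ (z' - (z - η • y)))) := by
      rw [← neg_dotProduct, neg_sub]
    have e4 : ((z - η • y) - q) ⬝ᵥ (Λ *ᵥ ((z - η • y) - q)) = (z - q) ⬝ᵥ (Λ *ᵥ (z - q))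
        - 2 * η * (g ⬝ᵥ (z - q)) + η ^ 2 * (y ⬝ᵥ g) := by
      have : (z - η • y) - q = (z - q) - η • y := by abel
      rw [this]
      generalize z - q = r
      simp only [Matrix.mulVec_sub, Matrix.mulVec_smul, hsol,
        dotProduct_sub, sub_dotProduct, smul_dotProduct, dotProduct_smul, smul_eq_mul]
      rw [hswap y r, hsol, dotProduct_comm r g]
      ring
    nlinarith [mul_le_mul_of_nonneg_left hyg (sq_nonneg η)]
  refine ⟨hmain, ?_⟩
  -- Taking the comparator to be the current iterate kills the linear term and leaves a bound on the
  -- length of the step.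
  have h1 := hmain z hz
  rw [sub_self, zero_dotProduct, dotProduct_zero] at h1
  have h2 := (hΛ (z' - z)).trans h1
  have h3 : (lam * euclNorm (z' - z)) ^ 2 ≤ (η * euclNorm g) ^ 2 := by
    have : lam * (lam * euclNorm (z' - z) ^ 2)
        ≤ lam * (0 - 2 * η * 0 + η ^ 2 * (euclNorm g ^ 2 / lam)) :=
      mul_le_mul_of_nonneg_left h2 hlam.le
    have e : lam * (0 - 2 * η * 0 + η ^ 2 * (euclNorm g ^ 2 / lam)) = (η * euclNorm g) ^ 2 := by
      field_simp; ring
    rw [e] at this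
    nlinarith
  have h4 := (abs_le_of_sq_le_sq' h3 (mul_nonneg hη (euclNorm_nonneg _))).2
  rw [← mul_div_assoc, le_div_iff₀ hlam]
  linarith

end Online

/-! ### The preconditioner as a potential. -/

section Preconditioner

variable {dy du m : ℕ} {lam : ℝ} {N : ℕ}
  {H : ℕ → Matrix (Fin dy ⊕ Fin du) (Fin m × Fin du × Fin dy) ℝ}

theorem preconditioner_transpose (t : ℕ) :
    (preconditioner lam N H t)ᵀ = preconditioner lam N H t := by
  simp [preconditioner, Matrix.transpose_sum]

theorem preconditioner_quadratic (t : ℕ) (x : Fin m × Fin du × Fin dy → ℝ) :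
    x ⬝ᵥ (preconditioner lam N H t *ᵥ x)
      = lam * euclNorm x ^ 2 + ∑ s ∈ Finset.Ico N (t + 1), euclNorm (H s *ᵥ x) ^ 2 := by
  have e : Finset.Icc N t = Finset.Ico N (t + 1) := by ext; simp
  rw [preconditioner, e, Matrix.add_mulVec, dotProduct_add, Matrix.smul_mulVec, Matrix.one_mulVec,
    dotProduct_smul, ← euclNorm_sq_eq_dotProduct, Matrix.sum_mulVec, dotProduct_sum, smul_eq_mul]
  congr 1
  refine Finset.sum_congr rfl fun s _ => ?_
  rw [← Matrix.mulVec_mulVec, Matrix.dotProduct_mulVec, Matrix.vecMul_transpose,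
    euclNorm_sq_eq_dotProduct]

theorem preconditioner_coercive (t : ℕ) (x : Fin m × Fin du × Fin dy → ℝ) :
    lam * euclNorm x ^ 2 ≤ x ⬝ᵥ (preconditioner lam N H t *ᵥ x) := by
  rw [preconditioner_quadratic]
  have : 0 ≤ ∑ s ∈ Finset.Ico N (t + 1), euclNorm (H s *ᵥ x) ^ 2 :=
    Finset.sum_nonneg fun _ _ => sq_nonneg _
  linarith

theorem convex_drcSet (m dy du : ℕ) (R : ℝ) : Convex ℝ (drcSet m dy du R) := by
  intro z hz w hw a b ha hb hab
  simp only [drcSet, Set.mem_ofPred_eq] at hz hw ⊢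
  have h : ∀ i, opNorm (drcBlock (a • z + b • w) i)
      ≤ a * opNorm (drcBlock z i) + b * opNorm (drcBlock w i) := by
    intro i
    have e : drcBlock (a • z + b • w) i = a • drcBlock z i + b • drcBlock w i := by
      ext; simp [drcBlock]
    rw [e]
    refine (opNorm_add_le _ _).trans ?_
    rw [opNorm_smul, opNorm_smul, abs_of_nonneg ha, abs_of_nonneg hb]
  refine (Finset.sum_le_sum fun i _ => h i).trans ?_
  rw [Finset.sum_add_distrib, ← Finset.mul_sum, ← Finset.mul_sum]
  calc _ ≤ a * R + b * R := by gcongr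
    _ = R := by rw [← add_mul, hab, one_mul]

/-- Regret of the linearized losses, up to the growth of the preconditioner. -/
theorem sum_dotProduct_le {S : Set (DrcVec m dy du)} (hS : Convex ℝ S) {η : ℝ} (hη : 0 < η)
    (hlam : 0 < lam) {f : ℕ → Signal dy du → ℝ} {v : ℕ → Fin dy ⊕ Fin du → ℝ}
    {z : ℕ → DrcVec m dy du} {g : ℕ → DrcVec m dy du} (hz0 : z N ∈ S)
    (hstep : ∀ t, N ≤ t →
      IsSemiONSStep S η (f t) (v t) (H t) (preconditioner lam N H t) (z t) (z (t + 1)))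
    (hg : ∀ t, g t = (H t)ᵀ *ᵥ (gradient (f t) (WithLp.toLp 2 (v t + H t *ᵥ z t))).ofLp)
    {q : DrcVec m dy du} (hq : q ∈ S) {T : ℕ} (hT : N ≤ T) :
    ∑ t ∈ Finset.Ico N T, g t ⬝ᵥ (z t - q)
      ≤ η / 2 * (∑ t ∈ Finset.Ico N T, euclNorm (g t) ^ 2 / lam)
        + 1 / (2 * η) * (lam * euclNorm (z N - q) ^ 2
          + ∑ t ∈ Finset.Ico N T, euclNorm (H t *ᵥ (z t - q)) ^ 2) := by
  have hmem : ∀ t, N ≤ t → z t ∈ S := by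
    intro t ht
    induction t, ht using Nat.le_induction with
    | base => exact hz0
    | succ t ht _ => exact (hstep t ht).1
  -- The potential before round `T` uses only the matrices `H s` with `s < T`, while the step of
  -- round `T` contracts in the norm that includes `H T`. Changing norm adds `|H T (z T - q)| ^ 2`,
  -- which is the middle sum.
  have key : ∀ T, N ≤ T → lam * euclNorm (z T - q) ^ 2
      + ∑ s ∈ Finset.Ico N T, euclNorm (H s *ᵥ (z T - q)) ^ 2
      ≤ lam * euclNorm (z N - q) ^ 2 + ∑ t ∈ Finset.Ico N T, (euclNorm (H t *ᵥ (z t - q)) ^ 2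
        - 2 * η * (g t ⬝ᵥ (z t - q)) + η ^ 2 * (euclNorm (g t) ^ 2 / lam)) := by
    intro T hT
    induction T, hT using Nat.le_induction with
    | base => simp
    | succ T hT ih =>
      have h1 := (IsSemiONSStep.bounds hS hη.le hlam (preconditioner_transpose T)
        (preconditioner_coercive T) (hmem T hT) (hstep T hT) (hg T)).1 q hq
      rw [preconditioner_quadratic, preconditioner_quadratic,
        Finset.sum_Ico_succ_top hT (f := fun s => euclNorm (H s *ᵥ (z T - q)) ^ 2)] at h1
      rw [Finset.sum_Ico_succ_top hT (f := fun t => (euclNorm (H t *ᵥ (z t - q)) ^ 2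
        - 2 * η * (g t ⬝ᵥ (z t - q)) + η ^ 2 * (euclNorm (g t) ^ 2 / lam)))]
      linarith
  have h := key T hT
  have h0 : 0 ≤ lam * euclNorm (z T - q) ^ 2
      + ∑ s ∈ Finset.Ico N T, euclNorm (H s *ᵥ (z T - q)) ^ 2 :=
    add_nonneg (by positivity) (Finset.sum_nonneg fun _ _ => sq_nonneg _)
  rw [Finset.sum_add_distrib, Finset.sum_sub_distrib, ← Finset.mul_sum, ← Finset.mul_sum] at h
  set A := ∑ t ∈ Finset.Ico N T, g t ⬝ᵥ (z t - q)
  set B := ∑ t ∈ Finset.Ico N T, euclNorm (g t) ^ 2 / lam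
  set C := ∑ t ∈ Finset.Ico N T, euclNorm (H t *ᵥ (z t - q)) ^ 2
  have h2 : 2 * η * A ≤ 2 * η * (η / 2 * B
      + 1 / (2 * η) * (lam * euclNorm (z N - q) ^ 2 + C)) := by
    have e : 2 * η * (η / 2 * B + 1 / (2 * η) * (lam * euclNorm (z N - q) ^ 2 + C))
        = η ^ 2 * B + (lam * euclNorm (z N - q) ^ 2 + C) := by field_simp
    rw [e]; linarith
  exact le_of_mul_le_mul_left h2 (by positivity)

end Preconditioner

/-! ### Signals during the control phase -/

/-- The signal need be bounded only where the kernel is nonzero: this serves kernels of finite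
memory and recursions in which the current input is not yet bounded. -/
theorem euclNorm_conv_le_of_forall {ι κ : Type*} [Fintype ι] [Fintype κ] [DecidableEq ι]
    (M : ℕ → Matrix κ ι ℝ) (u : ℕ → ι → ℝ) {T t : ℕ} (ht : t < T) {U : ℝ} (hU0 : 0 ≤ U)
    (hU : ∀ i ≤ t, M i = 0 ∨ euclNorm (u (t - i)) ≤ U) :
    euclNorm (conv M u t) ≤ (∑ i ∈ Finset.range T, opNorm (M i)) * U := by
  refine (euclNorm_sum_le _).trans ?_
  calc _ ≤ ∑ i ∈ Finset.range (t + 1), opNorm (M i) * U := by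
        refine Finset.sum_le_sum fun i hi => ?_
        rcases hU i (Nat.lt_succ_iff.1 (Finset.mem_range.1 hi)) with h | h
        · simp [h, opNorm_zero]
        · exact (euclNorm_mulVec_le _ _).trans (mul_le_mul_of_nonneg_left h (opNorm_nonneg _))
    _ = (∑ i ∈ Finset.range (t + 1), opNorm (M i)) * U := by rw [Finset.sum_mul]
    _ ≤ _ := by
        refine mul_le_mul_of_nonneg_right ?_ hU0
        exact Finset.sum_le_sum_of_subset_of_nonneg (by simpa using Nat.succ_le_of_lt ht)
          fun i _ _ => opNorm_nonneg _

/-! ### Passing between outputs, inputs and joint signals. -/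

section Lift

variable {dy du : ℕ} (K : Matrix (Fin du) (Fin dy) ℝ)

theorem conv_lift (G : ℕ → Matrix (Fin dy) (Fin du) ℝ) (u : ℕ → Fin du → ℝ) (t : ℕ) :
    conv (fun i => feedbackLift K * G i + if i = 0 then inputLift dy du else 0) u t
      = feedbackLift K *ᵥ conv G u t + inputLift dy du *ᵥ u t := by
  rw [mulVec_conv]
  have e : (fun i => feedbackLift K * G i + if i = 0 then inputLift dy du else 0)
      = (fun i => feedbackLift K * G i) + fun i => if i = 0 then inputLift dy du else 0 := rfl
  rw [e, add_conv, Pi.add_apply]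
  congr 1
  rw [conv, Finset.sum_range_succ', Finset.sum_eq_zero]
  · simp
  · intro i _; simp

theorem euclNorm_elim_sq (y : Fin dy → ℝ) (u : Fin du → ℝ) :
    euclNorm (Sum.elim y u) ^ 2 = euclNorm y ^ 2 + euclNorm u ^ 2 := by
  simp [euclNorm_sq]

theorem euclNorm_le_elim_left (y : Fin dy → ℝ) (u : Fin du → ℝ) :
    euclNorm y ≤ euclNorm (Sum.elim y u) := by
  refine le_of_sq_le_sq ?_ (euclNorm_nonneg _)
  rw [euclNorm_elim_sq]
  linarith [sq_nonneg (euclNorm u)]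

theorem euclNorm_le_elim_right (y : Fin dy → ℝ) (u : Fin du → ℝ) :
    euclNorm u ≤ euclNorm (Sum.elim y u) := by
  refine le_of_sq_le_sq ?_ (euclNorm_nonneg _)
  rw [euclNorm_elim_sq]
  linarith [sq_nonneg (euclNorm y)]

theorem euclNorm_le_feedbackLift (y : Fin dy → ℝ) : euclNorm y ≤ euclNorm (feedbackLift K *ᵥ y) := by
  rw [feedbackLift_mulVec]
  exact euclNorm_le_elim_left _ _

theorem opNorm_feedbackLift_le : opNorm (feedbackLift K) ≤ 1 + opNorm K := by
  refine opNorm_le_of_forall _ (by linarith [opNorm_nonneg K]) fun y => ?_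
  rw [feedbackLift_mulVec]
  have h0 := euclNorm_nonneg y
  have h1 := opNorm_nonneg K
  refine le_of_sq_le_sq ?_ (by positivity)
  rw [euclNorm_elim_sq]
  have h2 := pow_le_pow_left₀ (euclNorm_nonneg _) (euclNorm_mulVec_le K y) 2
  nlinarith [mul_nonneg h1 (mul_nonneg h0 h0)]

/-- The exogenous input can be read off the joint signal. -/
theorem euclNorm_input_le (y : Fin dy → ℝ) (u : Fin du → ℝ) :
    euclNorm u ≤ (1 + opNorm K) * euclNorm (feedbackLift K *ᵥ y + inputLift dy du *ᵥ u) := by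
  have e : feedbackLift K *ᵥ y + inputLift dy du *ᵥ u = Sum.elim y (K *ᵥ y + u) := by
    rw [feedbackLift_mulVec, inputLift_mulVec]
    funext i; rcases i with i | i <;> simp
  rw [e]
  have h1 := euclNorm_le_elim_left y (K *ᵥ y + u)
  have h2 := euclNorm_le_elim_right y (K *ᵥ y + u)
  have h3 := euclNorm_sub_le (K *ᵥ y + u) (K *ᵥ y)
  rw [add_sub_cancel_left] at h3
  have h4 := euclNorm_mulVec_le K y
  have h5 := mul_le_mul_of_nonneg_left h1 (opNorm_nonneg K)
  linarith

end Lift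

/-! ### Parameter vectors as convolution kernels. -/

section Drc

variable {dy du m : ℕ}

/-- The kernel encoded by a parameter vector. -/
def drcKernel (z : DrcVec m dy du) (i : ℕ) : Matrix (Fin du) (Fin dy) ℝ :=
  if hi : i < m then drcBlock z ⟨i, hi⟩ else 0

/-- The parameter vector encoding the first `m` blocks of a kernel. -/
def drcVecOf (m : ℕ) (M : ℕ → Matrix (Fin du) (Fin dy) ℝ) : DrcVec m dy du :=
  fun p => M p.1 p.2.1 p.2.2

theorem drcKernel_drcVecOf {M : ℕ → Matrix (Fin du) (Fin dy) ℝ} (hM : ∀ i, m ≤ i → M i = 0) :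
    drcKernel (drcVecOf m M) = M := by
  funext i
  unfold drcKernel
  split_ifs with hi
  · rfl
  · exact (hM i (not_lt.1 hi)).symm

theorem sum_drcKernel (z : DrcVec m dy du) (f : Matrix (Fin du) (Fin dy) ℝ → ℝ) :
    ∑ i ∈ Finset.range m, f (drcKernel z i) = ∑ i, f (drcBlock z i) := by
  rw [Finset.sum_range]
  exact Finset.sum_congr rfl fun i _ => by simp [drcKernel]

theorem sum_opNorm_drcKernel_le (z : DrcVec m dy du) (T : ℕ) :
    ∑ i ∈ Finset.range T, opNorm (drcKernel z i) ≤ ∑ i, opNorm (drcBlock z i) := by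
  rw [← sum_drcKernel z opNorm, ← Finset.sum_subset (Finset.inter_subset_left :
    Finset.range T ∩ Finset.range m ⊆ Finset.range T)]
  · exact Finset.sum_le_sum_of_subset_of_nonneg Finset.inter_subset_right
      fun i _ _ => opNorm_nonneg _
  · intro i hi hi'
    have : ¬ i < m := fun hc => hi' (Finset.mem_inter.2 ⟨hi, Finset.mem_range.2 hc⟩)
    simp [drcKernel, this, opNorm_zero]

theorem drcEmbed_mulVec (yhat : ℕ → Fin dy → ℝ) (t : ℕ) (z : DrcVec m dy du) :
    drcEmbed m yhat t *ᵥ z = conv (drcKernel z) yhat t := by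
  have e1 : drcEmbed m yhat t *ᵥ z
      = ∑ i : Fin m, if (i : ℕ) ≤ t then drcBlock z i *ᵥ yhat (t - i) else 0 := by
    funext a
    simp only [Matrix.mulVec, dotProduct, drcEmbed, Finset.sum_apply, Fintype.sum_prod_type]
    refine Finset.sum_congr rfl fun i _ => ?_
    by_cases hi : (i : ℕ) ≤ t
    · simp only [hi, and_true, if_true, ite_mul, zero_mul]
      rw [Finset.sum_comm]
      simp only [Finset.sum_ite_eq, Finset.mem_univ, if_true]
      exact Finset.sum_congr rfl fun b _ => by rw [mul_comm]; rfl
    · simp [hi]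
  rw [e1, conv]
  have e2 : ∀ i : Fin m, (if (i : ℕ) ≤ t then drcBlock z i *ᵥ yhat (t - i) else 0)
      = if (i : ℕ) ≤ t then drcKernel z i *ᵥ yhat (t - i) else 0 := by
    intro i; simp [drcKernel]
  rw [Finset.sum_congr rfl fun i _ => e2 i, ← Finset.sum_range
    (f := fun i => if i ≤ t then drcKernel z i *ᵥ yhat (t - i) else 0), ← Finset.sum_filter]
  have hsub : Finset.filter (fun i => i ≤ t) (Finset.range m) ⊆ Finset.range (t + 1) := by
    intro i; simp
  refine Finset.sum_subset hsub fun i hi hi' => ?_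
  have : ¬ i < m := fun hc => hi' (by simp at hi ⊢; omega)
  simp [drcKernel, this]

theorem euclNorm_drcVec_sq (z : DrcVec m dy du) :
    euclNorm z ^ 2 = ∑ i, ∑ a, ∑ b, drcBlock z i a b ^ 2 := by
  rw [euclNorm_sq]
  simp only [Fintype.sum_prod_type]
  rfl

theorem euclNorm_drcEmbed_le {yhat : ℕ → Fin dy → ℝ} {t : ℕ} {R Y : ℝ} {z : DrcVec m dy du}
    (hz : z ∈ drcSet m dy du R) (hY : ∀ s ≤ t, euclNorm (yhat s) ≤ Y) :
    euclNorm (drcEmbed m yhat t *ᵥ z) ≤ R * Y := by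
  rw [drcEmbed_mulVec]
  refine (euclNorm_conv_le _ _ (Nat.lt_succ_self t) hY).trans ?_
  refine mul_le_mul_of_nonneg_right ((sum_opNorm_drcKernel_le z _).trans hz) ?_
  exact (euclNorm_nonneg _).trans (hY t le_rfl)

theorem sum_opNorm_drcBlock_le (z : DrcVec m dy du) :
    ∑ i, opNorm (drcBlock z i) ≤ √m * euclNorm z := by
  refine le_of_sq_le_sq ?_ (mul_nonneg (Real.sqrt_nonneg _) (euclNorm_nonneg _))
  refine (sq_sum_le_card_mul_sum_sq).trans ?_
  rw [mul_pow, Real.sq_sqrt (Nat.cast_nonneg _), euclNorm_drcVec_sq]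
  simp only [Finset.card_univ, Fintype.card_fin]
  exact mul_le_mul_of_nonneg_left (Finset.sum_le_sum fun i _ => opNorm_sq_le_sum _)
    (Nat.cast_nonneg _)

theorem euclNorm_drcEmbed_le_sqrt {yhat : ℕ → Fin dy → ℝ} {t : ℕ} {Y : ℝ} (z : DrcVec m dy du)
    (hY : ∀ s ≤ t, euclNorm (yhat s) ≤ Y) :
    euclNorm (drcEmbed m yhat t *ᵥ z) ≤ √m * Y * euclNorm z := by
  refine (euclNorm_drcEmbed_le (R := √m * euclNorm z) (sum_opNorm_drcBlock_le z) hY).trans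
    (le_of_eq (by ring))

/-- The factor `dy` is the price of passing from operator to Frobenius norms; it is independent of
`m` because the `ℓ¹` norm of the blocks dominates their `ℓ²` norm. -/
theorem euclNorm_sq_le_of_mem_drcSet {R : ℝ} {z : DrcVec m dy du} (hz : z ∈ drcSet m dy du R) :
    euclNorm z ^ 2 ≤ dy * R ^ 2 := by
  have hz' : ∑ i, opNorm (drcBlock z i) ≤ R := hz
  have h0 : 0 ≤ ∑ i, opNorm (drcBlock z i) := Finset.sum_nonneg fun _ _ => opNorm_nonneg _
  rw [euclNorm_drcVec_sq]
  have h1 : ∑ i, ∑ a, ∑ b, drcBlock z i a b ^ 2 ≤ ∑ i, (dy : ℝ) * opNorm (drcBlock z i) ^ 2 :=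
    Finset.sum_le_sum fun i _ => by simpa using sum_sq_le_card_mul_opNorm_sq (drcBlock z i)
  refine h1.trans ?_
  rw [← Finset.mul_sum]
  refine mul_le_mul_of_nonneg_left ?_ (Nat.cast_nonneg _)
  refine (Finset.sum_sq_le_sq_sum_of_nonneg fun i _ => opNorm_nonneg _).trans ?_
  exact pow_le_pow_left₀ h0 hz' 2

end Drc

/-! ### Estimated nature's signals and the predictions built on them. -/

section Run

variable {dx dy du : ℕ} {E : Environment dx dy du} {K : Matrix (Fin du) (Fin dy) ℝ} {h m : ℕ}
  {uex : ℕ → Fin du → ℝ} {Gv : ℕ → Matrix (Fin dy ⊕ Fin du) (Fin du) ℝ}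
  {Gη : ℕ → Matrix (Fin dy) (Fin du) ℝ}

theorem estResidual_output_eq (t : ℕ) :
    estResidual Gη (E.output K uex) uex t = E.output K (fun _ => 0) t
      + conv (fun i => E.outputMarkov K i - Gη i) uex t := by
  have e : (fun i => E.outputMarkov K i - Gη i) = E.outputMarkov K - Gη := rfl
  rw [e, sub_conv, estResidual, E.output_eq, Pi.sub_apply]
  simp only [conv]
  abel

/-- Because the two estimates are compatible, the estimated nature's signal keeps the form `(y, K
y)`, so bounds on one residual serve for both. -/
theorem estResidual_signal_eq
    (hGv : Gv = fun i => feedbackLift K * Gη i + if i = 0 then inputLift dy du else 0) (t : ℕ) :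
    estResidual Gv (fun s => (E.signal K uex s).ofLp) uex t
      = feedbackLift K *ᵥ estResidual Gη (E.output K uex) uex t := by
  have e1 : estResidual Gv (fun s => (E.signal K uex s).ofLp) uex t
      = (E.signal K uex t).ofLp - conv Gv uex t := rfl
  have e2 : estResidual Gη (E.output K uex) uex t = E.output K uex t - conv Gη uex t := rfl
  rw [e1, e2, E.signal_ofLp, hGv, conv_lift, Matrix.mulVec_sub]
  abel

theorem memoryMatrix_mulVec (hGv : ∀ i, h < i → Gv i = 0) (yhat : ℕ → Fin dy → ℝ) (t : ℕ)
    (z : DrcVec m dy du) :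
    memoryMatrix h m Gv yhat t *ᵥ z = conv Gv (fun s => drcEmbed m yhat s *ᵥ z) t := by
  rw [memoryMatrix, Matrix.sum_mulVec, conv]
  have e : ∀ i, (if i ≤ t then Gv i * drcEmbed m yhat (t - i) else 0) *ᵥ z
      = if i ≤ t then Gv i *ᵥ (drcEmbed m yhat (t - i) *ᵥ z) else 0 := by
    intro i
    split_ifs
    · exact (Matrix.mulVec_mulVec _ _ _).symm
    · exact Matrix.zero_mulVec _
  rw [Finset.sum_congr rfl fun i _ => e i, ← Finset.sum_filter]
  have hsub : Finset.filter (fun i => i ≤ t) (Finset.range (h + 1)) ⊆ Finset.range (t + 1) := by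
    intro i; simp
  refine Finset.sum_subset hsub fun i hi hi' => ?_
  have : h < i := by
    by_contra hc
    exact hi' (by simp at hi ⊢; omega)
  simp [hGv i this]

/-- The prediction `H_t z` is itself a joint signal driven by the inputs `Y_s z`, and its current
input is recovered as `u - K y`. Hence curvature along `H_t` controls the input itself, at the cost
of a factor `1 + ‖K‖`. -/
theorem euclNorm_drcEmbed_le_memoryMatrix
    (hGv : Gv = fun i => feedbackLift K * Gη i + if i = 0 then inputLift dy du else 0)
    (hGv0 : ∀ i, h < i → Gv i = 0) (yhat : ℕ → Fin dy → ℝ) (t : ℕ) (z : DrcVec m dy du) :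
    euclNorm (drcEmbed m yhat t *ᵥ z)
      ≤ (1 + opNorm K) * euclNorm (memoryMatrix h m Gv yhat t *ᵥ z) := by
  rw [memoryMatrix_mulVec hGv0, hGv, conv_lift]
  exact euclNorm_input_le K _ _

/-- Boundedness of the estimated nature's outputs and of the control inputs. -/
theorem control_phase_bounds {N T : ℕ} {z : ℕ → DrcVec m dy du} {R Rn b ε : ℝ}
    (hGη0 : Gη 0 = 0) (hz : ∀ t, N ≤ t → z t ∈ drcSet m dy du R)
    (hctrl : ∀ t, N ≤ t → uex t = drcEmbed m (estResidual Gη (E.output K uex) uex) t *ᵥ z t)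
    (hε : ∑ i ∈ Finset.range T, opNorm (feedbackLift K * (E.outputMarkov K i - Gη i)) ≤ ε)
    (hnat : ∀ t, euclNorm (feedbackLift K *ᵥ E.output K (fun _ => 0) t) ≤ Rn)
    (hb : ∀ t < N, t < T → euclNorm (uex t) ≤ b) (hRn : 0 ≤ Rn) (hb0 : 0 ≤ b)
    (hRε : 2 * R * ε ≤ 1) (hεb : ε * b ≤ Rn) :
    ∀ t < T, euclNorm (feedbackLift K *ᵥ estResidual Gη (E.output K uex) uex t) ≤ 2 * Rn ∧
      (N ≤ t → euclNorm (uex t) ≤ R * (2 * Rn)) := by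
  intro t
  induction t using Nat.strong_induction_on with
  | _ t ih =>
    intro ht
    have hε0 : 0 ≤ ε := (Finset.sum_nonneg fun _ _ => opNorm_nonneg _).trans hε
    set U := max b (R * (2 * Rn)) with hU
    have hU0 : 0 ≤ U := le_max_of_le_left hb0
    have hu : ∀ s < t, euclNorm (uex s) ≤ U := by
      intro s hs
      rcases lt_or_ge s N with hsN | hsN
      · exact (hb s hsN (hs.trans ht)).trans (le_max_left _ _)
      · exact ((ih s hs (hs.trans ht)).2 hsN).trans (le_max_right _ _)
    have hεU : ε * U ≤ Rn := by
      rw [hU, mul_max_of_nonneg _ _ hε0]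
      refine max_le hεb ?_
      have := mul_le_mul_of_nonneg_right hRε hRn
      nlinarith
    have h1 : euclNorm (feedbackLift K *ᵥ estResidual Gη (E.output K uex) uex t) ≤ 2 * Rn := by
      rw [estResidual_output_eq, Matrix.mulVec_add, mulVec_conv]
      refine (euclNorm_add_le _ _).trans ?_
      have h2 := euclNorm_conv_le_of_forall
        (fun i => feedbackLift K * (E.outputMarkov K i - Gη i)) uex ht hU0 (fun i hi => by
          rcases Nat.eq_zero_or_pos i with h0 | h0
          -- The estimation error vanishes at lag zero, so the residual at time `t` depends only on
          -- earlier inputs; this is what makes the induction close.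
          · left; subst h0; simp [Environment.outputMarkov, hGη0]
          · right; exact hu _ (by omega))
      have h3 := mul_le_mul_of_nonneg_right hε hU0
      linarith [hnat t]
    refine ⟨h1, fun hN => ?_⟩
    rw [hctrl t hN]
    refine euclNorm_drcEmbed_le (hz t hN) fun s hs => (euclNorm_le_feedbackLift K _).trans ?_
    rcases hs.lt_or_eq with hs | hs
    · exact (ih s hs (hs.trans ht)).1
    · rw [hs]; exact h1

end Run

/-! ### The comparator -/

section Kernel

variable {ι κ μ : Type*} [Fintype ι] [Fintype κ] [Fintype μ]

/-- Truncation of a kernel to the lags below `n`. -/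
def truncKernel (n : ℕ) (M : ℕ → Matrix κ ι ℝ) (i : ℕ) : Matrix κ ι ℝ := if i < n then M i else 0

theorem truncKernel_eq_zero {n i : ℕ} (hi : n ≤ i) (M : ℕ → Matrix κ ι ℝ) :
    truncKernel n M i = 0 := if_neg (not_lt.2 hi)

theorem kernelMul_eq_zero {p q : ℕ} {M : ℕ → Matrix κ ι ℝ} {N : ℕ → Matrix ι μ ℝ}
    (hM : ∀ i, p ≤ i → M i = 0) (hN : ∀ i, q ≤ i → N i = 0) {i : ℕ} (hi : p + q ≤ i + 1) :
    kernelMul M N i = 0 := by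
  refine Finset.sum_eq_zero fun x hx => ?_
  rw [Finset.HasAntidiagonal.mem_antidiagonal] at hx
  rcases le_or_gt p x.1 with h | h
  · rw [hM _ h, Matrix.zero_mul]
  · rw [hN x.2 (by omega), Matrix.mul_zero]

theorem truncKernel_mul (n : ℕ) (M : ℕ → Matrix κ ι ℝ) (Q : Matrix ι μ ℝ) (i : ℕ) :
    truncKernel n (fun i => M i * Q) i = truncKernel n M i * Q := by
  unfold truncKernel; split_ifs <;> simp

theorem mul_truncKernel (n : ℕ) (Q : Matrix κ ι ℝ) (M : ℕ → Matrix ι μ ℝ) (i : ℕ) :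
    truncKernel n (fun i => Q * M i) i = Q * truncKernel n M i := by
  unfold truncKernel; split_ifs <;> simp

theorem kernelMul_assoc_const (M : ℕ → Matrix κ ι ℝ) (Q : Matrix ι μ ℝ) {σ : Type*} [Fintype σ]
    (N : ℕ → Matrix μ σ ℝ) :
    kernelMul (fun i => M i * Q) N = kernelMul M (fun i => Q * N i) := by
  funext t
  exact Finset.sum_congr rfl fun p _ => by rw [Matrix.mul_assoc]

theorem mul_kernelMul (Q : Matrix κ ι ℝ) (M : ℕ → Matrix ι μ ℝ) {σ : Type*} [Fintype σ]
    (N : ℕ → Matrix μ σ ℝ) :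
    (fun t => Q * kernelMul M N t) = kernelMul (fun i => Q * M i) N := by
  funext t
  simp only [kernelMul, Matrix.mul_sum, Matrix.mul_assoc]

variable [DecidableEq ι] [DecidableEq μ]

theorem opNorm_truncKernel_le (n : ℕ) (M : ℕ → Matrix κ ι ℝ) (i : ℕ) :
    opNorm (truncKernel n M i) ≤ opNorm (M i) := by
  unfold truncKernel
  split_ifs
  · exact le_rfl
  · rw [opNorm_zero]; exact opNorm_nonneg _

theorem sum_opNorm_truncKernel_le {M : ℕ → Matrix κ ι ℝ} {c : ℝ} (n T : ℕ)
    (hM : ∑ i ∈ Finset.range T, opNorm (M i) ≤ c) :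
    ∑ i ∈ Finset.range T, opNorm (truncKernel n M i) ≤ c :=
  (Finset.sum_le_sum fun i _ => opNorm_truncKernel_le n M i).trans hM

theorem euclNorm_conv_le_of_sum_le (M : ℕ → Matrix κ ι ℝ) (u : ℕ → ι → ℝ) {T t : ℕ} (ht : t < T)
    {U c : ℝ} (hc : ∑ i ∈ Finset.range T, opNorm (M i) ≤ c)
    (hU : ∀ s < T, euclNorm (u s) ≤ U) : euclNorm (conv M u t) ≤ c * U := by
  refine (euclNorm_conv_le M u ht fun s hs => hU s (by omega)).trans ?_
  exact mul_le_mul_of_nonneg_right hc ((euclNorm_nonneg _).trans (hU t ht))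

end Kernel

/-! ### The second-order comparator and its deviation from the policy. -/

section Comparator

variable {dx dy du : ℕ} {E : Environment dx dy du} {K : Matrix (Fin du) (Fin dy) ℝ} {h : ℕ}
  {uex : ℕ → Fin du → ℝ} {Gv : ℕ → Matrix (Fin dy ⊕ Fin du) (Fin du) ℝ}
  {Gη : ℕ → Matrix (Fin dy) (Fin du) ℝ}

/-- The DRC kernel that imitates `π` to second order in the estimation error. -/
def comparatorKernel (E : Environment dx dy du) (K : Matrix (Fin du) (Fin dy) ℝ) (h : ℕ)
    (Gη : ℕ → Matrix (Fin dy) (Fin du) ℝ) (π : LDC dy du) : ℕ → Matrix (Fin du) (Fin dy) ℝ :=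
  let M := truncKernel h fun i => π.exKernel E K i * feedbackLift K
  let D := truncKernel (h + 1) fun i => E.outputMarkov K i - Gη i
  M - kernelMul M (kernelMul D M)

/-- The factors have lengths `h`, `h + 1` and `h`, and each product of kernels loses one lag, so the
triple product is supported below `3 * h`. This is the reason for `m = 3 h`. -/
theorem comparatorKernel_eq_zero (hh : 0 < h) (π : LDC dy du) {i : ℕ} (hi : 3 * h ≤ i) :
    comparatorKernel E K h Gη π i = 0 := by
  simp only [comparatorKernel, Pi.sub_apply]
  rw [truncKernel_eq_zero (by omega), zero_sub, neg_eq_zero]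
  refine kernelMul_eq_zero (p := h) (q := 2 * h) (fun i hi => truncKernel_eq_zero hi _)
    (fun i hi => ?_) (by omega)
  exact kernelMul_eq_zero (p := h + 1) (q := h) (fun i hi => truncKernel_eq_zero hi _)
    (fun i hi => truncKernel_eq_zero hi _) (by omega)

/-- First-order part of the deviation of the comparator from `π`. -/
def firstOrderError (E : Environment dx dy du) (K : Matrix (Fin du) (Fin dy) ℝ) (h : ℕ)
    (Gη : ℕ → Matrix (Fin dy) (Fin du) ℝ) (π : LDC dy du) (e : ℕ → Fin du → ℝ) :
    ℕ → Fin dy ⊕ Fin du → ℝ :=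
  conv (fun i => feedbackLift K * (E.outputMarkov K i - Gη i)) e
    + conv (E.markov K) (conv (truncKernel h (π.exKernel E K))
      (conv (fun i => feedbackLift K * truncKernel (h + 1)
        (fun i => E.outputMarkov K i - Gη i) i) e))

/-- Second-order part of the deviation of the comparator from `π`. -/
def secondOrderError (E : Environment dx dy du) (K : Matrix (Fin du) (Fin dy) ℝ) (h : ℕ)
    (Gη : ℕ → Matrix (Fin dy) (Fin du) ℝ) (π : LDC dy du) (yhat : ℕ → Fin dy → ℝ)
    (uex : ℕ → Fin du → ℝ) : ℕ → Fin dy ⊕ Fin du → ℝ :=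
  let D : ℕ → Matrix (Fin dy) (Fin du) ℝ := fun i => E.outputMarkov K i - Gη i
  let N := truncKernel h (π.exKernel E K)
  let JD := fun i => feedbackLift K * truncKernel (h + 1) D i
  conv (E.markov K) (conv N (conv JD (conv N (conv JD
      (conv (truncKernel h fun i => π.exKernel E K i * feedbackLift K) yhat))))
    - conv N (conv (fun i => feedbackLift K * (D i - truncKernel (h + 1) D i)) uex)
    + conv (π.exKernel E K - N) (fun s => (E.natureSignal K s).ofLp))

/-- In convolution notation the residual is `ŷ = y + D uex`, with `y` nature's output, so up to
truncation `π` plays `M y = M ŷ - M D uex`. The comparator `us = M ŷ - M D M ŷ` replaces the unknown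
`uex` by `M ŷ`, which itself differs from `us` only by a term of order `ε`. -/
theorem comparator_identity
    (hGv : Gv = fun i => feedbackLift K * Gη i + if i = 0 then inputLift dy du else 0)
    (π : LDC dy du) {yhat : ℕ → Fin dy → ℝ}
    (hy : yhat = fun t => estResidual Gη (E.output K uex) uex t) {us : ℕ → Fin du → ℝ}
    (hus : us = conv (comparatorKernel E K h Gη π) yhat) (t : ℕ) :
    (π.signal E t).ofLp = feedbackLift K *ᵥ yhat t + conv Gv us t
      + firstOrderError E K h Gη π (us - uex) t + secondOrderError E K h Gη π yhat uex t := by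
  set D : ℕ → Matrix (Fin dy) (Fin du) ℝ := fun i => E.outputMarkov K i - Gη i with hD
  set Db := truncKernel (h + 1) D with hDb
  set N := truncKernel h (π.exKernel E K) with hN
  set Mb := truncKernel h fun i => π.exKernel E K i * feedbackLift K with hMb
  set yK : ℕ → Fin dy → ℝ := E.output K (fun _ => 0) with hyK
  have hMbN : Mb = fun i => N i * feedbackLift K := funext fun i => truncKernel_mul _ _ _ _
  have convMb : ∀ v : ℕ → Fin dy → ℝ, conv Mb v = conv N (fun s => feedbackLift K *ᵥ v s) := by
    intro v; funext t; rw [conv_mulVec, hMbN]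
  have convJ : ∀ (G : ℕ → Matrix (Fin dy) (Fin du) ℝ) (v : ℕ → Fin du → ℝ),
      (fun s => feedbackLift K *ᵥ conv G v s) = conv (fun i => feedbackLift K * G i) v := by
    intro G v; funext t; rw [mulVec_conv]
  have convMbG : ∀ (G : ℕ → Matrix (Fin dy) (Fin du) ℝ) (v : ℕ → Fin du → ℝ),
      conv Mb (conv G v) = conv N (conv (fun i => feedbackLift K * G i) v) := by
    intro G v; rw [convMb, convJ]
  have hyhat : yhat = yK + conv D uex := by
    rw [hy]; funext t; rw [estResidual_output_eq]; rfl
  have hnat : (fun s => (E.natureSignal K s).ofLp) = fun s => feedbackLift K *ᵥ yK s :=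
    funext fun s => E.natureSignal_ofLp K s
  set w := conv N (conv (fun i => feedbackLift K * Db i) (conv Mb yhat)) with hw
  have hus' : us = conv Mb yhat - w := by
    rw [hus, comparatorKernel, sub_conv, ← conv_conv, ← conv_conv, convMbG]
  set rr : ℕ → Fin du → ℝ :=
    conv (π.exKernel E K - N) (fun s => (E.natureSignal K s).ofLp)
      - conv N (conv (fun i => feedbackLift K * (D i - Db i)) uex) with hrr
  have hsplitD : conv D uex = conv Db uex + conv (D - Db) uex := by
    rw [sub_conv]; abel
  have hupi : π.exInput E K = conv Mb yhat - conv N (conv (fun i => feedbackLift K * Db i) uex)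
      + rr := by
    have e1 : π.exInput E K = conv (π.exKernel E K) (fun s => (E.natureSignal K s).ofLp) :=
      funext fun t => π.exInput_eq E K t
    have e2 : conv N (fun s => (E.natureSignal K s).ofLp) = conv Mb yhat
        - conv N (conv (fun i => feedbackLift K * Db i) uex)
        - conv N (conv (fun i => feedbackLift K * (D i - Db i)) uex) := by
      rw [hnat, ← convMb, hyhat, conv_add, hsplitD, conv_add, convMbG, convMbG]
      simp only [Pi.sub_apply]
      abel
    rw [e1, hrr, sub_conv, e2]
    abel
  -- With `w = M D M ŷ` and `M ŷ = us + w`, the discrepancy `M D (M ŷ - uex)` splits into `M D (us -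
  -- uex)`, of first order, and `M D w`, of second order.
  have hdiff : π.exInput E K - us
      = conv N (conv (fun i => feedbackLift K * Db i) (us - uex))
        + (conv N (conv (fun i => feedbackLift K * Db i) w) + rr) := by
    have : conv Mb yhat = us + w := by rw [hus']; abel
    have hw2 : w = conv N (conv (fun i => feedbackLift K * Db i) us)
        + conv N (conv (fun i => feedbackLift K * Db i) w) := by
      rw [← conv_add, ← conv_add, ← this]
    rw [hupi, this, conv_sub, conv_sub]
    generalize conv N (conv (fun i => feedbackLift K * Db i) us) = p at *
    generalize conv N (conv (fun i => feedbackLift K * Db i) w) = q at *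
    generalize conv N (conv (fun i => feedbackLift K * Db i) uex) = o at *
    have hp : p = w - q := eq_sub_of_add_eq hw2.symm
    rw [hp]
    abel
  have hsig : (π.signal E t).ofLp = feedbackLift K *ᵥ yK t + conv (E.markov K) (π.exInput E K) t := by
    rw [π.signal_eq E K, E.signal_eq_nature_add_conv, E.natureSignal_ofLp]
  -- Predicting with the estimate makes the error `-J D us`, with `J` the feedback lift, while the
  -- residual carries `J D uex`; the two combine into another multiple of `us - uex`.
  have hGvs : conv Gv us t = conv (E.markov K) us t
      - conv (fun i => feedbackLift K * D i) us t := by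
    have : Gv = E.markov K - fun i => feedbackLift K * D i := by
      funext i
      rw [Pi.sub_apply, E.markov_eq, hGv, hD, Matrix.mul_sub]
      abel_nf
    rw [this, sub_conv, Pi.sub_apply]
  have hJy : feedbackLift K *ᵥ yhat t = feedbackLift K *ᵥ yK t
      + conv (fun i => feedbackLift K * D i) uex t := by
    rw [hyhat, Pi.add_apply, Matrix.mulVec_add, mulVec_conv]
  have hsecond : secondOrderError E K h Gη π yhat uex = conv (E.markov K)
      (conv N (conv (fun i => feedbackLift K * Db i) w) + rr) := by
    rw [secondOrderError, hrr]
    simp only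
    congr 1
    abel
  have hupi2 : π.exInput E K = us + (conv N (conv (fun i => feedbackLift K * Db i) (us - uex))
        + (conv N (conv (fun i => feedbackLift K * Db i) w) + rr)) := by
    rw [← hdiff]; abel
  rw [hsig, hsecond, firstOrderError, hupi2, hGvs, hJy, conv_add, conv_add,
    conv_sub (fun i => feedbackLift K * D i)]
  simp only [Pi.add_apply, Pi.sub_apply]
  abel

variable {π : LDC dy du} {n₁ μ ε ε' ν a : ℝ}

/-- The correction `M D M` is small relative to `M`; doubling the radius leaves room for it. -/
theorem comparator_mem_drcSet (hh : 0 < h)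
    (hn₁ : ∀ n, ∑ i ∈ Finset.range n, opNorm (π.exKernel E K i) ≤ n₁)
    (hμ : ∀ n, ∑ i ∈ Finset.range n, opNorm (π.exKernel E K i * feedbackLift K) ≤ μ)
    (hε : ∀ n, ∑ i ∈ Finset.range n, opNorm (feedbackLift K * (E.outputMarkov K i - Gη i)) ≤ ε)
    {R : ℝ} (hR : μ + n₁ * (ε * μ) ≤ R) :
    drcVecOf (3 * h) (comparatorKernel E K h Gη π) ∈ drcSet (3 * h) dy du R := by
  show ∑ i, opNorm (drcBlock _ i) ≤ R
  have hn₁0 : 0 ≤ n₁ := by simpa using hn₁ 0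
  have hμ0 : 0 ≤ μ := by simpa using hμ 0
  have hε0 : 0 ≤ ε := by simpa using hε 0
  rw [← sum_drcKernel, drcKernel_drcVecOf fun i hi => comparatorKernel_eq_zero hh π hi]
  refine le_trans ?_ hR
  simp only [comparatorKernel]
  set D : ℕ → Matrix (Fin dy) (Fin du) ℝ := fun i => E.outputMarkov K i - Gη i
  set N := truncKernel h (π.exKernel E K)
  set Mb := truncKernel h fun i => π.exKernel E K i * feedbackLift K with hMb
  have hMbN : Mb = fun i => N i * feedbackLift K := funext fun i => truncKernel_mul _ _ _ _
  have hMμ : ∀ n, ∑ i ∈ Finset.range n, opNorm (Mb i) ≤ μ := fun n =>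
    sum_opNorm_truncKernel_le h n (hμ n)
  -- The lift is moved from `M` onto `D`, since `ε` measures the lifted error.
  have e : kernelMul Mb (kernelMul (truncKernel (h + 1) D) Mb)
      = kernelMul N (kernelMul (fun i => feedbackLift K * truncKernel (h + 1) D i) Mb) := by
    nth_rewrite 1 [hMbN]
    rw [kernelMul_assoc_const, mul_kernelMul]
  rw [e]
  calc _ ≤ ∑ i ∈ Finset.range (3 * h), (opNorm (Mb i) + opNorm (kernelMul N
        (kernelMul (fun i => feedbackLift K * truncKernel (h + 1) D i) Mb) i)) :=
        Finset.sum_le_sum fun i _ => opNorm_sub_le _ _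
    _ ≤ _ := by
        rw [Finset.sum_add_distrib]
        refine add_le_add (hMμ _) ((sum_opNorm_kernelMul_le _ _ _).trans ?_)
        refine mul_le_mul (sum_opNorm_truncKernel_le h _ (hn₁ _))
          ((sum_opNorm_kernelMul_le _ _ _).trans ?_)
          (Finset.sum_nonneg fun _ _ => opNorm_nonneg _) hn₁0
        refine mul_le_mul ?_ (hMμ _) (Finset.sum_nonneg fun _ _ => opNorm_nonneg _) hε0
        refine le_trans (Finset.sum_le_sum fun i _ => ?_) (hε (3 * h))
        rw [← mul_truncKernel]
        exact opNorm_truncKernel_le _ _ _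

theorem sum_firstOrderError_sq_le (T : ℕ)
    (hn₁ : ∀ n, ∑ i ∈ Finset.range n, opNorm (π.exKernel E K i) ≤ n₁)
    (hε : ∀ n, ∑ i ∈ Finset.range n, opNorm (feedbackLift K * (E.outputMarkov K i - Gη i)) ≤ ε)
    (ha : ∀ n, ∑ i ∈ Finset.range n, opNorm (E.markov K i) ≤ a) (e : ℕ → Fin du → ℝ) :
    ∑ t ∈ Finset.range T, euclNorm (firstOrderError E K h Gη π e t) ^ 2
      ≤ 2 * ε ^ 2 * (1 + (a * n₁) ^ 2) * ∑ s ∈ Finset.range T, euclNorm (e s) ^ 2 := by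
  have hn₁0 : 0 ≤ n₁ := by simpa using hn₁ 0
  have hε0 : 0 ≤ ε := by simpa using hε 0
  have ha0 : 0 ≤ a := by simpa using ha 0
  set S := ∑ s ∈ Finset.range T, euclNorm (e s) ^ 2 with hS
  have hS0 : 0 ≤ S := Finset.sum_nonneg fun _ _ => sq_nonneg _
  have hsq : ∀ {κ' : Type} [Fintype κ'] {ι' : Type} [Fintype ι'] [DecidableEq ι']
      (M : ℕ → Matrix κ' ι' ℝ) (v : ℕ → ι' → ℝ) {c V : ℝ},
      ∑ i ∈ Finset.range T, opNorm (M i) ≤ c → ∑ s ∈ Finset.range T, euclNorm (v s) ^ 2 ≤ V →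
      ∑ t ∈ Finset.range T, euclNorm (conv M v t) ^ 2 ≤ c ^ 2 * V := by
    intro κ' _ ι' _ _ M v c V hc hV
    refine (sum_euclNorm_conv_sq_le M v T).trans ?_
    refine mul_le_mul (pow_le_pow_left₀ (Finset.sum_nonneg fun _ _ => opNorm_nonneg _) hc 2) hV
      (Finset.sum_nonneg fun _ _ => sq_nonneg _) (sq_nonneg _)
  have h1 := hsq (fun i => feedbackLift K * (E.outputMarkov K i - Gη i)) e (hε T) le_rfl
  have h2 := hsq (E.markov K) _ (ha T) (hsq (truncKernel h (π.exKernel E K)) _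
    (sum_opNorm_truncKernel_le h T (hn₁ T))
    (hsq (fun i => feedbackLift K * truncKernel (h + 1)
        (fun i => E.outputMarkov K i - Gη i) i) e
      (le_trans (Finset.sum_le_sum fun i _ => by
        rw [← mul_truncKernel]; exact opNorm_truncKernel_le _ _ _) (hε T)) le_rfl))
  calc _ ≤ ∑ t ∈ Finset.range T, (2 * euclNorm (conv (fun i => feedbackLift K *
          (E.outputMarkov K i - Gη i)) e t) ^ 2
        + 2 * euclNorm (conv (E.markov K) (conv (truncKernel h (π.exKernel E K))
          (conv (fun i => feedbackLift K * truncKernel (h + 1)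
            (fun i => E.outputMarkov K i - Gη i) i) e)) t) ^ 2) := by
        refine Finset.sum_le_sum fun t _ => ?_
        rw [firstOrderError, Pi.add_apply]
        refine (pow_le_pow_left₀ (euclNorm_nonneg _) (euclNorm_add_le _ _) 2).trans ?_
        exact (add_sq_le).trans (le_of_eq (mul_add _ _ _))
    _ ≤ _ := by
        rw [Finset.sum_add_distrib, ← Finset.mul_sum, ← Finset.mul_sum]
        nlinarith

/-- Two factors `ε` from the correction applied twice; the other two terms are the tails of the
Markov operator and of the policy kernel beyond `h`. -/
theorem euclNorm_secondOrderError_le {T t : ℕ} (ht : t < T) {Y U Rn : ℝ}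
    (hn₁ : ∀ n, ∑ i ∈ Finset.range n, opNorm (π.exKernel E K i) ≤ n₁)
    (hμ : ∀ n, ∑ i ∈ Finset.range n, opNorm (π.exKernel E K i * feedbackLift K) ≤ μ)
    (hε : ∀ n, ∑ i ∈ Finset.range n, opNorm (feedbackLift K * (E.outputMarkov K i - Gη i)) ≤ ε)
    (hε' : ∀ n, ∑ i ∈ Finset.range n, opNorm (feedbackLift K * ((E.outputMarkov K i - Gη i)
      - truncKernel (h + 1) (fun i => E.outputMarkov K i - Gη i) i)) ≤ ε')
    (hν : ∀ n, ∑ i ∈ Finset.range n, opNorm (π.exKernel E K i - truncKernel h (π.exKernel E K) i)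
      ≤ ν)
    (ha : ∀ n, ∑ i ∈ Finset.range n, opNorm (E.markov K i) ≤ a)
    {yhat : ℕ → Fin dy → ℝ} (hY : ∀ s < T, euclNorm (yhat s) ≤ Y)
    (hU : ∀ s < T, euclNorm (uex s) ≤ U) (hRn : ∀ s, ‖E.natureSignal K s‖ ≤ Rn) :
    euclNorm (secondOrderError E K h Gη π yhat uex t)
      ≤ a * (n₁ * (ε * (n₁ * (ε * (μ * Y)))) + n₁ * (ε' * U) + ν * Rn) := by
  have hJD : ∑ i ∈ Finset.range T, opNorm (feedbackLift K * truncKernel (h + 1)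
        (fun i => E.outputMarkov K i - Gη i) i) ≤ ε :=
    le_trans (Finset.sum_le_sum fun i _ => by
        rw [← mul_truncKernel]; exact opNorm_truncKernel_le _ _ _) (hε T)
  have hN := sum_opNorm_truncKernel_le h T (hn₁ T)
  rw [secondOrderError]
  simp only
  refine euclNorm_conv_le_of_sum_le _ _ ht (ha T) fun s hs => ?_
  rw [Pi.add_apply, Pi.sub_apply]
  refine (euclNorm_add_le _ _).trans (add_le_add ((euclNorm_sub_le _ _).trans (add_le_add ?_ ?_)) ?_)
  · exact euclNorm_conv_le_of_sum_le _ _ hs hN fun s hs =>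
      euclNorm_conv_le_of_sum_le _ _ hs hJD fun s hs =>
      euclNorm_conv_le_of_sum_le _ _ hs hN fun s hs =>
      euclNorm_conv_le_of_sum_le _ _ hs hJD fun s hs =>
      euclNorm_conv_le_of_sum_le _ _ hs (sum_opNorm_truncKernel_le h T (hμ T)) hY
  · exact euclNorm_conv_le_of_sum_le _ _ hs hN fun s hs =>
      euclNorm_conv_le_of_sum_le _ _ hs (hε' T) hU
  · exact euclNorm_conv_le_of_sum_le _ _ hs (hν T) fun s _ => hRn s

end Comparator

/-! ### Regret against a fixed controller -/

/-- The bounds that hold on the control phase of a run, up to time `T`. -/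
structure ControlPhase {dx dy du : ℕ} (E : Environment dx dy du) (K : Matrix (Fin du) (Fin dy) ℝ)
    (h m N T : ℕ) (R Rn b a lam η : ℝ) (uex : ℕ → Fin du → ℝ)
    (Gv : ℕ → Matrix (Fin dy ⊕ Fin du) (Fin du) ℝ) (Gη : ℕ → Matrix (Fin dy) (Fin du) ℝ)
    (yhat : ℕ → Fin dy → ℝ) (z : ℕ → DrcVec m dy du) : Prop where
  yhat_eq : yhat = fun t => estResidual Gη (E.output K uex) uex t
  lift : Gv = fun i => feedbackLift K * Gη i + if i = 0 then inputLift dy du else 0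
  Gv_zero : ∀ i, h < i → Gv i = 0
  markov_sum : ∀ n, ∑ i ∈ Finset.range n, opNorm (E.markov K i) ≤ a
  est_sum : ∀ n, ∑ i ∈ Finset.range n, opNorm (Gv i) ≤ 2 * a
  nature : ∀ t, ‖E.natureSignal K t‖ ≤ Rn
  yhat_le : ∀ t < T, euclNorm (feedbackLift K *ᵥ yhat t) ≤ 2 * Rn
  input_le : ∀ t < T, N ≤ t → euclNorm (uex t) ≤ R * (2 * Rn)
  explore_le : ∀ t < N, t < T → euclNorm (uex t) ≤ b
  b_nonneg : 0 ≤ b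
  R_nonneg : 0 ≤ R
  mem : ∀ t, N ≤ t → z t ∈ drcSet m dy du R
  control : ∀ t, N ≤ t → uex t = drcEmbed m yhat t *ᵥ z t
  step : ∀ t, N ≤ t → IsSemiONSStep (drcSet m dy du R) η (E.loss t) (feedbackLift K *ᵥ yhat t)
    (memoryMatrix h m Gv yhat t) (preconditioner lam N (memoryMatrix h m Gv yhat) t) (z t)
    (z (t + 1))

namespace ControlPhase

variable {dx dy du : ℕ} {E : Environment dx dy du} {K : Matrix (Fin du) (Fin dy) ℝ}
  {h m N T : ℕ} {R Rn b a lam η α L V : ℝ} {uex : ℕ → Fin du → ℝ}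
  {Gv : ℕ → Matrix (Fin dy ⊕ Fin du) (Fin du) ℝ} {Gη : ℕ → Matrix (Fin dy) (Fin du) ℝ}
  {yhat : ℕ → Fin dy → ℝ} {z : ℕ → DrcVec m dy du}
  (P : ControlPhase E K h m N T R Rn b a lam η uex Gv Gη yhat z)

include P

theorem a_nonneg : 0 ≤ a := by simpa using P.markov_sum 0

theorem Rn_nonneg : 0 ≤ Rn := (norm_nonneg _).trans (P.nature 0)

theorem yhat_le' {t : ℕ} (ht : t < T) : euclNorm (yhat t) ≤ 2 * Rn :=
  (euclNorm_le_feedbackLift K _).trans (P.yhat_le t ht)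

theorem memory_mulVec_le {t : ℕ} (ht : t < T) (x : DrcVec m dy du) :
    euclNorm (memoryMatrix h m Gv yhat t *ᵥ x) ≤ 4 * a * Rn * √m * euclNorm x := by
  have ha := P.a_nonneg
  rw [memoryMatrix_mulVec P.Gv_zero]
  refine (euclNorm_conv_le_of_sum_le _ _ ht (P.est_sum T) fun s hs =>
    euclNorm_drcEmbed_le_sqrt x fun r hr => P.yhat_le' (lt_of_le_of_lt hr hs)).trans
    (le_of_eq (by ring))

theorem memory_mulVec_le_of_mem {t : ℕ} (ht : t < T) {x : DrcVec m dy du}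
    (hx : x ∈ drcSet m dy du R) :
    euclNorm (memoryMatrix h m Gv yhat t *ᵥ x) ≤ 2 * a * (R * (2 * Rn)) := by
  rw [memoryMatrix_mulVec P.Gv_zero]
  exact euclNorm_conv_le_of_sum_le _ _ ht (P.est_sum T) fun s hs =>
    euclNorm_drcEmbed_le hx fun r hr => P.yhat_le' (lt_of_le_of_lt hr hs)

theorem prediction_le (hV : 2 * Rn + 2 * a * (R * (2 * Rn)) ≤ V) {t : ℕ} (ht : t < T)
    {x : DrcVec m dy du} (hx : x ∈ drcSet m dy du R) :
    euclNorm (feedbackLift K *ᵥ yhat t + memoryMatrix h m Gv yhat t *ᵥ x) ≤ V :=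
  (euclNorm_add_le _ _).trans
    ((add_le_add (P.yhat_le t ht) (P.memory_mulVec_le_of_mem ht hx)).trans hV)

theorem gradient_le (hL : 0 ≤ L) (hV1 : 1 ≤ V) (hV : 2 * Rn + 2 * a * (R * (2 * Rn)) ≤ V)
    (hloss : ∀ t, RegularLoss α L (E.loss t)) {t : ℕ} (ht : t < T) (hN : N ≤ t) :
    euclNorm ((memoryMatrix h m Gv yhat t)ᵀ *ᵥ (gradient (E.loss t)
      (WithLp.toLp 2 (feedbackLift K *ᵥ yhat t + memoryMatrix h m Gv yhat t *ᵥ z t))).ofLp)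
      ≤ 4 * a * Rn * √m * (L * V) := by
  have ha := P.a_nonneg
  have hR := P.Rn_nonneg
  refine (euclNorm_transpose_mulVec_le _ (by positivity) (P.memory_mulVec_le ht) _).trans ?_
  refine mul_le_mul_of_nonneg_left ?_ (by positivity)
  rw [euclNorm_ofLp]
  refine ((hloss t).gradient_le _).trans (mul_le_mul_of_nonneg_left (max_le hV1 ?_) hL)
  exact P.prediction_le hV ht (P.mem t hN)

/-- With `lam` of order `√T`, iterates move by order `1 / √T` per round; this is all that is used
about the memory of the loss. -/
theorem movement_le (hη : 0 ≤ η) (hlam : 0 < lam) (hL : 0 ≤ L) (hV1 : 1 ≤ V)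
    (hV : 2 * Rn + 2 * a * (R * (2 * Rn)) ≤ V)
    (hloss : ∀ t, RegularLoss α L (E.loss t)) {t : ℕ} (ht : t < T) (hN : N ≤ t) :
    euclNorm (z (t + 1) - z t) ≤ η * (4 * a * Rn * √m * (L * V) / lam) := by
  refine ((P.step t hN).bounds (convex_drcSet _ _ _ _) hη hlam (preconditioner_transpose _)
    (preconditioner_coercive _) (P.mem t hN) rfl).2.trans ?_
  have := P.gradient_le hL hV1 hV hloss ht hN
  gcongr

theorem sub_iterate_le {σ : ℝ} (hσ : ∀ t < T, N ≤ t → euclNorm (z (t + 1) - z t) ≤ σ) {s : ℕ}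
    (hs : N ≤ s) (k : ℕ) (hk : s + k < T) : euclNorm (z s - z (s + k)) ≤ k * σ := by
  induction k with
  | zero => simp [euclNorm_zero]
  | succ k ih =>
    have e : z s - z (s + (k + 1)) = (z s - z (s + k)) - (z (s + k + 1) - z (s + k)) := by
      rw [← add_assoc]; abel
    rw [e]
    refine (euclNorm_sub_le _ _).trans ((add_le_add (ih (by omega))
      (hσ (s + k) (by omega) (by omega))).trans (le_of_eq ?_))
    push_cast; ring

theorem signal_eq (t : ℕ) :
    (E.signal K uex t).ofLp = feedbackLift K *ᵥ yhat t + conv Gv uex t := by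
  have h1 := estResidual_signal_eq (E := E) (uex := uex) P.lift t
  rw [P.yhat_eq, ← h1]
  exact (sub_add_cancel _ _).symm

/-- The played signal uses the past iterates and the prediction uses the current one for all lags.
From round `N + h` on, the window of length `h` contains control rounds only, and iterates in it
differ by at most `h * σ`. -/
theorem signal_sub_prediction_le {σ : ℝ} (hσ0 : 0 ≤ σ)
    (hσ : ∀ t < T, N ≤ t → euclNorm (z (t + 1) - z t) ≤ σ) {t : ℕ} (ht : t < T) (hN : N + h ≤ t) :
    euclNorm ((E.signal K uex t).ofLp
      - (feedbackLift K *ᵥ yhat t + memoryMatrix h m Gv yhat t *ᵥ z t))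
      ≤ 4 * a * Rn * √m * (h * σ) := by
  have ha := P.a_nonneg
  have hR := P.Rn_nonneg
  rw [P.signal_eq, memoryMatrix_mulVec P.Gv_zero, add_sub_add_left_eq_sub, ← Pi.sub_apply,
    ← conv_sub]
  have hU0 : 0 ≤ √m * (2 * Rn) * (h * σ) := by positivity
  refine (euclNorm_conv_le_of_forall _ _ ht hU0 fun i hi => ?_).trans
    ((mul_le_mul_of_nonneg_right (P.est_sum T) hU0).trans (le_of_eq (by ring)))
  rcases lt_or_ge h i with hi' | hi'
  · exact Or.inl (P.Gv_zero i hi')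
  · right
    rw [Pi.sub_apply, P.control _ (by omega), ← Matrix.mulVec_sub]
    refine (euclNorm_drcEmbed_le_sqrt _ fun r hr => P.yhat_le' (by omega)).trans ?_
    refine mul_le_mul_of_nonneg_left ?_ (by positivity)
    have := P.sub_iterate_le hσ (s := t - i) (by omega) i (by omega)
    rw [Nat.sub_add_cancel hi] at this
    refine this.trans (mul_le_mul_of_nonneg_right ?_ hσ0)
    exact_mod_cast hi'

theorem signal_le (hV : 2 * Rn + 2 * a * (R * (2 * Rn)) ≤ V) {t : ℕ} (ht : t < T)
    (hN : N + h ≤ t) : euclNorm (E.signal K uex t).ofLp ≤ V := by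
  have hR := P.Rn_nonneg
  have hR' := P.R_nonneg
  have hU0 : 0 ≤ R * (2 * Rn) := by positivity
  rw [P.signal_eq]
  refine (euclNorm_add_le _ _).trans ((add_le_add (P.yhat_le t ht) ?_).trans hV)
  refine (euclNorm_conv_le_of_forall _ _ ht hU0 fun i hi => ?_).trans
    (mul_le_mul_of_nonneg_right (P.est_sum T) hU0)
  rcases lt_or_ge h i with hi' | hi'
  · exact Or.inl (P.Gv_zero i hi')
  · exact Or.inr (P.input_le _ (by omega) (by omega))

theorem input_le_add {t : ℕ} (ht : t < T) : euclNorm (uex t) ≤ b + R * (2 * Rn) := by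
  have hR := P.Rn_nonneg
  have hR' := P.R_nonneg
  have hb := P.b_nonneg
  have hU0 : 0 ≤ R * (2 * Rn) := by positivity
  rcases lt_or_ge t N with hN | hN
  · linarith [P.explore_le t hN ht]
  · linarith [P.input_le t ht hN]

/-- One round against a nearby comparator. -/
theorem loss_sub_le (hα : 0 < α) (hL : 0 ≤ L) (hV1 : 1 ≤ V)
    (hV : 2 * Rn + 2 * a * (R * (2 * Rn)) ≤ V)
    (hloss : ∀ t, RegularLoss α L (E.loss t)) {q : DrcVec m dy du} (hq : q ∈ drcSet m dy du R)
    {t : ℕ} (ht : t < T) {v d : Fin dy ⊕ Fin du → ℝ}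
    (hv : v = feedbackLift K *ᵥ yhat t + memoryMatrix h m Gv yhat t *ᵥ q + d) :
    E.loss t (WithLp.toLp 2 (feedbackLift K *ᵥ yhat t + memoryMatrix h m Gv yhat t *ᵥ z t))
      - E.loss t (WithLp.toLp 2 v)
      ≤ ((memoryMatrix h m Gv yhat t)ᵀ *ᵥ (gradient (E.loss t)
      (WithLp.toLp 2 (feedbackLift K *ᵥ yhat t + memoryMatrix h m Gv yhat t *ᵥ z t))).ofLp)
        ⬝ᵥ (z t - q) - α / 2 * euclNorm (memoryMatrix h m Gv yhat t *ᵥ (z t - q)) ^ 2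
        + L * V * euclNorm d := by
  set H := memoryMatrix h m Gv yhat t
  have h1 := (hloss t).le_add_dotProduct (feedbackLift K *ᵥ yhat t + H *ᵥ z t)
    (feedbackLift K *ᵥ yhat t + H *ᵥ q)
  have h2 := (hloss t).sub_le hα.le (feedbackLift K *ᵥ yhat t + H *ᵥ q) v hL hV1
    (P.prediction_le hV ht hq)
  have e1 : feedbackLift K *ᵥ yhat t + H *ᵥ q - v = -d := by rw [hv]; abel
  have e2 : feedbackLift K *ᵥ yhat t + H *ᵥ q - (feedbackLift K *ᵥ yhat t + H *ᵥ z t)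
      = -(H *ᵥ (z t - q)) := by rw [Matrix.mulVec_sub]; abel
  rw [e1, euclNorm_neg] at h2
  rw [e2, euclNorm_neg, dotProduct_neg] at h1
  rw [Matrix.mulVec_transpose, ← Matrix.dotProduct_mulVec]
  linarith

end ControlPhase

namespace ControlPhase

variable {dx dy du : ℕ} {E : Environment dx dy du} {K : Matrix (Fin du) (Fin dy) ℝ}
  {h m N T : ℕ} {R Rn b a lam α L V : ℝ} {uex : ℕ → Fin du → ℝ}
  {Gv : ℕ → Matrix (Fin dy ⊕ Fin du) (Fin du) ℝ} {Gη : ℕ → Matrix (Fin dy) (Fin du) ℝ}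
  {yhat : ℕ → Fin dy → ℝ} {z : ℕ → DrcVec m dy du}

/-- During control both inputs come from the same residuals, so their difference is `Y_s (q - z_s)`
and is dominated by the curvature terms. The exploration rounds, where no such relation holds, are
bounded crudely. -/
theorem sum_comparator_input_sq_le {η : ℝ}
    (P : ControlPhase E K h m N T R Rn b a lam η uex Gv Gη yhat z)
    {q : DrcVec m dy du} (hq : q ∈ drcSet m dy du R) (hNT : N ≤ T) :
    ∑ s ∈ Finset.range T, euclNorm (drcEmbed m yhat s *ᵥ q - uex s) ^ 2
      ≤ N * (b + 2 * (R * (2 * Rn))) ^ 2 + (1 + opNorm K) ^ 2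
        * ∑ s ∈ Finset.Ico N T, euclNorm (memoryMatrix h m Gv yhat s *ᵥ (z s - q)) ^ 2 := by
  rw [← Finset.sum_range_add_sum_Ico _ hNT, Finset.mul_sum]
  refine add_le_add ?_ (Finset.sum_le_sum fun s hs => ?_)
  · refine (Finset.sum_le_card_nsmul _ _ ((b + 2 * (R * (2 * Rn))) ^ 2) fun s hs => ?_).trans
      (le_of_eq (by simp))
    have hs' : s < T := (Finset.mem_range.1 hs).trans_le hNT
    refine pow_le_pow_left₀ (euclNorm_nonneg _) ((euclNorm_sub_le _ _).trans ?_) 2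
    have h1 := P.input_le_add hs'
    have h2 := euclNorm_drcEmbed_le hq fun r (hr : r ≤ s) => P.yhat_le' (lt_of_le_of_lt hr hs')
    linarith
  · have hs' := Finset.mem_Ico.1 hs
    rw [P.control s hs'.1, ← Matrix.mulVec_sub, ← mul_pow, ← neg_sub (z s) q, Matrix.mulVec_neg,
      euclNorm_neg]
    exact pow_le_pow_left₀ (euclNorm_nonneg _)
      (euclNorm_drcEmbed_le_memoryMatrix P.lift P.Gv_zero _ _ _) 2

variable (P : ControlPhase E K h m N T R Rn b a lam (3 / α) uex Gv Gη yhat z)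

include P

/-- Regret of the memory-affected predictions in the control phase. -/
theorem sum_prediction_sub_le (hα : 0 < α) (hL : 0 ≤ L) (hV1 : 1 ≤ V) (hlam : 0 < lam)
    (hV : 2 * Rn + 2 * a * (R * (2 * Rn)) ≤ V)
    (hloss : ∀ t, RegularLoss α L (E.loss t)) {q : DrcVec m dy du} (hq : q ∈ drcSet m dy du R)
    (hNT : N ≤ T) {v E₁ E₂ : ℕ → Fin dy ⊕ Fin du → ℝ} {Γ A e₂ : ℝ}
    (hv : ∀ t, v t = feedbackLift K *ᵥ yhat t + memoryMatrix h m Gv yhat t *ᵥ q + E₁ t + E₂ t)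
    (hΓ : 0 ≤ Γ) (hA : 0 < A) (hΓA : Γ * (1 + opNorm K) ^ 2 ≤ α * A)
    (hE₁ : ∑ t ∈ Finset.range T, euclNorm (E₁ t) ^ 2
      ≤ Γ * ∑ s ∈ Finset.range T, euclNorm (drcEmbed m yhat s *ᵥ q - uex s) ^ 2)
    (hE₂ : ∀ t < T, euclNorm (E₂ t) ≤ e₂) (he₂ : 0 ≤ e₂) :
    ∑ t ∈ Finset.Ico N T, (E.loss t (WithLp.toLp 2 (feedbackLift K *ᵥ yhat t
        + memoryMatrix h m Gv yhat t *ᵥ z t)) - E.loss t (WithLp.toLp 2 (v t)))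
      ≤ 24 * T * (L * V) ^ 2 * (a ^ 2 * Rn ^ 2 * m) / (α * lam) + α * lam * (dy * R ^ 2)
        + T * (L * V) ^ 2 * A + α / 4 * (N * (b + 2 * (R * (2 * Rn))) ^ 2)
        + T * (L * V * e₂) := by
  set H := memoryMatrix h m Gv yhat with hH
  set g : ℕ → DrcVec m dy du := fun t => (H t)ᵀ *ᵥ (gradient (E.loss t)
      (WithLp.toLp 2 (feedbackLift K *ᵥ yhat t + H t *ᵥ z t))).ofLp with hg
  set X := ∑ s ∈ Finset.Ico N T, euclNorm (H s *ᵥ (z s - q)) ^ 2 with hX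
  have hX0 : 0 ≤ X := Finset.sum_nonneg fun _ _ => sq_nonneg _
  have ha := P.a_nonneg
  have hRn := P.Rn_nonneg
  have hK := opNorm_nonneg K
  have hLV : 0 ≤ L * V := mul_nonneg hL (by linarith)
  have hcard : ((Finset.Ico N T).card : ℝ) ≤ T := by
    rw [Nat.card_Ico]; exact_mod_cast Nat.sub_le _ _
  have hogd := sum_dotProduct_le (convex_drcSet m dy du R) (show 0 < 3 / α by positivity) hlam
    (P.mem N le_rfl) P.step (g := g) (fun t => rfl) hq hNT
  have hgrad : ∑ t ∈ Finset.Ico N T, euclNorm (g t) ^ 2 / lam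
      ≤ T * ((4 * a * Rn * √m * (L * V)) ^ 2 / lam) := by
    refine (Finset.sum_le_card_nsmul _ _ ((4 * a * Rn * √m * (L * V)) ^ 2 / lam) ?_).trans ?_
    · intro t ht
      have ht' := Finset.mem_Ico.1 ht
      have := P.gradient_le hL hV1 hV hloss ht'.2 ht'.1
      have := pow_le_pow_left₀ (euclNorm_nonneg _) this 2
      gcongr
    · rw [nsmul_eq_mul]
      exact mul_le_mul_of_nonneg_right hcard (by positivity)
  have hdiam : euclNorm (z N - q) ^ 2 ≤ 4 * (dy * R ^ 2) := by
    have h1 := euclNorm_sq_le_of_mem_drcSet (P.mem N le_rfl)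
    have h2 := euclNorm_sq_le_of_mem_drcSet hq
    have h3 := pow_le_pow_left₀ (euclNorm_nonneg _) (euclNorm_sub_le (z N) q) 2
    nlinarith [sq_nonneg (euclNorm (z N) - euclNorm q)]
  have hround : ∀ t ∈ Finset.Ico N T, E.loss t (WithLp.toLp 2 (feedbackLift K *ᵥ yhat t
        + H t *ᵥ z t)) - E.loss t (WithLp.toLp 2 (v t))
      ≤ g t ⬝ᵥ (z t - q) - α / 2 * euclNorm (H t *ᵥ (z t - q)) ^ 2
        + ((L * V) ^ 2 * A + L * V * e₂) + 1 / (4 * A) * euclNorm (E₁ t) ^ 2 := by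
    intro t ht
    have ht' := Finset.mem_Ico.1 ht
    have h1 := P.loss_sub_le hα hL hV1 hV hloss hq ht'.2 (v := v t) (d := E₁ t + E₂ t)
      (by rw [hv t]; abel)
    have h2 : euclNorm (E₁ t + E₂ t) ≤ euclNorm (E₁ t) + e₂ :=
      (euclNorm_add_le _ _).trans (by linarith [hE₂ t ht'.2])
    have h3 := mul_le_mul_of_nonneg_left h2 hLV
    -- The arithmetic-geometric inequality with weight `A`, chosen so that the square of the
    -- first-order error can be absorbed by strong convexity.
    have h4 : L * V * euclNorm (E₁ t) ≤ (L * V) ^ 2 * A + 1 / (4 * A) * euclNorm (E₁ t) ^ 2 := by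
      have : 0 ≤ A * (L * V - 1 / (2 * A) * euclNorm (E₁ t)) ^ 2 := by positivity
      have e : A * (L * V - 1 / (2 * A) * euclNorm (E₁ t)) ^ 2
          = (L * V) ^ 2 * A + 1 / (4 * A) * euclNorm (E₁ t) ^ 2 - L * V * euclNorm (E₁ t) := by
        field_simp; ring
      linarith
    linarith
  have hE₁' : ∑ t ∈ Finset.Ico N T, euclNorm (E₁ t) ^ 2
      ≤ Γ * (N * (b + 2 * (R * (2 * Rn))) ^ 2 + (1 + opNorm K) ^ 2 * X) := by
    refine le_trans (Finset.sum_le_sum_of_subset_of_nonneg (fun i hi => ?_)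
      fun _ _ _ => sq_nonneg _)
      (hE₁.trans (mul_le_mul_of_nonneg_left (P.sum_comparator_input_sq_le hq hNT) hΓ))
    exact Finset.mem_range.2 (Finset.mem_Ico.1 hi).2
  have hΓ1 : Γ ≤ α * A := by
    refine le_trans ?_ hΓA
    nlinarith [sq_nonneg (opNorm K)]
  have hE₁'' : 1 / (4 * A) * ∑ t ∈ Finset.Ico N T, euclNorm (E₁ t) ^ 2
      ≤ α / 4 * (N * (b + 2 * (R * (2 * Rn))) ^ 2) + α / 4 * X := by
    have h1 : ∑ t ∈ Finset.Ico N T, euclNorm (E₁ t) ^ 2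
        ≤ α * A * (N * (b + 2 * (R * (2 * Rn))) ^ 2) + α * A * X := by
      refine hE₁'.trans ?_
      have h2 : 0 ≤ (N : ℝ) * (b + 2 * (R * (2 * Rn))) ^ 2 := by positivity
      have h3 := mul_le_mul_of_nonneg_right hΓ1 h2
      have h4 := mul_le_mul_of_nonneg_right hΓA hX0
      linarith
    refine (mul_le_mul_of_nonneg_left h1 (by positivity)).trans (le_of_eq ?_)
    field_simp
  calc _ ≤ ∑ t ∈ Finset.Ico N T, (g t ⬝ᵥ (z t - q) - α / 2 * euclNorm (H t *ᵥ (z t - q)) ^ 2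
        + ((L * V) ^ 2 * A + L * V * e₂) + 1 / (4 * A) * euclNorm (E₁ t) ^ 2) :=
        Finset.sum_le_sum hround
    _ = ∑ t ∈ Finset.Ico N T, g t ⬝ᵥ (z t - q) - α / 2 * X
        + (Finset.Ico N T).card * ((L * V) ^ 2 * A + L * V * e₂)
        + 1 / (4 * A) * ∑ t ∈ Finset.Ico N T, euclNorm (E₁ t) ^ 2 := by
        rw [Finset.sum_add_distrib, Finset.sum_add_distrib, Finset.sum_sub_distrib,
          ← Finset.mul_sum, ← Finset.mul_sum, Finset.sum_const, nsmul_eq_mul]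
    _ ≤ (3 / α / 2 * (T * ((4 * a * Rn * √m * (L * V)) ^ 2 / lam))
          + 1 / (2 * (3 / α)) * (lam * (4 * (dy * R ^ 2)) + X)) - α / 2 * X
        + T * ((L * V) ^ 2 * A + L * V * e₂)
        + (α / 4 * (N * (b + 2 * (R * (2 * Rn))) ^ 2) + α / 4 * X) := by
        refine add_le_add (add_le_add (sub_le_sub_right (hogd.trans ?_) _) ?_) hE₁''
        · gcongr
        · exact mul_le_mul_of_nonneg_right hcard (by positivity)
    -- Budget for the curvature sum: strong convexity gives `-α / 2`, the step size `3 / α` uses `1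
    -- / (2 η) = α / 6`, the first-order error uses `α / 4`, and `-α / 12` is left over.
    _ = 24 * T * (L * V) ^ 2 * (a ^ 2 * Rn ^ 2 * m) / (α * lam) + 2 / 3 * (α * lam * (dy * R ^ 2))
        + T * (L * V) ^ 2 * A + α / 4 * (N * (b + 2 * (R * (2 * Rn))) ^ 2)
        + T * (L * V * e₂) - α / 12 * X := by
        rw [mul_pow, mul_pow, Real.sq_sqrt (Nat.cast_nonneg m)]
        field_simp
        ring
    _ ≤ _ := by
        have h1 : 0 ≤ α * lam * (dy * R ^ 2) := by positivity
        have h2 : 0 ≤ α / 12 * X := by positivity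
        linarith

/-- Regret against a fixed signal sequence that is close to a DRC comparator. -/
theorem sum_loss_sub_le (hα : 0 < α) (hL : 0 ≤ L) (hV1 : 1 ≤ V) (hlam : 0 < lam)
    (hV : 2 * Rn + 2 * a * (R * (2 * Rn)) ≤ V)
    (hloss : ∀ t, RegularLoss α L (E.loss t)) {q : DrcVec m dy du} (hq : q ∈ drcSet m dy du R)
    (hNT : N ≤ T) (hh : 1 ≤ h) {v E₁ E₂ : ℕ → Fin dy ⊕ Fin du → ℝ} {Γ A e₂ V' : ℝ}
    (hv : ∀ t, v t = feedbackLift K *ᵥ yhat t + memoryMatrix h m Gv yhat t *ᵥ q + E₁ t + E₂ t)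
    (hΓ : 0 ≤ Γ) (hA : 0 < A) (hΓA : Γ * (1 + opNorm K) ^ 2 ≤ α * A)
    (hE₁ : ∑ t ∈ Finset.range T, euclNorm (E₁ t) ^ 2
      ≤ Γ * ∑ s ∈ Finset.range T, euclNorm (drcEmbed m yhat s *ᵥ q - uex s) ^ 2)
    (hE₂ : ∀ t < T, euclNorm (E₂ t) ≤ e₂) (he₂ : 0 ≤ e₂) (hVV : V ≤ V')
    (hsig : ∀ t < T, ‖E.signal K uex t‖ ≤ V') (hvV : ∀ t < T, euclNorm (v t) ≤ V') :
    ∑ t ∈ Finset.range T, (E.loss t (E.signal K uex t) - E.loss t (WithLp.toLp 2 (v t)))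
      ≤ (N + h : ℕ) * (2 * L * V' ^ 2)
        + 72 * T * (L * V) ^ 2 * (a ^ 2 * Rn ^ 2 * m * h) / (α * lam)
        + α * lam * (dy * R ^ 2)
        + T * (L * V) ^ 2 * A + α / 4 * (N * (b + 2 * (R * (2 * Rn))) ^ 2)
        + T * (L * V * e₂) := by
  set H := memoryMatrix h m Gv yhat with hH
  have ha := P.a_nonneg
  have hRn := P.Rn_nonneg
  have hh' : (1 : ℝ) ≤ h := by exact_mod_cast hh
  have hV'1 : 1 ≤ V' := hV1.trans hVV
  have habs : ∀ t x, ‖x‖ ≤ V' → |E.loss t x| ≤ L * V' ^ 2 := by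
    intro t x hx
    refine ((hloss t).abs_le x).trans (mul_le_mul_of_nonneg_left (max_le ?_ ?_) hL)
    · exact one_le_pow₀ hV'1
    · exact pow_le_pow_left₀ (norm_nonneg _) hx 2
  have hcrude : ∀ t x y, ‖x‖ ≤ V' → ‖y‖ ≤ V' → E.loss t x - E.loss t y ≤ 2 * L * V' ^ 2 := by
    intro t x y hx hy
    have h1 := (abs_le.1 (habs t x hx)).2
    have h2 := (abs_le.1 (habs t y hy)).1
    linarith
  set M := L * V * (4 * a * Rn * √m * (h * (3 / α * (4 * a * Rn * √m * (L * V) / lam)))) with hM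
  have hM0 : 0 ≤ M := by positivity
  -- The first `h` control rounds still feel exploration inputs and are charged at the crude rate.
  have hmove : ∀ t ∈ Finset.Ico N T, E.loss t (E.signal K uex t)
      - E.loss t (WithLp.toLp 2 (feedbackLift K *ᵥ yhat t + H t *ᵥ z t))
      ≤ M + if t < N + h then 2 * L * V' ^ 2 else 0 := by
    intro t ht
    have ht' := Finset.mem_Ico.1 ht
    split_ifs with hth
    · have := hcrude t (E.signal K uex t)
        (WithLp.toLp 2 (feedbackLift K *ᵥ yhat t + H t *ᵥ z t)) (hsig t ht'.2)
        ((P.prediction_le hV ht'.2 (P.mem t ht'.1)).trans hVV)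
      linarith
    · rw [add_zero]
      have h1 := (hloss t).sub_le hα.le (E.signal K uex t).ofLp
        (feedbackLift K *ᵥ yhat t + H t *ᵥ z t) hL hV1 (P.signal_le hV ht'.2 (by omega))
      refine h1.trans (mul_le_mul_of_nonneg_left ?_ (by positivity))
      refine P.signal_sub_prediction_le (by positivity) (fun s hs hsN => ?_) ht'.2 (by omega)
      exact P.movement_le (by positivity) hlam hL hV1 hV hloss hs hsN
  have hpred := P.sum_prediction_sub_le hα hL hV1 hlam hV hloss hq hNT hv hΓ hA hΓA hE₁ hE₂ he₂
  have hsumM : ∑ t ∈ Finset.Ico N T, (E.loss t (E.signal K uex t)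
      - E.loss t (WithLp.toLp 2 (feedbackLift K *ᵥ yhat t + H t *ᵥ z t)))
      ≤ T * M + h * (2 * L * V' ^ 2) := by
    refine (Finset.sum_le_sum hmove).trans ?_
    rw [Finset.sum_add_distrib, Finset.sum_const, nsmul_eq_mul, Nat.card_Ico, ← Finset.sum_filter,
      Finset.sum_const, nsmul_eq_mul]
    have h1 : ((T - N : ℕ) : ℝ) ≤ T := by exact_mod_cast Nat.sub_le _ _
    have h2 : ((Finset.filter (fun t => t < N + h) (Finset.Ico N T)).card : ℝ) ≤ h := by
      have : (Finset.filter (fun t => t < N + h) (Finset.Ico N T)).card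
          ≤ (Finset.Ico N (N + h)).card := by
        refine Finset.card_le_card fun t ht => ?_
        simp only [Finset.mem_filter, Finset.mem_Ico] at ht ⊢
        omega
      rw [Nat.card_Ico, Nat.add_sub_cancel_left] at this
      exact_mod_cast this
    gcongr
  have hexp : ∑ t ∈ Finset.range N, (E.loss t (E.signal K uex t) - E.loss t (WithLp.toLp 2 (v t)))
      ≤ N * (2 * L * V' ^ 2) := by
    refine (Finset.sum_le_card_nsmul _ _ (2 * L * V' ^ 2) fun t ht => ?_).trans
      (le_of_eq (by simp))
    have ht' : t < T := (Finset.mem_range.1 ht).trans_le hNT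
    exact hcrude t _ _ (hsig t ht') (hvV t ht')
  have hMeq : T * M = 48 * T * (L * V) ^ 2 * (a ^ 2 * Rn ^ 2 * m * h) / (α * lam) := by
    rw [hM]
    have : √(m : ℝ) * √m = m := Real.mul_self_sqrt (Nat.cast_nonneg m)
    rw [show L * V * (4 * a * Rn * √m * (h * (3 / α * (4 * a * Rn * √m * (L * V) / lam))))
      = L * V * (4 * a * Rn * (h * (3 / α * (4 * a * Rn * (√m * √m) * (L * V) / lam)))) by ring,
      this]
    field_simp
    ring
  have hgr : 24 * T * (L * V) ^ 2 * (a ^ 2 * Rn ^ 2 * m) / (α * lam)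
      ≤ 24 * T * (L * V) ^ 2 * (a ^ 2 * Rn ^ 2 * m * h) / (α * lam) := by
    refine div_le_div_of_nonneg_right (mul_le_mul_of_nonneg_left ?_ (by positivity))
      (by positivity)
    exact le_mul_of_one_le_right (by positivity) hh'
  have hsplit : ∑ t ∈ Finset.range T, (E.loss t (E.signal K uex t) - E.loss t (WithLp.toLp 2 (v t)))
      = ∑ t ∈ Finset.range N, (E.loss t (E.signal K uex t) - E.loss t (WithLp.toLp 2 (v t)))
        + (∑ t ∈ Finset.Ico N T, (E.loss t (E.signal K uex t)
          - E.loss t (WithLp.toLp 2 (feedbackLift K *ᵥ yhat t + H t *ᵥ z t)))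
        + ∑ t ∈ Finset.Ico N T, (E.loss t (WithLp.toLp 2 (feedbackLift K *ᵥ yhat t
          + H t *ᵥ z t)) - E.loss t (WithLp.toLp 2 (v t)))) := by
    rw [← Finset.sum_range_add_sum_Ico _ hNT, ← Finset.sum_add_distrib]
    congr 1
    exact Finset.sum_congr rfl fun t _ => by ring
  rw [hsplit]
  push_cast
  have e72 : 72 * T * (L * V) ^ 2 * (a ^ 2 * Rn ^ 2 * m * h) / (α * lam)
      = 48 * T * (L * V) ^ 2 * (a ^ 2 * Rn ^ 2 * m * h) / (α * lam)
        + 24 * T * (L * V) ^ 2 * (a ^ 2 * Rn ^ 2 * m * h) / (α * lam) := by ring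
  linarith

end ControlPhase

/-! ### Kernel norms of exponentially stable systems -/

theorem sum_range_le_of_geometric {f : ℕ → ℝ} {c ρ : ℝ} {k : ℕ} (h0 : 0 < ρ) (h1 : ρ < 1)
    (hc : 0 ≤ c) (hk : ∀ i < k, f i ≤ 0) (hf : ∀ i, k ≤ i → f i ≤ c * ρ ^ i) (n : ℕ) :
    ∑ i ∈ Finset.range n, f i ≤ c * (ρ ^ k / (1 - ρ)) := by
  calc _ ≤ ∑ i ∈ Finset.range n, if k ≤ i then c * ρ ^ i else 0 := by
        refine Finset.sum_le_sum fun i _ => ?_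
        split_ifs with hi
        · exact hf i hi
        · exact hk i (not_le.1 hi)
    _ = ∑ i ∈ Finset.Ico k n, c * ρ ^ i := by
        rw [← Finset.sum_filter]
        refine Finset.sum_congr ?_ fun _ _ => rfl
        ext i; simp [and_comm]
    _ ≤ _ := by
        rw [← Finset.mul_sum]
        exact mul_le_mul_of_nonneg_left (sum_Ico_geom_le h0 h1 k n) hc

section

variable {dx dy du : ℕ} {E : Environment dx dy du} {K : Matrix (Fin du) (Fin dy) ℝ}

theorem sum_opNorm_markov_le {cK ρ : ℝ} (h0 : 0 < ρ) (h1 : ρ < 1) (hc : 0 ≤ cK)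
    (hG : ∀ i, opNorm (E.markov K i) ≤ cK * ρ ^ i) (n : ℕ) :
    ∑ i ∈ Finset.range n, opNorm (E.markov K i) ≤ cK / (1 - ρ) := by
  refine (sum_range_le_of_geometric (k := 0) h0 h1 hc (by simp) (fun i _ => hG i) n).trans
    (le_of_eq ?_)
  rw [pow_zero, mul_one_div]

/-- The lag-zero parameter contains the identity of input space, nontrivial because `0 < du`. -/
theorem one_le_of_markov_le {cK ρ : ℝ} (hdu : 0 < du)
    (hG : ∀ i, opNorm (E.markov K i) ≤ cK * ρ ^ i) : 1 ≤ cK := by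
  have h := hG 0
  have e : E.markov K 0 = inputLift dy du := by simp [Environment.markov, inputLift]
  rw [pow_zero, mul_one, e] at h
  have h1 := abs_entry_le_opNorm (inputLift dy du) (Sum.inr ⟨0, hdu⟩) ⟨0, hdu⟩
  simp only [inputLift, Matrix.fromRows_apply_inr, Matrix.one_apply_eq, abs_one] at h1
  exact h1.trans h

theorem opNorm_le_opNorm_fromCols (D : Matrix (Fin du) (Fin dy) ℝ) :
    opNorm D ≤ opNorm (Matrix.fromCols D (0 : Matrix (Fin du) (Fin du) ℝ)) := by
  refine opNorm_le_of_forall _ (opNorm_nonneg _) fun y => ?_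
  have e : D *ᵥ y = Matrix.fromCols D (0 : Matrix (Fin du) (Fin du) ℝ)
      *ᵥ Sum.elim y (0 : Fin du → ℝ) := by
    simp [Matrix.fromCols_mulVec]
  have e2 : euclNorm (Sum.elim y (0 : Fin du → ℝ)) = euclNorm y := by
    have := euclNorm_elim_sq y (0 : Fin du → ℝ)
    rw [euclNorm_zero, zero_pow two_ne_zero, add_zero] at this
    exact (sq_eq_sq₀ (euclNorm_nonneg _) (euclNorm_nonneg _)).1 this
  rw [e]
  exact (euclNorm_mulVec_le _ _).trans (le_of_eq (by rw [e2]))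

theorem opNorm_fromCols_neg_one_le (D : Matrix (Fin du) (Fin dy) ℝ) :
    opNorm (Matrix.fromCols D (-1 : Matrix (Fin du) (Fin du) ℝ)) ≤ opNorm D + 1 := by
  refine opNorm_le_of_forall _ (by linarith [opNorm_nonneg D]) fun x => ?_
  obtain ⟨y, u, rfl⟩ : ∃ y u, x = Sum.elim y u := ⟨_, _, (Sum.elim_comp_inl_inr x).symm⟩
  have e : Matrix.fromCols D (-1 : Matrix (Fin du) (Fin du) ℝ) *ᵥ Sum.elim y u = D *ᵥ y - u := by
    simp [Matrix.fromCols_mulVec, Matrix.neg_mulVec, sub_eq_add_neg]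
  rw [e, add_mul, one_mul]
  refine (euclNorm_sub_le _ _).trans (add_le_add ((euclNorm_mulVec_le _ _).trans ?_)
    (euclNorm_le_elim_right _ _))
  exact mul_le_mul_of_nonneg_left (euclNorm_le_elim_left _ _) (opNorm_nonneg _)

variable {π : LDC dy du} {cs ρs : ℝ}

theorem opNorm_exKernel_le (hcs : 1 ≤ cs) (hπ : π ∈ stabilizing E K cs ρs) (i : ℕ) :
    opNorm (π.exKernel E K i) ≤ (if i = 0 then 2 * cs else cs) * ρs ^ i := by
  have h : opNorm (π.closedLoop E K i) ≤ cs * ρs ^ i := hπ i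
  unfold LDC.exKernel
  split_ifs with hi
  · subst hi
    have h2 : opNorm (Matrix.fromCols π.Dπ (0 : Matrix (Fin du) (Fin du) ℝ)) ≤ cs := by
      simpa [LDC.closedLoop] using h
    have h3 := opNorm_fromCols_neg_one_le π.Dπ
    have h4 := opNorm_le_opNorm_fromCols π.Dπ
    rw [pow_zero, mul_one]
    linarith
  · exact h

theorem sum_opNorm_exKernel_le (h0 : 0 < ρs) (h1 : ρs < 1) (hcs : 1 ≤ cs)
    (hπ : π ∈ stabilizing E K cs ρs) (n : ℕ) :
    ∑ i ∈ Finset.range n, opNorm (π.exKernel E K i) ≤ 2 * (cs / (1 - ρs)) := by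
  refine (sum_range_le_of_geometric (k := 0) (c := 2 * cs) h0 h1 (by linarith) (by simp)
    (fun i _ => (opNorm_exKernel_le hcs hπ i).trans ?_) n).trans (le_of_eq ?_)
  · refine mul_le_mul_of_nonneg_right ?_ (by positivity)
    split_ifs <;> linarith
  · rw [pow_zero]; ring

/-- At lag zero the product is exactly `Dπ - K`, of norm at most `(1 + ‖K‖) cs`, so the factor `2`
of the unlifted kernel is avoided and the radius `R` is exactly twice this sum. -/
theorem sum_opNorm_exKernel_mul_le (h0 : 0 < ρs) (h1 : ρs < 1) (hcs : 1 ≤ cs)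
    (hπ : π ∈ stabilizing E K cs ρs) (n : ℕ) :
    ∑ i ∈ Finset.range n, opNorm (π.exKernel E K i * feedbackLift K)
      ≤ (1 + opNorm K) * (cs / (1 - ρs)) := by
  have hK := opNorm_nonneg K
  refine (sum_range_le_of_geometric (k := 0) (c := (1 + opNorm K) * cs) h0 h1 (by positivity)
    (by simp) (fun i _ => ?_) n).trans (le_of_eq ?_)
  · by_cases hi : i = 0
    · subst hi
      have h : opNorm (π.closedLoop E K 0) ≤ cs * ρs ^ 0 := hπ 0
      have h2 : opNorm (Matrix.fromCols π.Dπ (0 : Matrix (Fin du) (Fin du) ℝ)) ≤ cs := by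
        simpa [LDC.closedLoop] using h
      have h4 := opNorm_le_opNorm_fromCols π.Dπ
      have e : π.exKernel E K 0 * feedbackLift K = π.Dπ - K := by
        simp [LDC.exKernel, feedbackLift, Matrix.fromCols_mul_fromRows, sub_eq_add_neg]
      rw [e, pow_zero, mul_one]
      have h5 := opNorm_sub_le π.Dπ K
      nlinarith
    · have h := opNorm_exKernel_le hcs hπ i
      rw [if_neg hi] at h
      refine (opNorm_mul_le _ _).trans ?_
      refine (mul_le_mul h (opNorm_feedbackLift_le K) (opNorm_nonneg _) (by positivity)).trans
        (le_of_eq (by ring))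
  · rw [pow_zero]; ring

theorem sum_opNorm_exKernel_sub_trunc_le (h0 : 0 < ρs) (h1 : ρs < 1) (hcs : 1 ≤ cs)
    (hπ : π ∈ stabilizing E K cs ρs) {h : ℕ} (hh : 1 ≤ h) (n : ℕ) :
    ∑ i ∈ Finset.range n, opNorm (π.exKernel E K i - truncKernel h (π.exKernel E K) i)
      ≤ cs * (ρs ^ h / (1 - ρs)) := by
  refine sum_range_le_of_geometric h0 h1 (by linarith) (fun i hi => ?_) (fun i hi => ?_) n
  · rw [truncKernel, if_pos hi, sub_self, opNorm_zero]
  · rw [truncKernel_eq_zero hi, sub_zero]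
    have := opNorm_exKernel_le hcs hπ i
    rwa [if_neg (by omega)] at this

theorem euclNorm_signal_le {T : ℕ} {uex : ℕ → Fin du → ℝ} {a U Rn : ℝ}
    (ha : ∀ n, ∑ i ∈ Finset.range n, opNorm (E.markov K i) ≤ a)
    (hnat : ∀ t, ‖E.natureSignal K t‖ ≤ Rn) (hU : ∀ s < T, euclNorm (uex s) ≤ U) {t : ℕ}
    (ht : t < T) : ‖E.signal K uex t‖ ≤ Rn + a * U := by
  rw [← euclNorm_ofLp, E.signal_eq_nature_add_conv]
  exact (euclNorm_add_le _ _).trans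
    (add_le_add (hnat t) (euclNorm_conv_le_of_sum_le _ _ ht (ha T) hU))

theorem LDC.norm_signal_le {a n₁ Rn : ℝ}
    (ha : ∀ n, ∑ i ∈ Finset.range n, opNorm (E.markov K i) ≤ a)
    (hn₁ : ∀ n, ∑ i ∈ Finset.range n, opNorm (π.exKernel E K i) ≤ n₁)
    (hnat : ∀ t, ‖E.natureSignal K t‖ ≤ Rn) (t : ℕ) :
    ‖π.signal E t‖ ≤ Rn + a * (n₁ * Rn) := by
  rw [π.signal_eq E K]
  refine euclNorm_signal_le ha hnat (fun s hs => ?_) (Nat.lt_succ_self t)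
  rw [π.exInput_eq]
  exact euclNorm_conv_le_of_sum_le _ _ hs (hn₁ _) fun r _ => hnat r

/-! ### Splitting the estimation error at lag `h`. -/

section Estimate

variable {h : ℕ} {Gη : ℕ → Matrix (Fin dy) (Fin du) ℝ} {cK ρ : ℝ}

theorem opNorm_estimate_tail_le (hGη : ∀ i, h < i → Gη i = 0)
    (hG : ∀ i, opNorm (E.markov K i) ≤ cK * ρ ^ i) {i : ℕ} (hi : h < i) :
    opNorm (feedbackLift K * (E.outputMarkov K i - Gη i)) ≤ cK * ρ ^ i := by
  have h1 := hG i
  rw [E.markov_eq, if_neg (by omega), add_zero] at h1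
  rwa [hGη i hi, sub_zero]

theorem sum_opNorm_estimate_tail_le (h0 : 0 < ρ) (h1 : ρ < 1) (hc : 0 ≤ cK)
    (hGη : ∀ i, h < i → Gη i = 0) (hG : ∀ i, opNorm (E.markov K i) ≤ cK * ρ ^ i) (n : ℕ) :
    ∑ i ∈ Finset.range n, opNorm (feedbackLift K * ((E.outputMarkov K i - Gη i)
      - truncKernel (h + 1) (fun i => E.outputMarkov K i - Gη i) i))
      ≤ cK * (ρ ^ (h + 1) / (1 - ρ)) := by
  refine sum_range_le_of_geometric h0 h1 hc (fun i hi => ?_) (fun i hi => ?_) n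
  · rw [truncKernel, if_pos hi, sub_self, Matrix.mul_zero, opNorm_zero]
  · rw [truncKernel_eq_zero hi, sub_zero]
    exact opNorm_estimate_tail_le hGη hG hi

theorem sum_opNorm_estimate_le (h0 : 0 < ρ) (h1 : ρ < 1) (hc : 0 ≤ cK) (hGη0 : Gη 0 = 0)
    (hGη : ∀ i, h < i → Gη i = 0) (hG : ∀ i, opNorm (E.markov K i) ≤ cK * ρ ^ i) (n : ℕ) :
    ∑ i ∈ Finset.range n, opNorm (feedbackLift K * (E.outputMarkov K i - Gη i))
      ≤ ∑ i ∈ Finset.Icc 1 h, opNorm (feedbackLift K * (E.outputMarkov K i - Gη i))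
        + cK * (ρ ^ (h + 1) / (1 - ρ)) := by
  set f : ℕ → ℝ := fun i => opNorm (feedbackLift K * (E.outputMarkov K i - Gη i)) with hf
  have hf0 : ∀ i, 0 ≤ f i := fun i => opNorm_nonneg _
  have hf00 : f 0 = 0 := by simp [hf, Environment.outputMarkov, hGη0, opNorm_zero]
  have htail := sum_range_le_of_geometric (f := fun i => if i < h + 1 then 0 else f i) (k := h + 1)
    h0 h1 hc (fun i hi => by simp [hi]) (fun i hi => by
      rw [if_neg (by omega)]
      exact opNorm_estimate_tail_le hGη hG hi) n
  have hhead : ∑ i ∈ Finset.range n, (if i < h + 1 then f i else 0)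
      ≤ ∑ i ∈ Finset.Icc 1 h, f i := by
    rw [← Finset.sum_filter]
    calc _ ≤ ∑ i ∈ Finset.range (h + 1), f i :=
          Finset.sum_le_sum_of_subset_of_nonneg (fun i hi => by simp at hi ⊢; omega)
            fun i _ _ => hf0 i
      _ = _ := by
          rw [Finset.range_eq_Ico, Finset.sum_eq_sum_Ico_succ_bot (by omega), hf00, zero_add]
          rfl
  calc _ = ∑ i ∈ Finset.range n, (if i < h + 1 then f i else 0)
        + ∑ i ∈ Finset.range n, (if i < h + 1 then 0 else f i) := by
        rw [← Finset.sum_add_distrib]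
        exact Finset.sum_congr rfl fun i _ => by split_ifs <;> simp [hf]
    _ ≤ _ := add_le_add hhead htail

end Estimate

end

/-! ### Scalar estimates -/

section Scalar

/-- The regime of the parameters: `a`, `r` bound the gains of the nominal and the benchmark
feedback loops, `q` is the mixing time, `κ = 1 + ‖K‖`, `ι = log (1 / δ)`, `ℓ = log (1 + T)` and
`θ = √T`. -/
structure Regime (h : ℕ) (du d a r q κ Rn ι ℓ θ : ℝ) : Prop where
  h_ge : 1 ≤ h
  du_ge : 1 ≤ du
  du_le : du ≤ d
  a_ge : 1 ≤ a
  a_le : a ≤ r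
  q_ge : 1 ≤ q
  κ_ge : 1 ≤ κ
  Rn_ge : 1 ≤ Rn
  ι_ge : 2 / 3 ≤ ι
  ℓ_ge : 1 ≤ ℓ
  h_le : h ≤ 5 / 2 * (q * ℓ)
  large : 10 ^ 7 * (h : ℝ) ^ 2 * (r ^ 4 * κ ^ 2 * Rn ^ 2 * ι ^ 2 + du ^ 2) ≤ θ

namespace Regime

variable {h : ℕ} {du d a r q κ Rn ι ℓ θ : ℝ} (P : Regime h du d a r q κ Rn ι ℓ θ)

include P

theorem one_le_h : (1 : ℝ) ≤ h := by exact_mod_cast P.h_ge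

theorem r_ge : 1 ≤ r := P.a_ge.trans P.a_le

theorem d_ge : 1 ≤ d := P.du_ge.trans P.du_le

theorem large_gain : 10 ^ 7 * ((h : ℝ) ^ 2 * (r ^ 4 * κ ^ 2 * Rn ^ 2 * ι ^ 2)) ≤ θ := by
  refine le_trans ?_ P.large
  have : 0 ≤ (h : ℝ) ^ 2 * du ^ 2 := by positivity
  linarith

theorem large_dim : 10 ^ 7 * ((h : ℝ) ^ 2 * du ^ 2) ≤ θ := by
  refine le_trans ?_ P.large
  have : 0 ≤ (h : ℝ) ^ 2 * (r ^ 4 * κ ^ 2 * Rn ^ 2 * ι ^ 2) := by positivity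
  linarith

theorem large_sq : 10 ^ 7 * (r ^ 2 * κ ^ 2 * Rn ^ 2 * ι ^ 2) ≤ θ := by
  refine le_trans ?_ P.large_gain
  have h1 := P.one_le_h
  have h2 := P.r_ge
  have h3 := one_le_pow₀ h1 (n := 2)
  have h4 : r ^ 2 ≤ r ^ 4 := pow_le_pow_right₀ h2 (by norm_num)
  have h5 : r ^ 2 * κ ^ 2 * Rn ^ 2 * ι ^ 2 ≤ r ^ 4 * κ ^ 2 * Rn ^ 2 * ι ^ 2 := by gcongr
  have h6 : 0 ≤ r ^ 4 * κ ^ 2 * Rn ^ 2 * ι ^ 2 := by positivity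
  nlinarith

theorem large_h : 10 ^ 7 * (h : ℝ) ^ 2 ≤ θ := by
  refine le_trans ?_ P.large_dim
  have h3 := one_le_pow₀ P.du_ge (n := 2)
  have : 0 ≤ (h : ℝ) ^ 2 := by positivity
  nlinarith

theorem large_du : 10 ^ 7 * du ^ 2 ≤ θ := by
  refine le_trans ?_ P.large_dim
  have h3 := one_le_pow₀ P.one_le_h (n := 2)
  have : 0 ≤ du ^ 2 := by positivity
  nlinarith

theorem large_r : 10 ^ 7 * (r ^ 2 * ι ^ 2) ≤ θ := by
  refine le_trans ?_ P.large_sq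
  have h1 : 1 ≤ κ ^ 2 * Rn ^ 2 :=
    one_le_mul_of_one_le_of_one_le (one_le_pow₀ P.κ_ge) (one_le_pow₀ P.Rn_ge)
  have : 0 ≤ r ^ 2 * ι ^ 2 := by positivity
  nlinarith

theorem large_ι : 10 ^ 7 * ι ^ 2 ≤ θ := by
  refine le_trans ?_ P.large_r
  have h1 := one_le_pow₀ P.r_ge (n := 2)
  have : 0 ≤ ι ^ 2 := by positivity
  nlinarith

theorem θ_ge : 10 ^ 7 ≤ θ := by
  refine le_trans ?_ P.large_h
  have := one_le_pow₀ P.one_le_h (n := 2)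
  linarith

theorem ι_pos : 0 < ι := by linarith [P.ι_ge]

theorem h_le_θ : (h : ℝ) ≤ θ := by
  have := P.large_h
  have := P.one_le_h
  nlinarith

theorem h_sq_le : (h : ℝ) ^ 2 ≤ 25 / 4 * (q ^ 2 * ℓ ^ 2) := by
  have := pow_le_pow_left₀ (by positivity) P.h_le 2
  linarith

theorem noise_sq_le : 2 * du + 40 * ι ≤ 43 * (d * ι) := by
  have := P.ι_ge; have := P.d_ge; have := P.du_le
  nlinarith

theorem noise_sq_ge : 1 ≤ 2 * du + 40 * ι := by
  have := P.ι_ge; have := P.du_ge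
  linarith

theorem noise_sq_mul_le : 1000 * (ι * (2 * du + 40 * ι)) ≤ θ := by
  have h1 := P.large_du
  have h2 := P.large_ι
  nlinarith [sq_nonneg (ι - du)]

variable {b ε : ℝ}

theorem radius_mul_error_le (hε : ε ^ 2 = 784 * (Rn ^ 2 * ι / θ)) :
    2 * (2 * (κ * r)) * ε ≤ 1 := by
  have hθ : 0 < θ := by linarith [P.θ_ge]
  have hr := P.r_ge; have hκ := P.κ_ge; have hRn := P.Rn_ge; have hι := P.ι_ge
  refine le_of_sq_le_sq ?_ zero_le_one
  have e : (2 * (2 * (κ * r)) * ε) ^ 2 = 12544 * (r ^ 2 * κ ^ 2 * Rn ^ 2 * ι) / θ := by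
    rw [mul_pow, hε]; ring
  rw [e, one_pow, div_le_one hθ]
  refine le_trans ?_ P.large_sq
  have : 0 ≤ r ^ 2 * κ ^ 2 * Rn ^ 2 * ι := by positivity
  have : r ^ 2 * κ ^ 2 * Rn ^ 2 * ι ^ 2 = r ^ 2 * κ ^ 2 * Rn ^ 2 * ι * ι := by ring
  nlinarith

theorem error_le (hε0 : 0 ≤ ε) (hε : ε ^ 2 = 784 * (Rn ^ 2 * ι / θ)) : 2 * r * ε ≤ 1 := by
  have h1 := P.radius_mul_error_le hε
  have h2 : 0 ≤ r * ε := mul_nonneg (by linarith [P.r_ge]) hε0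
  have := P.κ_ge
  nlinarith

theorem error_mul_noise_le (hε : ε ^ 2 = 784 * (Rn ^ 2 * ι / θ))
    (hb : b ^ 2 = 2 * du + 40 * ι) : ε * b ≤ Rn := by
  have hθ : 0 < θ := by linarith [P.θ_ge]
  have hRn := P.Rn_ge
  refine le_of_sq_le_sq ?_ (by linarith)
  have h1 := P.noise_sq_mul_le
  have h0 := P.ι_pos
  have h2 := P.noise_sq_ge
  rw [mul_pow, hε, hb, show 784 * (Rn ^ 2 * ι / θ) * (2 * du + 40 * ι)
    = Rn ^ 2 * (784 * (ι * (2 * du + 40 * ι)) / θ) by ring]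
  refine mul_le_of_le_one_right (sq_nonneg _) ((div_le_one hθ).2 ?_)
  have : 0 ≤ ι * (2 * du + 40 * ι) := by positivity
  linarith

theorem exploration_length_sub_ge {n : ℝ} (hn : (h : ℝ) ^ 2 * θ * d - h ≤ n) :
    (h : ℝ) ^ 2 * θ * d / 2 ≤ n := by
  have h1 := P.one_le_h; have hd := P.d_ge; have hθ := P.θ_ge
  have : (h : ℝ) * 2 ≤ h ^ 2 * θ * d := by
    rw [show (h : ℝ) ^ 2 * θ * d = h * (h * θ * d) by ring]
    refine mul_le_mul_of_nonneg_left ?_ (by linarith)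
    have : 1 ≤ (h : ℝ) * d := one_le_mul_of_one_le_of_one_le h1 hd
    nlinarith
  linarith

/-- The Chernoff parameter `s = 1 / (8 h du)` turns the bias into `n / 4`; the fluctuation `160 ι h
^ 2 du ^ 2` fits into the other quarter because exploration has length of order `h ^ 2 √T d`. -/
theorem covariance_error_le {n s : ℝ} (hn : (h : ℝ) ^ 2 * θ * d - h ≤ n)
    (hs : s = 1 / (8 * (h * du))) :
    (2 * (10 * ι) / s + 2 * s * n) * (h * du) ≤ n / 2 := by
  have hn' := P.exploration_length_sub_ge hn
  have h1 := P.one_le_h; have hdu := P.du_ge; have hι := P.ι_pos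
  have hlin : 1280 * (ι * du) ≤ θ := by
    have := P.large_du; have := P.large_ι
    nlinarith [sq_nonneg (ι - du)]
  have e : (2 * (10 * ι) / s + 2 * s * n) * (h * du) = 160 * ι * (h ^ 2 * du ^ 2) + n / 4 := by
    rw [hs]; field_simp; ring
  rw [e]
  have h2 : 1280 * ι * (h ^ 2 * du ^ 2) ≤ (h : ℝ) ^ 2 * θ * d := by
    have hd := P.d_ge
    calc 1280 * ι * ((h : ℝ) ^ 2 * du ^ 2) = (h : ℝ) ^ 2 * du * (1280 * (ι * du)) := by ring
      _ ≤ (h : ℝ) ^ 2 * d * θ :=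
          mul_le_mul (mul_le_mul_of_nonneg_left P.du_le (by positivity)) hlin (by positivity)
            (by positivity)
      _ = (h : ℝ) ^ 2 * θ * d := by ring
  linarith

theorem gain_sq_le : 100 * a ^ 2 ≤ θ := by
  have h2 := P.large_r
  have ha := P.a_ge
  have h3 := pow_le_pow_left₀ (by linarith) P.a_le 2
  have h4 : 4 / 9 ≤ ι ^ 2 := by have := P.ι_ge; nlinarith
  have h5 : 0 ≤ r ^ 2 := by positivity
  have h6 := mul_le_mul_of_nonneg_left h4 h5
  linarith

theorem noise_error_le {n : ℝ} (hn : (h : ℝ) ^ 2 * θ * d - h ≤ n) :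
    √h * (Rn * √(2 * (10 * ι) * (h * du) / n)) ≤ 13 / 2 * √(Rn ^ 2 * ι / θ) := by
  have hn' := P.exploration_length_sub_ge hn
  have h1 := P.one_le_h; have hdu := P.du_ge; have hι := P.ι_pos; have hRn := P.Rn_ge
  have hθ := P.θ_ge; have hd := P.d_ge
  have hθ0 : 0 < θ := by linarith
  have hn0 : 0 < n := lt_of_lt_of_le (by positivity) hn'
  refine le_of_sq_le_sq ?_ (by positivity)
  rw [mul_pow, mul_pow, mul_pow, Real.sq_sqrt (by positivity), Real.sq_sqrt (by positivity),
    Real.sq_sqrt (by positivity)]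
  have h2 : (h : ℝ) * (2 * (10 * ι) * (h * du) / n) ≤ 40 * (ι / θ) := by
    rw [← mul_div_assoc, ← mul_div_assoc, div_le_div_iff₀ hn0 hθ0]
    have h2 := mul_le_mul_of_nonneg_left hn' (show 0 ≤ 40 * ι by positivity)
    have h3 : (h : ℝ) ^ 2 * θ * du ≤ (h : ℝ) ^ 2 * θ * d :=
      mul_le_mul_of_nonneg_left P.du_le (by positivity)
    have h4 := mul_le_mul_of_nonneg_left h3 (show 0 ≤ 20 * ι by positivity)
    linarith
  have h5 : 0 ≤ ι / θ := by positivity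
  calc (h : ℝ) * (Rn ^ 2 * (2 * (10 * ι) * (h * du) / n))
      = Rn ^ 2 * ((h : ℝ) * (2 * (10 * ι) * (h * du) / n)) := by ring
    _ ≤ Rn ^ 2 * (40 * (ι / θ)) := mul_le_mul_of_nonneg_left h2 (by positivity)
    _ ≤ Rn ^ 2 * ((13 / 2) ^ 2 * (ι / θ)) :=
        mul_le_mul_of_nonneg_left (mul_le_mul_of_nonneg_right (by norm_num) h5) (by positivity)
    _ = _ := by ring

/-- The error of the estimated Markov operator. -/
theorem estimation_error_le {n τ : ℝ} (hn : (h : ℝ) ^ 2 * θ * d - h ≤ n) (hτ0 : 0 ≤ τ)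
    (hτ : τ ≤ a / θ ^ 2) (hε0 : 0 ≤ ε) (hε : ε ^ 2 = 784 * (Rn ^ 2 * ι / θ))
    (hb : b ^ 2 = 2 * du + 40 * ι) :
    √h * (4 * (Rn * √(2 * (10 * ι) * (h * du) / n)) + 2 * (τ * b)) + τ ≤ ε := by
  have hn' := P.exploration_length_sub_ge hn
  have h1 := P.one_le_h; have hdu := P.du_ge; have hι := P.ι_pos; have hRn := P.Rn_ge
  have hθ := P.θ_ge; have ha := P.a_ge; have hd := P.d_ge
  have hθ0 : 0 < θ := by linarith
  have hn0 : 0 < n := lt_of_lt_of_le (by positivity) hn'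
  set w := √(Rn ^ 2 * ι / θ) with hw
  have hw0 : 0 ≤ w := Real.sqrt_nonneg _
  have hw2 : w ^ 2 = Rn ^ 2 * ι / θ := Real.sq_sqrt (by positivity)
  -- The constant is `28 = 4 * 13 / 2 + 1 + 1`: the noise term with `13 / 2 > √40`, then one unit
  -- for each of the two tail terms.
  have hεw : ε = 28 * w := by
    refine (sq_eq_sq₀ hε0 (by positivity)).1 ?_
    rw [hε, mul_pow, hw2]; norm_num
  have hA : √h * (Rn * √(2 * (10 * ι) * (h * du) / n)) ≤ 13 / 2 * w := P.noise_error_le hn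
  have hiv : 1 / θ ≤ w ^ 2 * (3 / 2) := by
    rw [hw2, div_mul_eq_mul_div]
    refine div_le_div_of_nonneg_right ?_ hθ0.le
    have := P.ι_ge
    have := one_le_pow₀ hRn (n := 2)
    nlinarith
  have hτw : τ * θ ≤ w := by
    refine le_of_sq_le_sq ?_ hw0
    have h2 : τ * θ ≤ a / θ := by
      refine (mul_le_mul_of_nonneg_right hτ hθ0.le).trans (le_of_eq ?_)
      field_simp
    refine (pow_le_pow_left₀ (by positivity) h2 2).trans ?_
    have e : (a / θ) ^ 2 = a ^ 2 / θ * (1 / θ) := by ring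
    rw [e]
    have h3 : a ^ 2 / θ ≤ 2 / 3 := by
      rw [div_le_iff₀ hθ0]
      linarith [P.gain_sq_le]
    calc a ^ 2 / θ * (1 / θ) ≤ 2 / 3 * (w ^ 2 * (3 / 2)) := by gcongr
      _ = w ^ 2 := by ring
  have hbh : 2 * (√h * b) ≤ θ := by
    refine le_of_sq_le_sq ?_ hθ0.le
    rw [mul_pow, mul_pow, Real.sq_sqrt (by positivity), hb]
    have h2 := P.noise_sq_mul_le
    have h3 := P.large_h
    have h4 := P.noise_sq_ge
    have h5 := P.ι_ge
    have h6 : 2 * du + 40 * ι ≤ θ / 4 := by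
      have := mul_le_mul_of_nonneg_right h5 (show 0 ≤ 2 * du + 40 * ι by linarith)
      linarith
    have h7 : (h : ℝ) ≤ θ := P.h_le_θ
    calc (2 : ℝ) ^ 2 * (h * (2 * du + 40 * ι)) ≤ 2 ^ 2 * (θ * (θ / 4)) := by gcongr
      _ = θ ^ 2 := by ring
  have hB : √h * (2 * (τ * b)) ≤ w := by
    refine le_trans ?_ hτw
    calc √h * (2 * (τ * b)) = τ * (2 * (√h * b)) := by ring
      _ ≤ τ * θ := mul_le_mul_of_nonneg_left hbh hτ0
  have hC : τ ≤ w := (le_mul_of_one_le_right hτ0 (by linarith)).trans hτw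
  rw [hεw]
  calc √h * (4 * (Rn * √(2 * (10 * ι) * (h * du) / n)) + 2 * (τ * b)) + τ
      = 4 * (√h * (Rn * √(2 * (10 * ι) * (h * du) / n))) + √h * (2 * (τ * b)) + τ := by ring
    _ ≤ 28 * w := by linarith

end Regime

end Scalar

/-! ### Each contribution to the regret against one common monomial. -/

namespace Regime

variable {h : ℕ} {du d a r q κ Rn ι ℓ θ : ℝ} (P : Regime h du d a r q κ Rn ι ℓ θ)

include P

theorem pos : 0 < d ∧ 0 < a ∧ 0 < r ∧ 0 < q ∧ 0 < κ ∧ 0 < Rn ∧ 0 < ι ∧ 0 < ℓ ∧ 0 < θ :=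
  ⟨by linarith [P.d_ge], by linarith [P.a_ge], by linarith [P.r_ge], by linarith [P.q_ge],
    by linarith [P.κ_ge], by linarith [P.Rn_ge], P.ι_pos, by linarith [P.ℓ_ge],
    by linarith [P.θ_ge]⟩

/-- All base quantities except `ι`, `θ` and the loss factor are at least one and may be raised to
their largest exponents, so every contribution reduces to computing its own monomial. -/
theorem monomial_le {Y Λ : ℝ} (hY : 0 ≤ Y) (hYΛ : Y ≤ Λ) {i₁ i₃ i₄ i₅ i₆ i₇ i₈ : ℕ}
    (h₁ : i₁ ≤ 2) (h₃ : i₃ ≤ 4) (h₄ : i₄ ≤ 4) (h₅ : i₅ ≤ 2) (h₆ : i₆ ≤ 5)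
    (h₇ : i₇ ≤ 5) (h₈ : i₈ ≤ 3) :
    d ^ i₁ * θ * (a ^ i₃ * r ^ i₄ * q ^ i₅ * κ ^ i₆) * (Y * Rn ^ i₇) * ℓ ^ i₈ * ι
      ≤ d ^ 2 * θ * (a ^ 4 * r ^ 4 * q ^ 2 * κ ^ 5) * (Λ * Rn ^ 5) * ℓ ^ 3 * ι := by
  obtain ⟨p1, p3, p4, p5, p6, p7, p8, p9, p2⟩ := P.pos
  have e1 := pow_le_pow_right₀ P.d_ge h₁
  have e3 := pow_le_pow_right₀ P.a_ge h₃
  have e4 := pow_le_pow_right₀ P.r_ge h₄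
  have e5 := pow_le_pow_right₀ P.q_ge h₅
  have e6 := pow_le_pow_right₀ P.κ_ge h₆
  have e7 := pow_le_pow_right₀ P.Rn_ge h₇
  have e8 := pow_le_pow_right₀ P.ℓ_ge h₈
  have hΛ : 0 ≤ Λ := hY.trans hYΛ
  gcongr

variable {b ε α L Λ N : ℝ}

theorem crude_bound_sq_le (hb : b ^ 2 = 2 * du + 40 * ι) :
    (10 * (a * κ * r * Rn) + a * b) ^ 2 ≤ 400 * (a ^ 2 * κ ^ 2 * r ^ 2 * Rn ^ 2 * (d * ι)) := by
  obtain ⟨p1, p3, p4, p5, p6, p7, p8, p9, p2⟩ := P.pos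
  have h1 := P.noise_sq_le
  have hd := P.d_ge
  have hι := P.ι_ge
  have h2 : 1 ≤ κ ^ 2 * r ^ 2 * Rn ^ 2 := one_le_mul_of_one_le_of_one_le
    (one_le_mul_of_one_le_of_one_le (one_le_pow₀ P.κ_ge) (one_le_pow₀ P.r_ge))
    (one_le_pow₀ P.Rn_ge)
  have h3 : b ^ 2 ≤ κ ^ 2 * r ^ 2 * Rn ^ 2 * (43 * (d * ι)) := by
    rw [hb]
    refine h1.trans (le_mul_of_one_le_left (by positivity) h2)
  have h4 : 1 ≤ 3 / 2 * (d * ι) := by nlinarith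
  calc (10 * (a * κ * r * Rn) + a * b) ^ 2
      ≤ 2 * ((10 * (a * κ * r * Rn)) ^ 2 + (a * b) ^ 2) := add_sq_le
    _ = 200 * (a ^ 2 * (κ ^ 2 * r ^ 2 * Rn ^ 2)) * 1 + 2 * a ^ 2 * b ^ 2 := by ring
    _ ≤ 200 * (a ^ 2 * (κ ^ 2 * r ^ 2 * Rn ^ 2)) * (3 / 2 * (d * ι))
        + 2 * a ^ 2 * (κ ^ 2 * r ^ 2 * Rn ^ 2 * (43 * (d * ι))) := by gcongr
    _ = 386 * (a ^ 2 * κ ^ 2 * r ^ 2 * Rn ^ 2 * (d * ι)) := by ring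
    _ ≤ _ := by gcongr; norm_num

theorem exploration_length_le (hN : N ≤ (h : ℝ) ^ 2 * θ * d + 1) :
    N + h ≤ 75 / 4 * (q ^ 2 * ℓ ^ 2 * θ * d) := by
  obtain ⟨p1, p3, p4, p5, p6, p7, p8, p9, p2⟩ := P.pos
  have h1 := P.one_le_h
  have hd := P.d_ge
  have hθ : 1 ≤ θ := by linarith [P.θ_ge]
  have h2 := P.h_sq_le
  have h3 : (h : ℝ) ≤ (h : ℝ) ^ 2 * θ * d := by
    have : 1 ≤ (h : ℝ) * θ * d :=
      one_le_mul_of_one_le_of_one_le (one_le_mul_of_one_le_of_one_le h1 hθ) hd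
    nlinarith
  have h4 : (h : ℝ) ^ 2 * θ * d ≤ 25 / 4 * (q ^ 2 * ℓ ^ 2) * θ * d := by gcongr
  linarith

theorem exploration_term_le (hL : 0 ≤ L) (hLΛ : L ≤ Λ)
    (hN : N ≤ (h : ℝ) ^ 2 * θ * d + 1) (hb : b ^ 2 = 2 * du + 40 * ι) :
    (N + h) * (2 * L * (10 * (a * κ * r * Rn) + a * b) ^ 2)
      ≤ 15000 * (d ^ 2 * θ * (a ^ 4 * r ^ 4 * q ^ 2 * κ ^ 5) * (Λ * Rn ^ 5) * ℓ ^ 3 * ι) := by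
  obtain ⟨p1, p3, p4, p5, p6, p7, p8, p9, p2⟩ := P.pos
  have h1 := P.exploration_length_le hN
  have h2 := P.crude_bound_sq_le hb
  have h3 := P.monomial_le hL hLΛ (i₁ := 2) (i₃ := 2) (i₄ := 2) (i₅ := 2) (i₆ := 2) (i₇ := 2)
    (i₈ := 2) (by norm_num) (by norm_num) (by norm_num) (by norm_num) (by norm_num) (by norm_num)
    (by norm_num)
  calc _ ≤ 75 / 4 * (q ^ 2 * ℓ ^ 2 * θ * d)
        * (2 * L * (400 * (a ^ 2 * κ ^ 2 * r ^ 2 * Rn ^ 2 * (d * ι)))) := by gcongr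
    _ = 15000 * (d ^ 2 * θ * (a ^ 2 * r ^ 2 * q ^ 2 * κ ^ 2) * (L * Rn ^ 2) * ℓ ^ 2 * ι) := by ring
    _ ≤ _ := by gcongr

/-- Of `lam` only the summand `Rn ^ 2 ι θ` is needed: it divides `T = θ ^ 2` down to `θ`. -/
theorem gradient_term_le {m lam : ℝ} (hα : 0 < α) (hm : m = 3 * h)
    (hlam : lam = Rn ^ 2 * ι * θ + h * a ^ 2) :
    72 * θ ^ 2 * (L * (10 * (a * κ * r * Rn))) ^ 2 * (a ^ 2 * Rn ^ 2 * m * h) / (α * lam)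
      ≤ 400000 * (d ^ 2 * θ * (a ^ 4 * r ^ 4 * q ^ 2 * κ ^ 5) * (L ^ 2 / α * Rn ^ 5)
        * ℓ ^ 3 * ι) := by
  obtain ⟨p1, p3, p4, p5, p6, p7, p8, p9, p2⟩ := P.pos
  have h1 := P.h_sq_le
  have hι : 1 ≤ 9 / 4 * ι ^ 2 := by nlinarith [P.ι_ge]
  have hlam' : Rn ^ 2 * ι * θ ≤ lam := by
    rw [hlam]; have : 0 ≤ h * a ^ 2 := by positivity
    linarith
  have h3 := P.monomial_le (Y := L ^ 2 / α) (by positivity) le_rfl (i₁ := 0) (i₃ := 4) (i₄ := 2)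
    (i₅ := 2) (i₆ := 2) (i₇ := 2) (i₈ := 2) (by norm_num) (by norm_num) (by norm_num)
    (by norm_num) (by norm_num) (by norm_num) (by norm_num)
  rw [div_le_iff₀ (mul_pos hα (lt_of_lt_of_le (by positivity) hlam'))]
  calc 72 * θ ^ 2 * (L * (10 * (a * κ * r * Rn))) ^ 2 * (a ^ 2 * Rn ^ 2 * m * h)
      = 21600 * θ ^ 2 * L ^ 2 * (a ^ 4 * κ ^ 2 * r ^ 2 * Rn ^ 4) * (h : ℝ) ^ 2 * 1 := by
        rw [hm]; ring
    _ ≤ 21600 * θ ^ 2 * L ^ 2 * (a ^ 4 * κ ^ 2 * r ^ 2 * Rn ^ 4) * (25 / 4 * (q ^ 2 * ℓ ^ 2))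
        * (9 / 4 * ι ^ 2) := by gcongr
    _ = 303750 * (d ^ 0 * θ * (a ^ 4 * r ^ 2 * q ^ 2 * κ ^ 2) * (L ^ 2 / α * Rn ^ 2) * ℓ ^ 2 * ι)
        * (α * (Rn ^ 2 * ι * θ)) := by
        field_simp; ring
    _ ≤ 400000 * (d ^ 2 * θ * (a ^ 4 * r ^ 4 * q ^ 2 * κ ^ 5) * (L ^ 2 / α * Rn ^ 5) * ℓ ^ 3 * ι)
        * (α * lam) := by
        gcongr
        norm_num

theorem diameter_term_le {dy lam : ℝ} (hα : 0 ≤ α) (hαΛ : α ≤ Λ) (hdy0 : 0 ≤ dy) (hdy : dy ≤ d)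
    (hlam : lam = Rn ^ 2 * ι * θ + h * a ^ 2) :
    α * lam * (dy * (2 * (κ * r)) ^ 2)
      ≤ 10 * (d ^ 2 * θ * (a ^ 4 * r ^ 4 * q ^ 2 * κ ^ 5) * (Λ * Rn ^ 5) * ℓ ^ 3 * ι) := by
  obtain ⟨p1, p3, p4, p5, p6, p7, p8, p9, p2⟩ := P.pos
  have h1 := P.h_le_θ
  have ha2 := one_le_pow₀ P.a_ge (n := 2)
  have hR2 := one_le_pow₀ P.Rn_ge (n := 2)
  have hlam' : lam ≤ 5 / 2 * (a ^ 2 * Rn ^ 2 * ι * θ) := by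
    have e1 : Rn ^ 2 * ι * θ ≤ a ^ 2 * (Rn ^ 2 * ι * θ) :=
      le_mul_of_one_le_left (by positivity) ha2
    have e2 : h * a ^ 2 ≤ 3 / 2 * (a ^ 2 * Rn ^ 2 * ι * θ) := by
      have e3 : 1 ≤ 3 / 2 * (Rn ^ 2 * ι) := by nlinarith [P.ι_ge]
      calc h * a ^ 2 ≤ θ * a ^ 2 * 1 := by rw [mul_one]; gcongr
        _ ≤ θ * a ^ 2 * (3 / 2 * (Rn ^ 2 * ι)) := by gcongr
        _ = _ := by ring
    rw [hlam]; linarith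
  have h3 := P.monomial_le hα hαΛ (i₁ := 1) (i₃ := 2) (i₄ := 2)
    (i₅ := 0) (i₆ := 2) (i₇ := 2) (i₈ := 0) (by norm_num) (by norm_num) (by norm_num)
    (by norm_num) (by norm_num) (by norm_num) (by norm_num)
  calc α * lam * (dy * (2 * (κ * r)) ^ 2)
      ≤ α * (5 / 2 * (a ^ 2 * Rn ^ 2 * ι * θ)) * (d * (2 * (κ * r)) ^ 2) := by gcongr
    _ = 10 * (d ^ 1 * θ * (a ^ 2 * r ^ 2 * q ^ 0 * κ ^ 2) * (α * Rn ^ 2) * ℓ ^ 0 * ι) := by ring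
    _ ≤ _ := by gcongr

theorem first_order_gain_le (hε : ε ^ 2 = 784 * (Rn ^ 2 * ι / θ)) :
    2 * ε ^ 2 * (1 + (a * (2 * r)) ^ 2) * κ ^ 2
      ≤ 7840 * (Rn ^ 2 * ι / θ) * (a ^ 2 * r ^ 2 * κ ^ 2) := by
  obtain ⟨p1, p3, p4, p5, p6, p7, p8, p9, p2⟩ := P.pos
  have : 1 ≤ a ^ 2 * r ^ 2 :=
    one_le_mul_of_one_le_of_one_le (one_le_pow₀ P.a_ge) (one_le_pow₀ P.r_ge)
  calc 2 * ε ^ 2 * (1 + (a * (2 * r)) ^ 2) * κ ^ 2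
      ≤ 2 * ε ^ 2 * (a ^ 2 * r ^ 2 + (a * (2 * r)) ^ 2) * κ ^ 2 := by gcongr
    _ = _ := by rw [hε]; ring

/-- Here `T` times the squared estimation error becomes `√T`, because `ε ^ 2` is of order `1 / θ`.
-/
theorem first_order_term_le (hα : 0 < α) :
    θ ^ 2 * (L * (10 * (a * κ * r * Rn))) ^ 2
      * (7840 * (Rn ^ 2 * ι / θ) * (a ^ 2 * r ^ 2 * κ ^ 2) / α)
      ≤ 784000 * (d ^ 2 * θ * (a ^ 4 * r ^ 4 * q ^ 2 * κ ^ 5) * (L ^ 2 / α * Rn ^ 5)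
        * ℓ ^ 3 * ι) := by
  obtain ⟨p1, p3, p4, p5, p6, p7, p8, p9, p2⟩ := P.pos
  have h3 := P.monomial_le (Y := L ^ 2 / α) (by positivity) le_rfl (i₁ := 0) (i₃ := 4) (i₄ := 4)
    (i₅ := 0) (i₆ := 4) (i₇ := 4) (i₈ := 0) (by norm_num) (by norm_num) (by norm_num)
    (by norm_num) (by norm_num) (by norm_num) (by norm_num)
  calc _ = 784000 * (d ^ 0 * θ * (a ^ 4 * r ^ 4 * q ^ 0 * κ ^ 4) * (L ^ 2 / α * Rn ^ 4)
        * ℓ ^ 0 * ι) := by field_simp; ring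
    _ ≤ _ := by gcongr

theorem exploration_input_term_le (hα : 0 ≤ α) (hαΛ : α ≤ Λ)
    (hN : N ≤ (h : ℝ) ^ 2 * θ * d + 1) (hb : b ^ 2 = 2 * du + 40 * ι) :
    α / 4 * (N * (b + 2 * (2 * (κ * r) * (2 * Rn))) ^ 2)
      ≤ 2000 * (d ^ 2 * θ * (a ^ 4 * r ^ 4 * q ^ 2 * κ ^ 5) * (Λ * Rn ^ 5) * ℓ ^ 3 * ι) := by
  obtain ⟨p1, p3, p4, p5, p6, p7, p8, p9, p2⟩ := P.pos
  have hN' : N ≤ 75 / 4 * (q ^ 2 * ℓ ^ 2 * θ * d) := by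
    linarith [P.exploration_length_le hN, P.one_le_h]
  have h4 : 1 ≤ 3 / 2 * (d * ι) := by nlinarith [P.d_ge, P.ι_ge]
  have h2 : 1 ≤ κ ^ 2 * r ^ 2 * Rn ^ 2 := one_le_mul_of_one_le_of_one_le
    (one_le_mul_of_one_le_of_one_le (one_le_pow₀ P.κ_ge) (one_le_pow₀ P.r_ge))
    (one_le_pow₀ P.Rn_ge)
  have hsq : (b + 2 * (2 * (κ * r) * (2 * Rn))) ^ 2
      ≤ 278 * (κ ^ 2 * r ^ 2 * Rn ^ 2 * (d * ι)) := by
    calc _ ≤ 2 * (b ^ 2 + (2 * (2 * (κ * r) * (2 * Rn))) ^ 2) := add_sq_le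
      _ = 2 * (2 * du + 40 * ι) + 128 * (κ ^ 2 * r ^ 2 * Rn ^ 2) * 1 := by rw [hb]; ring
      _ ≤ κ ^ 2 * r ^ 2 * Rn ^ 2 * (2 * (43 * (d * ι)))
          + 128 * (κ ^ 2 * r ^ 2 * Rn ^ 2) * (3 / 2 * (d * ι)) := by
          refine add_le_add ?_ (by gcongr)
          refine le_trans ?_ (le_mul_of_one_le_left (by positivity) h2)
          linarith [P.noise_sq_le]
      _ = _ := by ring
  have h3 := P.monomial_le hα hαΛ (i₁ := 2) (i₃ := 0) (i₄ := 2)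
    (i₅ := 2) (i₆ := 2) (i₇ := 2) (i₈ := 2) (by norm_num) (by norm_num) (by norm_num)
    (by norm_num) (by norm_num) (by norm_num) (by norm_num)
  calc _ ≤ α / 4 * (75 / 4 * (q ^ 2 * ℓ ^ 2 * θ * d)
        * (278 * (κ ^ 2 * r ^ 2 * Rn ^ 2 * (d * ι)))) := by gcongr
    _ = 10425 / 8 * (d ^ 2 * θ * (a ^ 0 * r ^ 2 * q ^ 2 * κ ^ 2) * (α * Rn ^ 2) * ℓ ^ 2 * ι) := by
        ring
    _ ≤ _ := by gcongr; norm_num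

theorem second_order_term_le (hL : 0 ≤ L) (hLΛ : L ≤ Λ) (hε : ε ^ 2 = 784 * (Rn ^ 2 * ι / θ))
    (hb0 : 0 ≤ b) (hb : b ^ 2 = 2 * du + 40 * ι) :
    θ ^ 2 * (L * (10 * (a * κ * r * Rn)) * (a * (2 * r * (ε * (2 * r * (ε * (κ * r * (2 * Rn)))))
      + 2 * r * (a / θ ^ 2 * (b + 2 * (κ * r) * (2 * Rn))) + r / θ ^ 2 * Rn)))
      ≤ 64000 * (d ^ 2 * θ * (a ^ 4 * r ^ 4 * q ^ 2 * κ ^ 5) * (Λ * Rn ^ 5) * ℓ ^ 3 * ι) := by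
  obtain ⟨p1, p3, p4, p5, p6, p7, p8, p9, p2⟩ := P.pos
  have h4 : 1 ≤ 3 / 2 * (d * ι) := by nlinarith [P.d_ge, P.ι_ge]
  have hθ : 1 ≤ θ := by linarith [P.θ_ge]
  have h2 : 1 ≤ κ * r * Rn := one_le_mul_of_one_le_of_one_le
    (one_le_mul_of_one_le_of_one_le P.κ_ge P.r_ge) P.Rn_ge
  have hb1 : b ≤ κ * r * Rn * (43 * (d * ι)) := by
    have : b ≤ b ^ 2 := by
      have : 1 ≤ b := by
        by_contra hc
        have := P.noise_sq_ge
        nlinarith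
      nlinarith
    refine (this.trans (hb.le.trans P.noise_sq_le)).trans
      (le_mul_of_one_le_left (by positivity) h2)
  have hU : b + 2 * (κ * r) * (2 * Rn) ≤ 49 * (κ * r * Rn * (d * ι)) := by
    have : κ * r * Rn * 1 ≤ κ * r * Rn * (3 / 2 * (d * ι)) := by gcongr
    linarith
  have e : θ ^ 2 * (L * (10 * (a * κ * r * Rn)) * (a * (2 * r * (ε * (2 * r
        * (ε * (κ * r * (2 * Rn)))))
      + 2 * r * (a / θ ^ 2 * (b + 2 * (κ * r) * (2 * Rn))) + r / θ ^ 2 * Rn)))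
      = 62720 * (d ^ 0 * θ * (a ^ 2 * r ^ 4 * q ^ 0 * κ ^ 2) * (L * Rn ^ 4) * ℓ ^ 0 * ι)
        + 20 * (L * a ^ 3 * κ * r ^ 2 * Rn * (b + 2 * (κ * r) * (2 * Rn)))
        + 10 * (L * a ^ 2 * κ * r ^ 2 * Rn ^ 2) := by
    have : θ ^ 2 * (L * (10 * (a * κ * r * Rn)) * (a * (2 * r * (ε * (2 * r
        * (ε * (κ * r * (2 * Rn)))))
      + 2 * r * (a / θ ^ 2 * (b + 2 * (κ * r) * (2 * Rn))) + r / θ ^ 2 * Rn)))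
      = 80 * (θ ^ 2 * ε ^ 2) * (L * a ^ 2 * κ ^ 2 * r ^ 4 * Rn ^ 2)
        + 20 * (L * a ^ 3 * κ * r ^ 2 * Rn * (b + 2 * (κ * r) * (2 * Rn)))
        + 10 * (L * a ^ 2 * κ * r ^ 2 * Rn ^ 2) := by
      field_simp
      ring
    rw [this, hε]
    field_simp
    ring
  have t1 := P.monomial_le hL hLΛ (i₁ := 0) (i₃ := 2) (i₄ := 4)
    (i₅ := 0) (i₆ := 2) (i₇ := 4) (i₈ := 0) (by norm_num) (by norm_num) (by norm_num)
    (by norm_num) (by norm_num) (by norm_num) (by norm_num)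
  have t2 := P.monomial_le hL hLΛ (i₁ := 1) (i₃ := 3) (i₄ := 3)
    (i₅ := 0) (i₆ := 2) (i₇ := 2) (i₈ := 0) (by norm_num) (by norm_num) (by norm_num)
    (by norm_num) (by norm_num) (by norm_num) (by norm_num)
  have t3 := P.monomial_le hL hLΛ (i₁ := 1) (i₃ := 2) (i₄ := 2)
    (i₅ := 0) (i₆ := 1) (i₇ := 2) (i₈ := 0) (by norm_num) (by norm_num) (by norm_num)
    (by norm_num) (by norm_num) (by norm_num) (by norm_num)
  have s2 : 20 * (L * a ^ 3 * κ * r ^ 2 * Rn * (b + 2 * (κ * r) * (2 * Rn)))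
      ≤ 980 * (d ^ 1 * θ * (a ^ 3 * r ^ 3 * q ^ 0 * κ ^ 2) * (L * Rn ^ 2) * ℓ ^ 0 * ι) := by
    calc _ ≤ 20 * (L * a ^ 3 * κ * r ^ 2 * Rn * (49 * (κ * r * Rn * (d * ι)))) := by gcongr
      _ = 980 * (d ^ 1 * 1 * (a ^ 3 * r ^ 3 * q ^ 0 * κ ^ 2) * (L * Rn ^ 2) * ℓ ^ 0 * ι) := by ring
      _ ≤ _ := by gcongr
  have s3 : 10 * (L * a ^ 2 * κ * r ^ 2 * Rn ^ 2)
      ≤ 15 * (d ^ 1 * θ * (a ^ 2 * r ^ 2 * q ^ 0 * κ ^ 1) * (L * Rn ^ 2) * ℓ ^ 0 * ι) := by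
    calc _ = 10 * (L * a ^ 2 * κ * r ^ 2 * Rn ^ 2) * 1 := by ring
      _ ≤ 10 * (L * a ^ 2 * κ * r ^ 2 * Rn ^ 2) * (3 / 2 * (d * ι)) := by gcongr
      _ = 15 * (d ^ 1 * 1 * (a ^ 2 * r ^ 2 * q ^ 0 * κ ^ 1) * (L * Rn ^ 2) * ℓ ^ 0 * ι) := by ring
      _ ≤ _ := by gcongr
  rw [e]
  have hΛ : 0 ≤ Λ := hL.trans hLΛ
  have hW : 0 ≤ d ^ 2 * θ * (a ^ 4 * r ^ 4 * q ^ 2 * κ ^ 5) * (Λ * Rn ^ 5) * ℓ ^ 3 * ι := by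
    positivity
  linarith

end Regime

/-! ### Regret of a run -/

section Policy

variable {dx dy du : ℕ} {E : Environment dx dy du} {K : Matrix (Fin du) (Fin dy) ℝ}
  {h m N T : ℕ} {R Rn b a lam α L r q ι ℓ θ ε : ℝ} {uex : ℕ → Fin du → ℝ}
  {Gv : ℕ → Matrix (Fin dy ⊕ Fin du) (Fin du) ℝ} {Gη : ℕ → Matrix (Fin dy) (Fin du) ℝ}
  {yhat : ℕ → Fin dy → ℝ} {z : ℕ → DrcVec m dy du} {π : LDC dy du}

theorem ControlPhase.sum_loss_sub_policy_le
    (P : ControlPhase E K h m N T R Rn b a lam (3 / α) uex Gv Gη yhat z) (hm : m = 3 * h)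
    (Q : Regime h du (dy + du) a r q (1 + opNorm K) Rn ι ℓ θ) (hθ : (T : ℝ) = θ ^ 2)
    (hR : R = 2 * ((1 + opNorm K) * r)) (hlam : lam = Rn ^ 2 * ι * θ + h * a ^ 2)
    (hα : 0 < α) (hloss : ∀ t, RegularLoss α L (E.loss t)) (hNT : N ≤ T)
    (hN : (N : ℝ) ≤ (h : ℝ) ^ 2 * θ * (dy + du) + 1) (hb : b ^ 2 = 2 * du + 40 * ι)
    (hε0 : 0 ≤ ε) (hε : ε ^ 2 = 784 * (Rn ^ 2 * ι / θ))
    (hest : ∀ n, ∑ i ∈ Finset.range n,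
      opNorm (feedbackLift K * (E.outputMarkov K i - Gη i)) ≤ ε)
    (htail : ∀ n, ∑ i ∈ Finset.range n, opNorm (feedbackLift K * ((E.outputMarkov K i - Gη i)
      - truncKernel (h + 1) (fun i => E.outputMarkov K i - Gη i) i)) ≤ a / θ ^ 2)
    (hπ₁ : ∀ n, ∑ i ∈ Finset.range n, opNorm (π.exKernel E K i) ≤ 2 * r)
    (hπ₂ : ∀ n, ∑ i ∈ Finset.range n, opNorm (π.exKernel E K i * feedbackLift K)
      ≤ (1 + opNorm K) * r)
    (hπ₃ : ∀ n, ∑ i ∈ Finset.range n,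
      opNorm (π.exKernel E K i - truncKernel h (π.exKernel E K) i) ≤ r / θ ^ 2) :
    ∑ t ∈ Finset.range T, (E.loss t (E.signal K uex t) - E.loss t (π.signal E t))
      ≤ 2000000 * ((dy + du) ^ 2 * θ * (a ^ 4 * r ^ 4 * q ^ 2 * (1 + opNorm K) ^ 5)
        * (L ^ 2 / α * Rn ^ 5) * ℓ ^ 3 * ι) := by
  subst hm
  set κ := 1 + opNorm K with hκ
  obtain ⟨p1, p3, p4, p5, p6, p7, p8, p9, p2⟩ := Q.pos
  have hL : 0 ≤ L := (hloss 0).nonneg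
  have hαL : α ≤ L := by
    refine (hloss 0).le ?_
    have := Q.du_ge
    have : 0 < du := by exact_mod_cast (by linarith : (0 : ℝ) < du)
    omega
  have hLΛ : L ≤ L ^ 2 / α := by
    rw [le_div_iff₀ hα, sq]
    exact mul_le_mul_of_nonneg_left hαL hL
  set V := 10 * (a * κ * r * Rn) with hVdef
  have hκr : 1 ≤ κ * r := one_le_mul_of_one_le_of_one_le Q.κ_ge Q.r_ge
  have hakr : 1 ≤ a * κ * r := by
    rw [mul_assoc]; exact one_le_mul_of_one_le_of_one_le Q.a_ge hκr
  have hRnle : Rn ≤ a * κ * r * Rn := le_mul_of_one_le_left (by linarith) hakr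
  have hV : 2 * Rn + 2 * a * (R * (2 * Rn)) ≤ V := by
    rw [hR, hVdef]
    linarith
  have hV1 : 1 ≤ V := by rw [hVdef]; linarith [Q.Rn_ge]
  have hb0 := P.b_nonneg
  have hlam0 : 0 < lam := by
    rw [hlam]; have : 0 ≤ h * a ^ 2 := by positivity
    have : 0 < Rn ^ 2 * ι * θ := by positivity
    linarith
  have hsmall := Q.error_le hε0 hε
  set Mk := comparatorKernel E K h Gη π with hMk
  have hMk0 : ∀ i, 3 * h ≤ i → Mk i = 0 := fun i hi =>
    comparatorKernel_eq_zero (by have := Q.h_ge; omega) π hi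
  have hq : drcVecOf (3 * h) Mk ∈ drcSet (3 * h) dy du R := by
    refine comparator_mem_drcSet (by have := Q.h_ge; omega) hπ₁ hπ₂ hest ?_
    rw [hR]
    have : 0 ≤ κ * r := by positivity
    nlinarith
  have hembed : ∀ s, drcEmbed (3 * h) yhat s *ᵥ drcVecOf (3 * h) Mk = conv Mk yhat s := by
    intro s; rw [drcEmbed_mulVec, drcKernel_drcVecOf hMk0]
  have hmem : ∀ t, memoryMatrix h (3 * h) Gv yhat t *ᵥ drcVecOf (3 * h) Mk
      = conv Gv (conv Mk yhat) t := by
    intro t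
    rw [memoryMatrix_mulVec P.Gv_zero]
    congr 1
    exact funext hembed
  have hfirst := sum_firstOrderError_sq_le (h := h) T hπ₁ hest P.markov_sum (conv Mk yhat - uex)
  have hA0 : 0 < 7840 * (Rn ^ 2 * ι / θ) * (a ^ 2 * r ^ 2 * κ ^ 2) / α := by positivity
  have hmain := P.sum_loss_sub_le hα hL hV1 hlam0 hV hloss hq hNT Q.h_ge
    (v := fun t => (π.signal E t).ofLp)
    (E₁ := firstOrderError E K h Gη π (conv Mk yhat - uex))
    (E₂ := secondOrderError E K h Gη π yhat uex)
    (Γ := 2 * ε ^ 2 * (1 + (a * (2 * r)) ^ 2))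
    -- An upper bound for `Γ κ ^ 2 / α`, as small as absorption into the curvature sum permits.
    (A := 7840 * (Rn ^ 2 * ι / θ) * (a ^ 2 * r ^ 2 * κ ^ 2) / α)
    (e₂ := a * (2 * r * (ε * (2 * r * (ε * (κ * r * (2 * Rn)))))
      + 2 * r * (a / θ ^ 2 * (b + 2 * (κ * r) * (2 * Rn))) + r / θ ^ 2 * Rn))
    -- The crude radius adds to `V` the response of the plant to exploration noise.
    (V' := V + a * b) ?_ (by positivity) hA0 ?_ ?_ ?_ (by positivity)
    (by linarith [mul_nonneg p3.le hb0]) ?_ ?_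
  · refine hmain.trans ?_
    have t1 := Q.exploration_term_le hL hLΛ hN hb
    have t2 := Q.gradient_term_le (m := ((3 * h : ℕ) : ℝ)) (L := L) hα (by push_cast; ring) hlam
    have t3 := Q.diameter_term_le (dy := (dy : ℝ)) hα.le (hαL.trans hLΛ) (Nat.cast_nonneg _)
      (by linarith [Nat.cast_nonneg (α := ℝ) du]) hlam
    have t4 := Q.first_order_term_le (L := L) hα
    have t5 := Q.exploration_input_term_le hα.le (hαL.trans hLΛ) hN hb
    have t6 := Q.second_order_term_le hL hLΛ hε hb0 hb
    have hW : 0 ≤ ((dy : ℝ) + du) ^ 2 * θ * (a ^ 4 * r ^ 4 * q ^ 2 * κ ^ 5)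
        * (L ^ 2 / α * Rn ^ 5) * ℓ ^ 3 * ι := by positivity
    rw [hθ, hR, Nat.cast_add]
    linarith
  · intro t
    rw [hmem]
    exact comparator_identity P.lift π P.yhat_eq rfl t
  · rw [mul_div_cancel₀ _ hα.ne']
    exact Q.first_order_gain_le hε
  · refine hfirst.trans (le_of_eq ?_)
    simp only [hembed, Pi.sub_apply]
  · intro t ht
    refine euclNorm_secondOrderError_le ht hπ₁ hπ₂ hest htail hπ₃ P.markov_sum
      (fun s hs => P.yhat_le' hs) (fun s hs => ?_) P.nature
    rw [← hR]
    exact P.input_le_add hs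
  · intro t ht
    refine (euclNorm_signal_le P.markov_sum P.nature (fun s hs => P.input_le_add hs) ht).trans ?_
    rw [hR]
    linarith
  · intro t _
    rw [euclNorm_ofLp]
    refine (LDC.norm_signal_le P.markov_sum hπ₁ P.nature t).trans ?_
    have h1 : a * (2 * r * Rn) ≤ 2 * (a * κ * r * Rn) := by
      have := le_mul_of_one_le_right (show 0 ≤ a * r * Rn by positivity) Q.κ_ge
      linarith
    linarith [mul_nonneg p3.le hb0]

/-- The regret when the horizon does not exceed the exploration phase. -/
theorem sum_loss_sub_policy_le_of_le
    (Q : Regime h du (dy + du) a r q (1 + opNorm K) Rn ι ℓ θ)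
    (hα : 0 < α) (hloss : ∀ t, RegularLoss α L (E.loss t)) (hTN : T ≤ N)
    (hN : (N : ℝ) ≤ (h : ℝ) ^ 2 * θ * (dy + du) + 1) (hb0 : 0 ≤ b)
    (hb : b ^ 2 = 2 * du + 40 * ι) (hu : ∀ t < T, euclNorm (uex t) ≤ b)
    (ha : ∀ n, ∑ i ∈ Finset.range n, opNorm (E.markov K i) ≤ a)
    (hnat : ∀ t, ‖E.natureSignal K t‖ ≤ Rn)
    (hπ₁ : ∀ n, ∑ i ∈ Finset.range n, opNorm (π.exKernel E K i) ≤ 2 * r) :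
    ∑ t ∈ Finset.range T, (E.loss t (E.signal K uex t) - E.loss t (π.signal E t))
      ≤ 2000000 * ((dy + du) ^ 2 * θ * (a ^ 4 * r ^ 4 * q ^ 2 * (1 + opNorm K) ^ 5)
        * (L ^ 2 / α * Rn ^ 5) * ℓ ^ 3 * ι) := by
  set κ := 1 + opNorm K with hκ
  obtain ⟨p1, p3, p4, p5, p6, p7, p8, p9, p2⟩ := Q.pos
  have hL : 0 ≤ L := (hloss 0).nonneg
  have hαL : α ≤ L := by
    refine (hloss 0).le ?_
    have := Q.du_ge
    have : 0 < du := by exact_mod_cast (by linarith : (0 : ℝ) < du)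
    omega
  have hLΛ : L ≤ L ^ 2 / α := by
    rw [le_div_iff₀ hα, sq]
    exact mul_le_mul_of_nonneg_left hαL hL
  set V := 10 * (a * κ * r * Rn) + a * b with hVdef
  have hκr : 1 ≤ κ * r := one_le_mul_of_one_le_of_one_le Q.κ_ge Q.r_ge
  have hakr : 1 ≤ a * κ * r := by
    rw [mul_assoc]; exact one_le_mul_of_one_le_of_one_le Q.a_ge hκr
  have hRnle : Rn ≤ a * κ * r * Rn := le_mul_of_one_le_left (by linarith) hakr
  have hab := mul_nonneg p3.le hb0
  have hV1 : 1 ≤ V := by rw [hVdef]; linarith [Q.Rn_ge]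
  have hb' : ∀ t (x : Signal dy du), ‖x‖ ≤ V → |E.loss t x| ≤ L * V ^ 2 := by
    intro t x hx
    refine ((hloss t).abs_le x).trans (mul_le_mul_of_nonneg_left (max_le ?_ ?_) hL)
    · exact one_le_pow₀ hV1
    · exact pow_le_pow_left₀ (norm_nonneg _) hx 2
  have hround : ∀ t ∈ Finset.range T, E.loss t (E.signal K uex t) - E.loss t (π.signal E t)
      ≤ 2 * L * V ^ 2 := by
    intro t ht
    have h1 := (abs_le.1 (hb' t (E.signal K uex t) ((euclNorm_signal_le ha hnat hu
      (Finset.mem_range.1 ht)).trans (by linarith)))).2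
    have h2 := (abs_le.1 (hb' t (π.signal E t) ((LDC.norm_signal_le ha hπ₁ hnat t).trans (by
      have h1 : a * (2 * r * Rn) ≤ 2 * (a * κ * r * Rn) := by
        have := le_mul_of_one_le_right (show 0 ≤ a * r * Rn by positivity) Q.κ_ge
        linarith
      linarith)))).1
    linarith
  refine (Finset.sum_le_card_nsmul _ _ _ hround).trans ?_
  rw [Finset.card_range, nsmul_eq_mul]
  have t1 := Q.exploration_term_le hL hLΛ hN hb
  have hT : (T : ℝ) ≤ N + h := by
    have : (T : ℝ) ≤ N := by exact_mod_cast hTN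
    linarith [Nat.cast_nonneg (α := ℝ) h]
  have h2 : (T : ℝ) * (2 * L * V ^ 2) ≤ (N + h) * (2 * L * V ^ 2) := by gcongr
  have hW : 0 ≤ ((dy : ℝ) + du) ^ 2 * θ * (a ^ 4 * r ^ 4 * q ^ 2 * κ ^ 5)
      * (L ^ 2 / α * Rn ^ 5) * ℓ ^ 3 * ι := by positivity
  linarith

end Policy

/-! ### From a run to the bounds of its control phase. -/

section Run

variable {dx dy du : ℕ} {E : Environment dx dy du} {K : Matrix (Fin du) (Fin dy) ℝ}
  {p : DrcParams} {ξ : Fin p.N → Fin du → ℝ} {uex : ℕ → Fin du → ℝ}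
  {Gv : ℕ → Matrix (Fin dy ⊕ Fin du) (Fin du) ℝ} {Gη : ℕ → Matrix (Fin dy) (Fin du) ℝ}
  {z : ℕ → DrcVec p.m dy du} {T : ℕ} {Rn b a ε s c : ℝ}

theorem IsDrcOnsRun.uex_eq (run : IsDrcOnsRun E K p ξ uex Gv Gη z) {t : ℕ} (ht : t < p.N) :
    uex t = extendZero ξ t := by
  rw [extendZero, dif_pos ht]
  exact run.explore ⟨t, ht⟩

theorem IsDrcOnsRun.lift_eq (run : IsDrcOnsRun E K p ξ uex Gv Gη z)
    (hlift : ∀ i ∈ Finset.Icc 1 p.h, Gv i = feedbackLift K * Gη i) :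
    Gv = fun i => feedbackLift K * Gη i + if i = 0 then inputLift dy du else 0 := by
  funext i
  by_cases h0 : i = 0
  · rw [if_pos h0, h0, run.est_v.1, run.est_η.1, Matrix.mul_zero, zero_add, inputLift]
  rw [if_neg h0, add_zero]
  rcases le_or_gt i p.h with hi | hi
  · exact hlift i (Finset.mem_Icc.2 ⟨by omega, hi⟩)
  · rw [run.est_v.2.1 i hi, run.est_η.2.1 i hi, Matrix.mul_zero]

theorem IsDrcOnsRun.mem (run : IsDrcOnsRun E K p ξ uex Gv Gη z) (t : ℕ) (ht : p.N ≤ t) :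
    z t ∈ drcSet p.m dy du p.R := by
  induction t, ht using Nat.le_induction with
  | base => exact run.init
  | succ t ht _ => exact (run.update t ht).1

theorem IsDrcOnsRun.controlPhase (run : IsDrcOnsRun E K p ξ uex Gv Gη z)
    (hlift : ∀ i ∈ Finset.Icc 1 p.h, Gv i = feedbackLift K * Gη i)
    (ha : ∀ n, ∑ i ∈ Finset.range n, opNorm (E.markov K i) ≤ a)
    (hε : ∀ n, ∑ i ∈ Finset.range n,
      opNorm (feedbackLift K * (E.outputMarkov K i - Gη i)) ≤ ε)
    (hnat : ∀ t, ‖E.natureSignal K t‖ ≤ Rn) (hb0 : 0 ≤ b) (hR : 0 ≤ p.R)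
    (hb : ∀ t < p.N, t < T → euclNorm (uex t) ≤ b) (hRε : 2 * p.R * ε ≤ 1) (hεb : ε * b ≤ Rn)
    (hεa : ε ≤ a) :
    ControlPhase E K p.h p.m p.N T p.R Rn b a p.lam p.η uex Gv Gη
      (estResidual Gη (E.output K uex) uex) z := by
  have hl := run.lift_eq hlift
  have hRn : 0 ≤ Rn := (norm_nonneg _).trans (hnat 0)
  have hbd := control_phase_bounds (T := T) run.est_η.1 run.mem run.control (hε T)
    (fun t => by
      rw [← E.natureSignal_ofLp]
      exact hnat t) hb hRn hb0 hRε hεb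
  refine ⟨rfl, hl, run.est_v.2.1, ha, fun n => ?_, hnat, fun t ht => (hbd t ht).1,
    fun t ht => (hbd t ht).2, hb, hb0, hR, run.mem, run.control, fun t ht => ?_⟩
  · have e : ∀ i, Gv i = E.markov K i - feedbackLift K * (E.outputMarkov K i - Gη i) := by
      intro i
      rw [E.markov_eq, hl, Matrix.mul_sub]
      abel_nf
    calc _ ≤ ∑ i ∈ Finset.range n, (opNorm (E.markov K i)
          + opNorm (feedbackLift K * (E.outputMarkov K i - Gη i))) :=
          Finset.sum_le_sum fun i _ => by rw [e]; exact opNorm_sub_le _ _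
      _ ≤ a + ε := by rw [Finset.sum_add_distrib]; exact add_le_add (ha n) (hε n)
      _ ≤ 2 * a := by linarith
  · rw [← estResidual_signal_eq hl]
    exact run.update t ht

end Run

/-! ### High-probability regret bound -/

/-- `ρ ^ h ≤ exp (-(1 - ρ) h)`, and `h` is at least `log T / (1 - ρ)`. -/
theorem pow_mixing_le {ρ : ℝ} {h T : ℕ} (h0 : 0 < ρ) (h1 : ρ < 1) (hT : 2 ≤ T)
    (hh : h = ⌈(1 - ρ)⁻¹ * Real.log T⌉₊) : ρ ^ h ≤ 1 / T := by
  have hT0 : (0 : ℝ) < T := by positivity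
  have h2 : (1 - ρ)⁻¹ * Real.log T ≤ h := by rw [hh]; exact Nat.le_ceil _
  have h3 : Real.log T ≤ h * (1 - ρ) := by
    rw [inv_mul_le_iff₀ (by linarith)] at h2
    linarith
  have h4 : Real.log ρ ≤ -(1 - ρ) := by linarith [Real.log_le_sub_one_of_pos h0]
  rw [← Real.log_le_log_iff (by positivity) (by positivity), Real.log_pow, one_div, Real.log_inv]
  have := mul_le_mul_of_nonneg_left h4 (Nat.cast_nonneg (α := ℝ) h)
  linarith

theorem two_thirds_le_log_two : 2 / 3 ≤ Real.log 2 := by linarith [Real.log_two_gt_d9]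

theorem regime_of_large {dy du h T : ℕ} {cK ρK cs ρs κ Rn δ : ℝ} (hdu : 0 < du) (hcK : 1 ≤ cK)
    (hρK0 : 0 < ρK) (hcs : cK ≤ cs) (hρ : ρK ≤ ρs) (hρs : ρs < 1) (hκ : 1 ≤ κ) (hRn : 1 ≤ Rn)
    (hT : 2 ≤ T) (hδ0 : 0 < δ) (hδ : δ < 1 / (T : ℝ))
    (hlarge : 10 ^ 8 * Real.log T ^ 2 *
        ((1 - ρs)⁻¹ ^ 6 * cs ^ 4 * κ ^ 2 * Rn ^ 2 * Real.log (1 / δ) ^ 2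
          + (1 - ρs)⁻¹ ^ 2 * (du : ℝ) ^ 2) ≤ √(T : ℝ))
    (hh : h = ⌈(1 - ρs)⁻¹ * Real.log T⌉₊) :
    Regime h du ((dy : ℝ) + du) (cK / (1 - ρK)) (cs / (1 - ρs)) (1 - ρs)⁻¹ κ Rn
      (Real.log (1 / δ)) (Real.log (1 + T)) √(T : ℝ) := by
  have hs : 0 < 1 - ρs := by linarith
  have hk : 0 < 1 - ρK := by linarith
  have hT2 : (2 : ℝ) ≤ T := by exact_mod_cast hT
  have hlogT : 2 / 3 ≤ Real.log T :=
    two_thirds_le_log_two.trans (Real.log_le_log (by norm_num) hT2)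
  have hq : 1 ≤ (1 - ρs)⁻¹ := (one_le_inv₀ hs).2 (by linarith)
  have hqlog : 2 / 3 ≤ (1 - ρs)⁻¹ * Real.log T :=
    hlogT.trans (le_mul_of_one_le_left (by linarith) hq)
  have hhT : (h : ℝ) ≤ 5 / 2 * ((1 - ρs)⁻¹ * Real.log T) := by
    have := Nat.ceil_lt_add_one (show 0 ≤ (1 - ρs)⁻¹ * Real.log T by linarith)
    rw [← hh] at this
    linarith
  refine ⟨?_, by exact_mod_cast hdu, by linarith [Nat.cast_nonneg (α := ℝ) dy], ?_, ?_, hq, hκ,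
    hRn, ?_, ?_, ?_, ?_⟩
  · rw [hh]
    exact Nat.one_le_ceil_iff.2 (by linarith)
  · rw [one_le_div hk]; linarith
  · exact div_le_div₀ (by linarith) hcs hs (by linarith)
  · refine hlogT.trans (Real.log_le_log (by linarith) ?_)
    rw [le_div_iff₀ hδ0, mul_comm]
    exact ((lt_div_iff₀ (by linarith)).1 hδ).le
  · rw [Real.le_log_iff_exp_le (by linarith)]
    linarith [Real.exp_one_lt_d9]
  · refine hhT.trans ?_
    have : Real.log T ≤ Real.log (1 + T) := Real.log_le_log (by linarith) (by linarith)
    gcongr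
  · refine le_trans ?_ hlarge
    -- The ceiling costs a factor `5 / 2`, because its argument is at least `2 / 3`; hence `10 ^ 7 *
    -- 25 / 4 ≤ 10 ^ 8`.
    have h2 := pow_le_pow_left₀ (Nat.cast_nonneg _) hhT 2
    calc 10 ^ 7 * (h : ℝ) ^ 2 * ((cs / (1 - ρs)) ^ 4 * κ ^ 2 * Rn ^ 2 * Real.log (1 / δ) ^ 2
          + (du : ℝ) ^ 2)
        ≤ 10 ^ 7 * (5 / 2 * ((1 - ρs)⁻¹ * Real.log T)) ^ 2
          * ((cs / (1 - ρs)) ^ 4 * κ ^ 2 * Rn ^ 2 * Real.log (1 / δ) ^ 2 + (du : ℝ) ^ 2) := by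
          gcongr
      _ = (25 / 4 * 10 ^ 7) * Real.log T ^ 2 *
        ((1 - ρs)⁻¹ ^ 6 * cs ^ 4 * κ ^ 2 * Rn ^ 2 * Real.log (1 / δ) ^ 2
          + (1 - ρs)⁻¹ ^ 2 * (du : ℝ) ^ 2) := by
          rw [div_eq_mul_inv]; ring
      _ ≤ _ := by gcongr; norm_num

/-- The event depends on the noise and on nature's signals only, which are fixed in advance; it
therefore serves all runs and all benchmark policies at once. Good conditioning is claimed only for
`N < T`, the case in which the dimension is at most `√T` and the union bound is affordable. -/
theorem exists_exploration_event {dy du h N T : ℕ} {a r q κ Rn ℓ δ : ℝ}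
    (Q : Regime h du ((dy : ℝ) + du) a r q κ Rn (Real.log (1 / δ)) ℓ √(T : ℝ))
    (hT : 2 ≤ T) (hδ0 : 0 < δ) (hδ : δ < 1 / (T : ℝ))
    (hN : (h : ℝ) ^ 2 * √(T : ℝ) * ((dy : ℝ) + du) ≤ N) (o : ℕ → Fin dy ⊕ Fin du → ℝ) :
    ∃ S : Set (Fin N → Fin du → ℝ), MeasurableSet S ∧
      1 - δ ≤ (explorationLaw N du).real S ∧
      ∀ ξ ∈ S, (∀ t < N, t < T →
          euclNorm (extendZero ξ t) ^ 2 ≤ 2 * du + 40 * Real.log (1 / δ)) ∧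
        (N < T → GoodNoise h N (1 / (8 * (h * du))) (10 * Real.log (1 / δ)) o (extendZero ξ)) := by
  set ι := Real.log (1 / δ) with hι
  have hθ0 : 0 < √(T : ℝ) := by linarith [Q.θ_ge]
  have hθ2 : √(T : ℝ) ^ 2 = T := Real.sq_sqrt (Nat.cast_nonneg _)
  have hT2 : (2 : ℝ) ≤ T := by exact_mod_cast hT
  have hδT : δ * T < 1 := (lt_div_iff₀ (by linarith)).1 hδ
  have hδ2 : δ ≤ 1 / 2 := hδ.le.trans (by gcongr)
  have hexp : Real.exp (-(10 * ι)) = δ ^ 10 := by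
    rw [hι, one_div, Real.log_inv, mul_neg, neg_neg, mul_comm, Real.exp_mul, Real.exp_log hδ0]
    norm_cast
  -- The deviation level `10 ι` makes each elementary event fail with probability at most a multiple
  -- of `δ ^ 10`; one share `T` is for the noise norms and two for the covariance and offset events.
  have hδ10 : 3 * (T * δ ^ 10) ≤ δ := by
    have h1 : T * δ ^ 10 ≤ 1 * δ ^ 9 := by
      rw [show (T : ℝ) * δ ^ 10 = δ * T * δ ^ 9 by ring]
      gcongr
    have h2 : δ ^ 9 ≤ δ * (1 / 2) ^ 8 := by
      rw [show δ ^ 9 = δ * δ ^ 8 by ring]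
      gcongr
    linarith
  obtain ⟨S₁, hS₁, hP₁, hb⟩ := exists_bounded_noise_event (du := du) N T (10 * ι)
  have hb' : ∀ ξ ∈ S₁, ∀ t < N, t < T → euclNorm (extendZero ξ t) ^ 2 ≤ 2 * du + 40 * ι :=
    fun ξ hξ t ht ht' => (hb ξ hξ t ht ht').trans (le_of_eq (by ring))
  rw [hexp] at hP₁
  have hofReal : ∀ n : ℕ, (n : ℝ≥0∞) * ENNReal.ofReal (δ ^ 10) = ENNReal.ofReal (n * δ ^ 10) := by
    intro n
    rw [ENNReal.ofReal_mul (Nat.cast_nonneg _), ENNReal.ofReal_natCast]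
  rw [hofReal] at hP₁
  have hTδ0 : 0 ≤ T * δ ^ 10 := by positivity
  rcases le_or_gt T N with hTN | hNT
  · refine ⟨S₁, hS₁, real_ge_of_compl_le _ hS₁ hδ0.le (hP₁.trans ?_), fun ξ hξ =>
      ⟨hb' ξ hξ, fun h => absurd h (by omega)⟩⟩
    exact ENNReal.ofReal_le_ofReal (by linarith)
  · have h1 := Q.one_le_h
    have hdu := Q.du_ge
    have hhdu : 1 ≤ (h : ℝ) * du := one_le_mul_of_one_le_of_one_le h1 hdu
    obtain ⟨S₂, hS₂, hP₂, hg⟩ := exists_goodNoise_event h N (s := 1 / (8 * (h * du)))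
      (c := 10 * ι) (by positivity) (by gcongr; linarith) (by linarith [Q.ι_pos]) o
    rw [hexp, hofReal] at hP₂
    refine ⟨S₁ ∩ S₂, hS₁.inter hS₂, real_ge_of_compl_le _ (hS₁.inter hS₂) hδ0.le ?_,
      fun ξ hξ => ⟨hb' ξ hξ.1, fun _ => hg ξ hξ.2⟩⟩
    -- From `h ^ 2 √T d ≤ N < T`.
    have hd : (dy : ℝ) + du ≤ √(T : ℝ) := by
      have h2 : (h : ℝ) ^ 2 * √(T : ℝ) * ((dy : ℝ) + du) ≤ √(T : ℝ) * √(T : ℝ) := by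
        rw [← sq, hθ2]
        exact hN.trans (by exact_mod_cast hNT.le)
      have h3 : (h : ℝ) ^ 2 * ((dy : ℝ) + du) ≤ √(T : ℝ) := by
        refine le_of_mul_le_mul_left ?_ hθ0
        linarith
      refine le_trans (le_mul_of_one_le_left (by linarith [Q.d_ge]) (one_le_pow₀ h1)) h3
    have hcount : ((4 * ((h + 1) * du) ^ 2
        + 2 * ((h + 1) * du * Fintype.card (Fin dy ⊕ Fin du)) : ℕ) : ℝ) ≤ 2 * T := by
      simp only [Fintype.card_sum, Fintype.card_fin]
      push_cast
      have hL := Q.large_dim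
      have e1 : ((h : ℝ) + 1) * du ≤ 2 * (h * du) := by nlinarith
      have e2 : (((h : ℝ) + 1) * du) ^ 2 ≤ (2 * (h * du)) ^ 2 := by gcongr
      have e3 : √(T : ℝ) ≤ T := by
        have := Q.θ_ge
        nlinarith
      have e4 : (h : ℝ) * du ≤ (h : ℝ) ^ 2 * du ^ 2 := by nlinarith
      have e5 : ((h : ℝ) + 1) * du * ((dy : ℝ) + du) ≤ 2 * (h * du) * √(T : ℝ) := by
        gcongr
      have e6 : 4 * (h * du) * √(T : ℝ) ≤ √(T : ℝ) * √(T : ℝ) := by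
        gcongr
        have : 0 ≤ (h : ℝ) ^ 2 * du ^ 2 := by positivity
        linarith
      have e7 : √(T : ℝ) * √(T : ℝ) = T := by rw [← sq, hθ2]
      have e8 : 0 ≤ (h : ℝ) ^ 2 * du ^ 2 := by positivity
      nlinarith
    rw [Set.compl_inter]
    refine (measure_union_le _ _).trans ((add_le_add hP₁ hP₂).trans ?_)
    rw [← ENNReal.ofReal_add hTδ0 (by positivity)]
    refine ENNReal.ofReal_le_ofReal ?_
    have := mul_le_mul_of_nonneg_right hcount (show 0 ≤ δ ^ 10 by positivity)
    linarith

/-- The inequality is rearranged to a lower bound on the infimum, which also covers an empty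
benchmark, where the infimum is `⊤`. -/
theorem controlRegret_le_of_forall {dx dy du : ℕ} {E : Environment dx dy du}
    {K : Matrix (Fin du) (Fin dy) ℝ} {c ρ B : ℝ} {T : ℕ} {uex : ℕ → Fin du → ℝ}
    (h : ∀ π ∈ stabilizing E K c ρ,
      ∑ t ∈ Finset.range T, (E.loss t (E.signal K uex t) - E.loss t (π.signal E t)) ≤ B) :
    controlRegret E K c ρ T uex ≤ (B : EReal) := by
  refine EReal.sub_le_of_le_add ?_
  set S := ∑ t ∈ Finset.range T, E.loss t (E.signal K uex t) with hS
  have h1 : ((S - B : ℝ) : EReal) ≤ ⨅ π ∈ stabilizing E K c ρ,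
      ((∑ t ∈ Finset.range T, E.loss t (π.signal E t) : ℝ) : EReal) := by
    refine le_iInf₂ fun π hπ => ?_
    have := h π hπ
    rw [Finset.sum_sub_distrib] at this
    exact EReal.coe_le_coe_iff.2 (by linarith)
  calc (S : EReal) = (B : EReal) + ((S - B : ℝ) : EReal) := by
        rw [← EReal.coe_add]; congr 1; ring
    _ ≤ _ := by gcongr

theorem IsDrcOnsRun.sum_loss_sub_le {dx dy du : ℕ} {E : Environment dx dy du}
    {K : Matrix (Fin du) (Fin dy) ℝ} {α L Rn cK ρK cs ρs ι ℓ q : ℝ} {T : ℕ} {p : DrcParams}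
    {ξ : Fin p.N → Fin du → ℝ} {uex : ℕ → Fin du → ℝ}
    {Gv : ℕ → Matrix (Fin dy ⊕ Fin du) (Fin du) ℝ} {Gη : ℕ → Matrix (Fin dy) (Fin du) ℝ}
    {z : ℕ → DrcVec p.m dy du} (run : IsDrcOnsRun E K p ξ uex Gv Gη z)
    (Q : Regime p.h du ((dy : ℝ) + du) (cK / (1 - ρK)) (cs / (1 - ρs)) q (1 + opNorm K) Rn ι ℓ
      √(T : ℝ))
    (hα : 0 < α) (hloss : ∀ t, RegularLoss α L (E.loss t)) (hcK : 1 ≤ cK) (hρK0 : 0 < ρK)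
    (hρK1 : ρK < 1) (hG : ∀ i, opNorm (E.markov K i) ≤ cK * ρK ^ i)
    (hnat : ∀ t, ‖E.natureSignal K t‖ ≤ Rn) (hcs : cK ≤ cs) (hρ : ρK ≤ ρs) (hρs : ρs < 1)
    (hmix : ρs ^ p.h ≤ 1 / T) (hm : p.m = 3 * p.h)
    (hR : p.R = 2 * ((1 + opNorm K) * (cs / (1 - ρs))))
    (hlam : p.lam = Rn ^ 2 * ι * √(T : ℝ) + p.h * (cK / (1 - ρK)) ^ 2) (hη : p.η = 3 / α)
    (hN₁ : (p.h : ℝ) ^ 2 * √(T : ℝ) * ((dy : ℝ) + du) ≤ p.N)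
    (hN₂ : (p.N : ℝ) ≤ (p.h : ℝ) ^ 2 * √(T : ℝ) * ((dy : ℝ) + du) + 1)
    (hξ : ∀ t < p.N, t < T → euclNorm (extendZero ξ t) ^ 2 ≤ 2 * du + 40 * ι)
    (hgood : p.N < T → GoodNoise p.h p.N (1 / (8 * (p.h * du))) (10 * ι)
      (fun t => (E.natureSignal K t).ofLp) (extendZero ξ))
    {π : LDC dy du} (hπ : π ∈ stabilizing E K cs ρs) :
    ∑ t ∈ Finset.range T, (E.loss t (E.signal K uex t) - E.loss t (π.signal E t))
      ≤ 2000000 * (((dy : ℝ) + du) ^ 2 * √(T : ℝ) * ((cK / (1 - ρK)) ^ 4 * (cs / (1 - ρs)) ^ 4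
        * q ^ 2 * (1 + opNorm K) ^ 5) * (L ^ 2 / α * Rn ^ 5) * ℓ ^ 3 * ι) := by
  have hs : 0 < 1 - ρs := by linarith
  have hk : 0 < 1 - ρK := by linarith
  have hρs0 : 0 < ρs := by linarith
  have hcs1 : 1 ≤ cs := hcK.trans hcs
  have hθ0 : 0 < √(T : ℝ) := by linarith [Q.θ_ge]
  have hθ2 : √(T : ℝ) ^ 2 = T := Real.sq_sqrt (Nat.cast_nonneg _)
  set b := √(2 * du + 40 * ι) with hb
  have hb0 : 0 ≤ b := Real.sqrt_nonneg _
  have hb2 : b ^ 2 = 2 * du + 40 * ι := Real.sq_sqrt (by linarith [Q.noise_sq_ge])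
  have hu : ∀ t < p.N, t < T → euclNorm (uex t) ≤ b := by
    intro t ht htT
    rw [run.uex_eq ht]
    exact Real.le_sqrt_of_sq_le (hξ t ht htT)
  have ha := sum_opNorm_markov_le hρK0 hρK1 (by linarith) hG
  have hπ₁ := sum_opNorm_exKernel_le hρs0 hρs hcs1 hπ
  have hπ₂ := sum_opNorm_exKernel_mul_le hρs0 hρs hcs1 hπ
  -- If the horizon ends within exploration, no estimate is ever used and boundedness of all signals
  -- is enough.
  rcases le_or_gt T p.N with hTN | hNT
  · exact sum_loss_sub_policy_le_of_le Q hα hloss hTN hN₂ hb0 hb2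
      (fun t ht => hu t (by omega) ht) ha hnat hπ₁
  set ε := √(784 * (Rn ^ 2 * ι / √(T : ℝ))) with hε
  have hι := Q.ι_pos
  have hε0 : 0 ≤ ε := Real.sqrt_nonneg _
  have hε2 : ε ^ 2 = 784 * (Rn ^ 2 * ι / √(T : ℝ)) := Real.sq_sqrt (by positivity)
  set τ := cK * (ρK ^ (p.h + 1) / (1 - ρK)) with hτ
  have hτ0 : 0 ≤ τ := by positivity
  have hτle : τ ≤ cK / (1 - ρK) / √(T : ℝ) ^ 2 := by
    rw [hθ2, hτ, ← mul_div_assoc, mul_div_right_comm, div_eq_mul_one_div _ (T : ℝ)]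
    refine mul_le_mul_of_nonneg_left (le_trans ?_ hmix) (by positivity)
    rw [pow_succ]
    exact (mul_le_of_le_one_right (by positivity) hρK1.le).trans (pow_le_pow_left₀ hρK0.le hρ _)
  have hπ₃ : ∀ n, ∑ i ∈ Finset.range n, opNorm (π.exKernel E K i
      - truncKernel p.h (π.exKernel E K) i) ≤ cs / (1 - ρs) / √(T : ℝ) ^ 2 := by
    intro n
    refine (sum_opNorm_exKernel_sub_trunc_le hρs0 hρs hcs1 hπ Q.h_ge n).trans ?_
    rw [hθ2, ← mul_div_assoc, mul_div_right_comm, div_eq_mul_one_div _ (T : ℝ)]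
    exact mul_le_mul_of_nonneg_left hmix (by positivity)
  have hhN' : (p.h : ℝ) < p.N := by
    have h1 := Q.exploration_length_sub_ge le_rfl
    have h2 : 0 < (p.h : ℝ) ^ 2 * √(T : ℝ) * ((dy : ℝ) + du) := by
      have := Q.one_le_h; have := Q.d_ge; positivity
    linarith
  have hhN : p.h < p.N := by exact_mod_cast hhN'
  have hn : (p.h : ℝ) ^ 2 * √(T : ℝ) * ((dy : ℝ) + du) - p.h ≤ ((p.N - p.h : ℕ) : ℝ) := by
    rw [Nat.cast_sub hhN.le]; linarith
  have hx := (hgood hNT).congr (x' := uex) fun t ht => run.uex_eq ht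
  have hβ := Q.covariance_error_le hn rfl
  have hlift := estimate_eq_lift run.est_v run.est_η hx hhN hβ
  have herr := estimation_error run.est_v run.est_η hx hhN hβ (by positivity)
    (by linarith [Q.Rn_ge]) hb0 (by linarith) hρK0 hρK1 hG hnat
    (fun t ht => hu t ht (ht.trans hNT))
  have hest : ∀ n, ∑ i ∈ Finset.range n,
      opNorm (feedbackLift K * (E.outputMarkov K i - Gη i)) ≤ ε := fun n =>
    ((sum_opNorm_estimate_le hρK0 hρK1 (by linarith) run.est_η.1 run.est_η.2.1 hG n).trans
      (add_le_add_left herr _)).trans (Q.estimation_error_le hn hτ0 hτle hε0 hε2 hb2)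
  have hsmall := Q.error_le hε0 hε2
  have hεa : ε ≤ cK / (1 - ρK) := by
    refine le_trans ?_ Q.a_ge
    have := mul_le_mul_of_nonneg_right Q.r_ge hε0
    linarith
  have hr0 : 0 ≤ (1 + opNorm K) * (cs / (1 - ρs)) :=
    mul_nonneg (by linarith [Q.κ_ge]) (by linarith [Q.r_ge])
  have P := run.controlPhase (T := T) hlift ha hest hnat hb0 (by rw [hR]; linarith) hu
    (by rw [hR]; exact Q.radius_mul_error_le hε2) (Q.error_mul_noise_le hε2 hb2) hεa
  rw [hη] at P
  refine P.sum_loss_sub_policy_le hm Q hθ2.symm hR hlam hα hloss hNT.le hN₂ hb2 hε0 hε2 hest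
    (fun n => ?_) hπ₁ hπ₂ hπ₃
  exact (sum_opNorm_estimate_tail_le hρK0 hρK1 (by linarith) run.est_η.2.1 hG n).trans hτle


end

theorem mainTheorem4 :
    ∃ c > (0 : ℝ), ∃ C > (0 : ℝ),
      ∀ (dx dy du : ℕ) (E : Environment dx dy du) (K : Matrix (Fin du) (Fin dy) ℝ)
        (α L Rnat cK ρK cs ρs δ : ℝ) (T : ℕ) (p : DrcParams),
        -- losses
        0 < α → (∀ t, RegularLoss α L (E.loss t)) →
        -- the nominal feedback is stabilizing, and nature's iterates are bounded
        0 < cK → 0 < ρK → ρK < 1 → (∀ i, opNorm (E.markov K i) ≤ cK * ρK ^ i) →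
        1 ≤ Rnat → (∀ t, ‖E.natureSignal K t‖ ≤ Rnat) →
        -- comparator parameters
        cK ≤ cs → ρK ≤ ρs → ρs < 1 →
        -- horizon and failure probability
        2 ≤ T → 0 < δ → δ < 1 / (T : ℝ) →
        c * Real.log T ^ 2 *
            ((1 - ρs)⁻¹ ^ 6 * cs ^ 4 * (1 + opNorm K) ^ 2 * Rnat ^ 2 * Real.log (1 / δ) ^ 2
              + (1 - ρs)⁻¹ ^ 2 * (du : ℝ) ^ 2) ≤ √(T : ℝ) →
        -- algorithm parameters
        p.h = ⌈(1 - ρs)⁻¹ * Real.log T⌉₊ →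
        p.m = 3 * p.h →
        p.R = 2 * ((1 + opNorm K) * cs / (1 - ρs)) →
        p.lam = Rnat ^ 2 * Real.log (1 / δ) * √(T : ℝ) + p.h * cK ^ 2 / (1 - ρK) ^ 2 →
        p.η = 3 / α →
        p.N = ⌈(p.h : ℝ) ^ 2 * √(T : ℝ) * ((dy : ℝ) + du)⌉₊ →
        -- regret bound with probability at least `1 - δ`
        ∃ S : Set (Fin p.N → Fin du → ℝ), MeasurableSet S ∧
          1 - δ ≤ (explorationLaw p.N du).real S ∧
          ∀ ξ ∈ S, ∀ uex Gv Gη z, IsDrcOnsRun E K p ξ uex Gv Gη z →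
            controlRegret E K cs ρs T uex ≤
              ((C * ((dy : ℝ) + du) ^ 2 * √(T : ℝ)
                * (cK ^ 4 * cs ^ 4 * (1 + opNorm K) ^ 5 / ((1 - ρK) ^ 4 * (1 - ρs) ^ 6))
                * (L ^ 2 * Rnat ^ 5 / α)
                * Real.log (1 + T) ^ 3 * Real.log (1 / δ) : ℝ) : EReal) := by
  refine ⟨10 ^ 8, by norm_num, 2000000, by norm_num, ?_⟩
  intro dx dy du E K α L Rnat cK ρK cs ρs δ T p hα hloss hcK hρK0 hρK1 hG hRn hnat hcs hρ hρs hT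
    hδ0 hδ hlarge hh hm hR hlam hη hN
  have hs : 0 < 1 - ρs := by linarith
  have hk : 0 < 1 - ρK := by linarith
  have hT2 : (2 : ℝ) ≤ T := by exact_mod_cast hT
  have hδ1 : 1 ≤ 1 / δ := by
    rw [le_div_iff₀ hδ0]
    have := hδ.le.trans ((div_le_one (by linarith)).2 (show (1 : ℝ) ≤ T by linarith))
    linarith
  -- Without inputs there is only one possible input sequence, so each policy has the same signals
  -- as the run. This case is separated because `1 ≤ cK` and `α ≤ L` need a nontrivial input space.
  rcases Nat.eq_zero_or_pos du with hdu | hdu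
  · subst hdu
    refine ⟨Set.univ, MeasurableSet.univ, by rw [probReal_univ]; linarith, ?_⟩
    intro ξ _ uex Gv Gη z _
    refine controlRegret_le_of_forall fun π _ => ?_
    have h0 : ∑ t ∈ Finset.range T, (E.loss t (E.signal K uex t) - E.loss t (π.signal E t)) = 0 := by
      refine Finset.sum_eq_zero fun t _ => ?_
      rw [π.signal_eq E K, Subsingleton.elim uex (π.exInput E K), sub_self]
    rw [h0]
    have h1 := opNorm_nonneg K
    have h2 := Real.log_nonneg hδ1
    have h3 : 0 ≤ Real.log (1 + T) := Real.log_nonneg (by linarith)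
    positivity
  have hcK1 := one_le_of_markov_le hdu hG
  have Q := regime_of_large (dy := dy) hdu hcK1 hρK0 hcs hρ hρs
    (show 1 ≤ 1 + opNorm K by linarith [opNorm_nonneg K]) hRn hT hδ0 hδ hlarge hh
  have hN₁ : (p.h : ℝ) ^ 2 * √(T : ℝ) * ((dy : ℝ) + du) ≤ p.N := by
    rw [hN]; exact Nat.le_ceil _
  have hN₂ : (p.N : ℝ) ≤ (p.h : ℝ) ^ 2 * √(T : ℝ) * ((dy : ℝ) + du) + 1 := by
    rw [hN]; exact (Nat.ceil_lt_add_one (by positivity)).le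
  obtain ⟨S, hS, hP, hgood⟩ := exists_exploration_event Q hT hδ0 hδ hN₁
    fun t => (E.natureSignal K t).ofLp
  refine ⟨S, hS, hP, fun ξ hξ uex Gv Gη z run => controlRegret_le_of_forall fun π hπ => ?_⟩
  refine (run.sum_loss_sub_le Q hα hloss hcK1 hρK0 hρK1 hG hnat hcs hρ hρs
    (pow_mixing_le (by linarith) hρs hT hh) hm (by rw [hR, mul_div_assoc])
    (by rw [hlam, div_pow, mul_div_assoc (p.h : ℝ)]) hη hN₁ hN₂ (hgood ξ hξ).1 (hgood ξ hξ).2 hπ).trans (le_of_eq ?_)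
  field_simp
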